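/- **Setting.** For every $n\ge 1$ let $\boldsymbol d=\boldsymbol d^{(n)}=(d_1,\dots,d_n)$ be a sequence of non-negative integers with even sum $\ell_n=\sum_v d_v$. Give vertex $v\in[n]$ exactly $d_v$ half-edges and pair all $\ell_n$ half-edges by a uniformly random perfect matching; the resulting random multigraph is the configuration model $\mathrm{CM}_n(\boldsymbol d)$. Let $D_n$ be the degree of a uniformly chosen vertex, let $n_i$ be the number of vertices of degree $i$, and let $d_{\max}=\max_v d_v$. Assume that: 1. $D_n\xrightarrow{d}D$ for some (finite) random variable $D$; 2. $n_0=0$ for all $n$; 3. $n_1/\sqrt n\to\rho_1\in[0,\infty)$; 4. $n_2/n\to p_2\in[0,1)$; 5. $\mathbb E[D_n]\to d<\infty$; 6. $\nu_n=\mathbb E[D_n(D_n-1)]/\mathbb E[D_n]\to\nu\in[0,\infty]$; 7. if $\nu<\infty$, then $d_{\max}=o(\sqrt n)$. (For $\nu<\infty$ this holds in particular whenever $\nu=\mathbb E[D(D-1)]/\mathbb E[D]$, i.e. when the second moments of $D_n$ converge to the finite second moment of $D$.) Let $L_k(n)$, $k\ge 2$, be the number of lines of length $k$, i.e. of connected components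 consisting of $2$ vertices of degree $1$ and $k-2$ vertices of degree $2$. Let $C_k(n)$, $k\ge3$, be the number of cycles of length $k$, i.e. of connected components consisting of $k$ vertices of degree $2$. Let $S(n)$ be the number of self-loops, and let $M(n)=\sum_{u<v}(X_{uv}-1)\mathbf 1_{\{X_{uv}\ge2\}}$ be the number of multiple edges, where $X_{uv}$ is the number of edges between $u$ and $v$. **Theorem (Poisson convergence of the number of self-loops and multiple edges).** Under these assumptions, as $n\to\infty$, $$\big((L_k(n))_{k\ge2},(C_k(n))_{k\ge3},S(n),M(n)\big)\xrightarrow{d}\big((L_k)_{k\ge2},(C_k)_{k\ge3},S,M\big)$$ in the product topology, where all the variables on the right-hand side are independent and $$L_k\sim\mathsf{Poi}\Big(\frac{\rho_1^2(2p_2)^{k-2}}{2d^{k-1}}\Big),\quad C_k\sim\mathsf{Poi}\Big(\frac{(2p_2)^k}{2k\,d^k}\Big),\quad S\sim\mathsf{Poi}(\nu/2),\quad M\sim\mathsf{Poi}(\nu^2/4),$$ with the conventions $0^0=1$ and, when $\nu=\infty$, $\mathsf{Poi}(\infty)=\delta_\infty$ (convergence is then in $\mathbb N\cup\{\infty\}$,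 i.e. $S(n),M(n)\to\infty$ in probability). -/

import Mathlib

open MeasureTheory ProbabilityTheory Filter Topology
open scoped NNReal ENNReal

namespace ConfigModel

/-- A degree sequence on the vertex set `Fin n`, with even total degree. -/
structure DegreeSequence (n : ℕ) where
  deg : Fin n → ℕ
  even_sum : Even (∑ v, deg v)

namespace DegreeSequence

variable {n : ℕ} (d : DegreeSequence n)

/-- `n_k`: the number of vertices of degree `k`. -/
def numDeg (k : ℕ) : ℕ := (Finset.univ.filter fun v => d.deg v = k).card

/-- The largest degree. -/
def maxDeg : ℕ := Finset.univ.sup d.deg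

/-- `E[D_n]`, where `D_n` is the degree of a uniformly chosen vertex. -/
noncomputable def meanDeg : ℝ := (∑ v, (d.deg v : ℝ)) / n

/-- `E[D_n (D_n - 1)]`, where `D_n` is the degree of a uniformly chosen vertex. -/
noncomputable def meanDegPairs : ℝ := (∑ v, (d.deg v : ℝ) * ((d.deg v : ℝ) - 1)) / n

/-- `ν_n = E[D_n (D_n - 1)] / E[D_n]`. -/
noncomputable def nu : ℝ := d.meanDegPairs / d.meanDeg

/-- Half-edges: vertex `v` carries `deg v` of them. -/
abbrev HalfEdge : Type := Σ v : Fin n, Fin (d.deg v)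

/-- A perfect pairing of the half-edges, as a fixed-point-free involution: `σ h` is the
half-edge that `h` is paired with. -/
def Pairing : Type :=
  {σ : Equiv.Perm d.HalfEdge // (∀ h, σ (σ h) = h) ∧ ∀ h, σ h ≠ h}

noncomputable instance : Fintype d.Pairing := by
  classical
  unfold Pairing
  infer_instance

instance : MeasurableSpace d.Pairing := ⊤

instance : DiscreteMeasurableSpace d.Pairing := ⟨fun _ => trivial⟩

instance : Nonempty d.Pairing := by
  obtain ⟨m, hm⟩ := d.even_sum
  have hc : Fintype.card d.HalfEdge = Fintype.card (Fin m × Bool) := by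
    simp [HalfEdge, hm, mul_two]
  let e : d.HalfEdge ≃ Fin m × Bool := Fintype.equivOfCardEq hc
  let τ : Equiv.Perm (Fin m × Bool) := Equiv.prodCongr (Equiv.refl _) Equiv.boolNot
  refine ⟨⟨(e.trans τ).trans e.symm, fun h => ?_, fun h hh => ?_⟩⟩
  · have h2 : ∀ x, τ (τ x) = x := fun ⟨a, b⟩ => by simp [τ, Equiv.boolNot]
    simp only [Equiv.trans_apply, Equiv.apply_symm_apply, h2, Equiv.symm_apply_apply]
  · have h2 : τ (e h) = e h := by simpa using congrArg e hh
    have h3 := congrArg Prod.snd h2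
    simp [τ, Equiv.boolNot] at h3

/-- The law of the configuration model: the uniform distribution on pairings. -/
noncomputable def cmMeasure : Measure d.Pairing := uniformOn Set.univ

instance : IsProbabilityMeasure d.cmMeasure :=
  isProbabilityMeasure_uniformOn Set.finite_univ Set.univ_nonempty

variable {d} (σ : d.Pairing)

/-- The edges of the multigraph: the unordered pairs of half-edges that are matched. -/
def edges : Finset (Sym2 d.HalfEdge) := Finset.univ.image fun h => s(h, σ.1 h)

/-- The unordered pair of vertices (possibly equal) joined by a pair of half-edges. -/
def ends (e : Sym2 d.HalfEdge) : Sym2 (Fin n) := e.map Sigma.fst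

/-- The number of edges with pair of end points `z`. -/
def mult (z : Sym2 (Fin n)) : ℕ := ((edges σ).filter fun e => ends e = z).card

/-- `S(n)`: the number of self-loops. -/
def selfLoops : ℕ := ((edges σ).filter fun e => (ends e).IsDiag).card

/-- `M(n)`: the number of multiple edges. If `X_{uv}` is the number of edges between `u` and `v`,
this is `∑_{u < v} (X_{uv} - 1) 1_{X_{uv} ≥ 2}`. -/
def multiEdges : ℕ := ∑ z : Sym2 (Fin n) with ¬ z.IsDiag, (mult σ z - 1)

/-- The simple graph underlying the multigraph; it has the same connected components. -/
def graph : SimpleGraph (Fin n) := SimpleGraph.fromEdgeSet {z | ∃ e ∈ edges σ, ends e = z}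

/-- `C_k(n)`: the number of connected components consisting of `k` vertices of degree 2. -/
noncomputable def cycles (k : ℕ) : ℕ :=
  Set.ncard {c : (graph σ).ConnectedComponent |
    c.supp.ncard = k ∧ ∀ v ∈ c.supp, d.deg v = 2}

/-- `L_k(n)` for `k ≥ 2`: the number of connected components consisting of 2 vertices of degree 1
and `k - 2` vertices of degree 2. -/
noncomputable def lines (k : ℕ) : ℕ :=
  Set.ncard {c : (graph σ).ConnectedComponent |
    c.supp.ncard = k ∧ {v ∈ c.supp | d.deg v = 1}.ncard = 2 ∧
      {v ∈ c.supp | d.deg v = 2}.ncard = k - 2}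

end DegreeSequence

/-- Indices of the family `((L_k)_{k ≥ 2}, (C_k)_{k ≥ 3}, S, M)`. -/
inductive CountIndex : Type
  | line (k : ℕ) (hk : 2 ≤ k)
  | cycle (k : ℕ) (hk : 3 ≤ k)
  | selfLoops
  | multiEdges

instance : OpensMeasurableSpace ℕ∞ := ⟨fun _ _ => trivial⟩

instance : Countable CountIndex := by
  let f : CountIndex → ℕ ⊕ ℕ ⊕ Bool := fun
    | .line k _ => .inl k
    | .cycle k _ => .inr (.inl k)
    | .selfLoops => .inr (.inr true)
    | .multiEdges => .inr (.inr false)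
  refine Function.Injective.countable (f := f) fun a b h => ?_
  cases a <;> cases b <;> simp_all [f]

/-- The family `((L_k(n))_{k ≥ 2}, (C_k(n))_{k ≥ 3}, S(n), M(n))`. The values are viewed in `ℕ∞`
so that the infinite limits of `S(n)` and `M(n)` in the case `ν = ∞` are covered too. -/
noncomputable def counts {n : ℕ} {d : DegreeSequence n} (σ : d.Pairing) : CountIndex → ℕ∞
  | .line k _ => (DegreeSequence.lines σ k : ℕ∞)
  | .cycle k _ => (DegreeSequence.cycles σ k : ℕ∞)
  | .selfLoops => (DegreeSequence.selfLoops σ : ℕ∞)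
  | .multiEdges => (DegreeSequence.multiEdges σ : ℕ∞)

/-- The Poisson distribution with mean `r ∈ [0, ∞]`, on `ℕ∞`; for `r = ∞` it is the point mass
at `∞`. -/
noncomputable def poisson (r : ℝ≥0∞) : Measure ℕ∞ :=
  if r = ∞ then Measure.dirac ⊤ else (poissonMeasure r.toNNReal).map (fun m : ℕ => (m : ℕ∞))

instance (r : ℝ≥0∞) : IsProbabilityMeasure (poisson r) := by
  unfold poisson
  split_ifs
  · infer_instance
  · exact Measure.isProbabilityMeasure_map .of_discrete

/-- The means of the limiting variables `((L_k)_{k ≥ 2}, (C_k)_{k ≥ 3}, S, M)`. -/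
noncomputable def limitMean (ρ₁ p₂ dbar : ℝ≥0) (ν : ℝ≥0∞) : CountIndex → ℝ≥0∞
  | .line k _ => ((ρ₁ ^ 2 * (2 * p₂) ^ (k - 2) / (2 * dbar ^ (k - 1)) : ℝ≥0) : ℝ≥0∞)
  | .cycle k _ => (((2 * p₂) ^ k / (2 * k * dbar ^ k) : ℝ≥0) : ℝ≥0∞)
  | .selfLoops => ν / 2
  | .multiEdges => ν ^ 2 / 4

instance (n : ℕ+) : IsProbabilityMeasure (uniformOn (Set.univ : Set (Fin n))) :=
  isProbabilityMeasure_uniformOn Set.finite_univ Set.univ_nonempty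

/-- The critical window for connectivity, with `lim n_1 / √n = ρ₁`, `lim n_2 / n = p₂` and
`lim E[D_n] = dbar`. -/
structure CriticalWindow (d : (n : ℕ+) → DegreeSequence n) (ρ₁ p₂ dbar : ℝ≥0) : Prop where
  /-- `D_n` converges in distribution to some (finite) random variable `D`, of law `μ`. -/
  tendsto_degree : ∃ μ : ProbabilityMeasure ℕ,
    TendstoInDistribution (fun (n : ℕ+) (v : Fin n) => (d n).deg v) atTop (id : ℕ → ℕ)
      (fun _ => uniformOn Set.univ) (μ : Measure ℕ)
  numDeg_zero : ∀ n, (d n).numDeg 0 = 0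
  tendsto_numDeg_one :
    Tendsto (fun n : ℕ+ => ((d n).numDeg 1 : ℝ) / √(n : ℝ)) atTop (𝓝 (ρ₁ : ℝ))
  tendsto_numDeg_two :
    Tendsto (fun n : ℕ+ => ((d n).numDeg 2 : ℝ) / (n : ℝ)) atTop (𝓝 (p₂ : ℝ))
  p₂_lt_one : p₂ < 1
  tendsto_meanDeg : Tendsto (fun n : ℕ+ => (d n).meanDeg) atTop (𝓝 (dbar : ℝ))

end ConfigModel

namespace ConfigModel
namespace DegreeSequence

variable {n : ℕ} {d : DegreeSequence n}

/-! ### Partial matchings and switchings -/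

/-! Each quantity in the theorem counts, at least up to an event of vanishing probability, the
patterns that occur: a pattern is a set of disjoint pairs of half-edges, and it occurs if the random
matching contains it. With `ℓ` half-edges, a pattern of `r` edges occurs with probability
`1/((ℓ-1)(ℓ-3)⋯(ℓ-2r+1))`, so disjoint patterns are nearly independent, and Stein's method applies.

The coupling is a switching: pair `a` with `b`, and pair their former partners. Composing switchings
(`exists_forcing`) gives a map `T` such that `T σ` has the law of `σ` conditioned to contain `α`,
while every edge of `σ` that avoids the half-edges of `α` survives. Hence `(x_i + 1) P(N = x + e_i)
= Σ_α P(α) P(N(T σ) = x + e_i)`, the sum being over patterns of type `i`. Here `N(T σ) = N(σ) + e_i`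
unless `α` was already there or `T` changes the status of another pattern. A pattern with half-edges
disjoint from those of `α` can only be created, never destroyed, so the expected change is a small
covariance (`abs_stein_le`). In the limit `(x_i + 1) p(x + e_i) = λ_i p(x)`; together with tightness
from Markov's inequality this forces a product of Poisson laws (`tendsto_of_stein`,
`tendsto_prob_patternCount`).

Three inputs are needed: convergent means, a vanishing expected number of patterns through any given
half-edge, and a vanishing expected number of distinct overlapping patterns that occur together.
Lines and cycles are followed by a deterministic walk through vertices of degree at most two, which
identifies such components with occurring patterns (`ncard_isComp`). There are about `n_1² (2
n_2)^(k-2)` labelled lines, each line counted twice, and `(2 n_2)^k` labelled cycles, each cycle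
counted `2k` times. Distinct patterns that occur together share no edge, except pairs of parallel
edges inside a triple edge (`patterns_overlap`). The expected number of triples is at most `d_max²
(Σ d(d-1))² / oddProd d 3`, which tends to zero when `d_max = o(√n)` and `ν < ∞`; this also allows
`M(n)` to be replaced by the number of pairs of parallel edges.

If `ν = ∞`, the second moment method gives divergence of `S(n)` and `M(n)`
(`tendsto_prob_patternCount_lt`). For `M(n)` it is run on a subfamily of double edges, the hub
patterns, any two of which are disjoint or incompatible; this needs no bound on `d_max`. Coordinates
with the constant limit `∞` do not affect the joint limit of the others
(`tendstoInDistribution_poisson`). -/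

lemma mk_mem_edges {σ : d.Pairing} {a b : d.HalfEdge} : s(a, b) ∈ edges σ ↔ σ.1 a = b := by
  simp only [edges, Finset.mem_image, Finset.mem_univ, true_and, Sym2.eq_iff]
  constructor
  · rintro ⟨h, ⟨rfl, rfl⟩ | ⟨rfl, rfl⟩⟩
    · rfl
    · exact σ.2.1 h
  · rintro rfl
    exact ⟨a, Or.inl ⟨rfl, rfl⟩⟩

/-- A set of unordered pairs of half-edges that are proper and pairwise disjoint. -/
def IsPartialMatching (α : Finset (Sym2 d.HalfEdge)) : Prop :=
  (∀ e ∈ α, ¬ e.IsDiag) ∧ ∀ e ∈ α, ∀ f ∈ α, ∀ h, h ∈ e → h ∈ f → e = f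

lemma isPartialMatching_edges (σ : d.Pairing) : IsPartialMatching (edges σ) := by
  refine ⟨fun e he => ?_, fun e he f hf h h1 h2 => ?_⟩
  · induction e with | _ a b =>
    rw [mk_mem_edges] at he
    rw [Sym2.mk_isDiag_iff]
    rintro rfl
    exact σ.2.2 _ he
  · obtain ⟨a, rfl⟩ := h1
    obtain ⟨b, rfl⟩ := h2
    rw [mk_mem_edges] at he hf
    rw [← he, ← hf]

lemma IsPartialMatching.mono {α β : Finset (Sym2 d.HalfEdge)} (h : IsPartialMatching β)
    (hs : α ⊆ β) : IsPartialMatching α :=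
  ⟨fun e he => h.1 e (hs he), fun e he f hf => h.2 e (hs he) f (hs hf)⟩

/-- The half-edges covered by a set of pairs. -/
def cover (α : Finset (Sym2 d.HalfEdge)) : Finset d.HalfEdge := α.biUnion Sym2.toFinset

lemma mem_cover {α : Finset (Sym2 d.HalfEdge)} {h : d.HalfEdge} :
    h ∈ cover α ↔ ∃ e ∈ α, h ∈ e := by
  simp [cover]

lemma card_cover {α : Finset (Sym2 d.HalfEdge)} (hα : IsPartialMatching α) :
    (cover α).card = 2 * α.card := by
  rw [cover, Finset.card_biUnion]
  · rw [Finset.sum_congr rfl fun e he => Sym2.card_toFinset_of_not_isDiag e (hα.1 e he)]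
    simp [mul_comm]
  · intro e he f hf hef
    rw [Function.onFun, Finset.disjoint_left]
    intro h h1 h2
    exact hef (hα.2 e he f hf h (Sym2.mem_toFinset.1 h1) (Sym2.mem_toFinset.1 h2))

lemma IsPartialMatching.union {α β : Finset (Sym2 d.HalfEdge)} (hα : IsPartialMatching α)
    (hβ : IsPartialMatching β) (h : Disjoint (cover α) (cover β)) :
    IsPartialMatching (α ∪ β) := by
  rw [Finset.disjoint_left] at h
  refine ⟨fun e he => ?_, fun e he f hf x hx hy => ?_⟩
  · rcases Finset.mem_union.1 he with he | he
    exacts [hα.1 e he, hβ.1 e he]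
  · rcases Finset.mem_union.1 he with he | he <;> rcases Finset.mem_union.1 hf with hf | hf
    · exact hα.2 e he f hf x hx hy
    · exact absurd (mem_cover.2 ⟨f, hf, hy⟩) (h (mem_cover.2 ⟨e, he, hx⟩))
    · exact absurd (mem_cover.2 ⟨e, he, hx⟩) (h (mem_cover.2 ⟨f, hf, hy⟩))
    · exact hβ.2 e he f hf x hx hy

/-- Conjugate a pairing by a permutation of the half-edges. -/
def conj (τ : Equiv.Perm d.HalfEdge) (σ : d.Pairing) : d.Pairing :=
  ⟨τ⁻¹ * σ.1 * τ, fun h => by simp [σ.2.1], fun h => by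
    simp only [Equiv.Perm.coe_mul, Function.comp_apply, ne_eq, Equiv.Perm.inv_eq_iff_eq]
    exact σ.2.2 _⟩

lemma conj_swap_conj_swap (a b : d.HalfEdge) (σ : d.Pairing) :
    conj (Equiv.swap a b) (conj (Equiv.swap a b) σ) = σ := by
  apply Subtype.ext
  simp only [conj, Equiv.swap_inv]
  ext1 h
  simp

lemma mk_mem_edges_conj {τ : Equiv.Perm d.HalfEdge} {σ : d.Pairing} {a b : d.HalfEdge} :
    s(a, b) ∈ edges (conj τ σ) ↔ σ.1 (τ a) = τ b := by
  rw [mk_mem_edges]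
  simp [conj, Equiv.symm_apply_eq]

lemma mem_edges_conj_swap {a b : d.HalfEdge} {σ : d.Pairing} {e : Sym2 d.HalfEdge}
    (ha : a ∉ e) (hb : b ∉ e) : e ∈ edges (conj (Equiv.swap a b) σ) ↔ e ∈ edges σ := by
  induction e with | _ x y =>
  rw [Sym2.mem_iff, not_or] at ha hb
  rw [mk_mem_edges_conj, mk_mem_edges, Equiv.swap_apply_of_ne_of_ne (Ne.symm ha.1) (Ne.symm hb.1),
    Equiv.swap_apply_of_ne_of_ne (Ne.symm ha.2) (Ne.symm hb.2)]

/-- The switching of `σ` that pairs `a` with `b`, and pairs their former partners. -/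
def switch (a b : d.HalfEdge) (σ : d.Pairing) : d.Pairing := conj (Equiv.swap b (σ.1 a)) σ

lemma apply_left_switch {a b : d.HalfEdge} (hab : a ≠ b) (σ : d.Pairing) :
    s(a, b) ∈ edges (switch a b σ) := by
  rw [switch, mk_mem_edges_conj, Equiv.swap_apply_of_ne_of_ne hab (σ.2.2 a).symm]
  simp

lemma mem_edges_switch {a b : d.HalfEdge} {σ : d.Pairing} {e : Sym2 d.HalfEdge}
    (he : e ∈ edges σ) (ha : a ∉ e) (hb : b ∉ e) : e ∈ edges (switch a b σ) := by
  rw [switch, mem_edges_conj_swap hb]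
  · exact he
  · rintro ⟨c, rfl⟩
    rw [mk_mem_edges, σ.2.1] at he
    exact ha (he ▸ Sym2.mem_mk_right _ _)

/-- The number `∏_{i<r} (ℓ - 1 - 2 i)`, where `ℓ` is the number of half-edges. -/
def oddProd (d : DegreeSequence n) (r : ℕ) : ℝ :=
  ∏ i ∈ Finset.range r, ((Fintype.card d.HalfEdge : ℝ) - 1 - 2 * i)

/-- The pairings containing `α` are split by the partner `c` of `a`. For fixed `c`, conjugation by
the transposition of `b` and `c` is an involution carrying the class `σ a = c` onto the class `σ a =
b`. All half-edges outside `cover α` and different from `a` are possible values of `c`, including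
`b` itself, which gives the factor. -/
lemma sum_switch {α : Finset (Sym2 d.HalfEdge)} (hα : IsPartialMatching α) {a b : d.HalfEdge}
    (hab : a ≠ b) (ha : a ∉ cover α) (hb : b ∉ cover α) (F : d.Pairing → ℝ) :
    ∑ σ with α ⊆ edges σ, F (switch a b σ) =
      ((Fintype.card d.HalfEdge : ℝ) - 1 - 2 * α.card) *
        ∑ σ with insert s(a, b) α ⊆ edges σ, F σ := by
  classical
  have key : ∀ c ∈ Finset.univ \ insert a (cover α),
      ∑ σ with α ⊆ edges σ ∧ σ.1 a = c, F (switch a b σ) =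
        ∑ σ with insert s(a, b) α ⊆ edges σ, F σ := by
    intro c hc
    simp only [Finset.mem_sdiff, Finset.mem_univ, Finset.mem_insert, true_and, not_or] at hc
    have h1 : ∀ σ : d.Pairing, α ⊆ edges (conj (Equiv.swap b c) σ) ↔ α ⊆ edges σ := by
      intro σ
      refine forall₂_congr fun e he => mem_edges_conj_swap ?_ ?_
      · exact fun h => hb (mem_cover.2 ⟨e, he, h⟩)
      · exact fun h => hc.2 (mem_cover.2 ⟨e, he, h⟩)
    refine Finset.sum_bij' (fun σ _ => conj (Equiv.swap b c) σ)
      (fun σ _ => conj (Equiv.swap b c) σ) ?_ ?_ ?_ ?_ ?_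
    · intro σ hσ
      simp only [Finset.mem_filter, Finset.mem_univ, true_and] at hσ
      simp only [Finset.mem_filter, Finset.mem_univ, true_and, Finset.insert_subset_iff, h1,
        mk_mem_edges_conj]
      rw [Equiv.swap_apply_of_ne_of_ne hab (Ne.symm hc.1)]
      simpa using hσ.symm
    · intro σ hσ
      simp only [Finset.mem_filter, Finset.mem_univ, true_and, Finset.insert_subset_iff] at hσ
      simp only [Finset.mem_filter, Finset.mem_univ, true_and, h1, ← mk_mem_edges,
        mk_mem_edges_conj]
      rw [Equiv.swap_apply_of_ne_of_ne hab (Ne.symm hc.1)]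
      rw [Equiv.swap_apply_right]
      exact hσ.symm
    · exact fun σ _ => conj_swap_conj_swap _ _ _
    · exact fun σ _ => conj_swap_conj_swap _ _ _
    · intro σ hσ
      simp only [Finset.mem_filter, Finset.mem_univ, true_and] at hσ
      rw [switch, hσ.2]
  have hcard : ((Finset.univ \ insert a (cover α)).card : ℝ) =
      (Fintype.card d.HalfEdge : ℝ) - 1 - 2 * α.card := by
    rw [Finset.cast_card_sdiff (Finset.subset_univ _), Finset.card_insert_of_notMem ha,
      card_cover hα, Finset.card_univ]
    push_cast; ring
  rw [← hcard, ← nsmul_eq_mul, ← Finset.sum_const, ← Finset.sum_congr rfl key]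
  have hmap : ∀ σ ∈ Finset.univ.filter (fun σ : d.Pairing => α ⊆ edges σ),
      σ.1 a ∈ Finset.univ \ insert a (cover α) := by
    intro σ hσ
    simp only [Finset.mem_filter, Finset.mem_univ, true_and] at hσ
    simp only [Finset.mem_sdiff, Finset.mem_univ, Finset.mem_insert, true_and, not_or]
    refine ⟨σ.2.2 a, fun h => ha ?_⟩
    obtain ⟨e, he, c, rfl⟩ := mem_cover.1 h
    have := hσ he
    rw [mk_mem_edges, σ.2.1] at this
    exact mem_cover.2 ⟨_, he, this ▸ Sym2.mem_mk_right _ _⟩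
  rw [← Finset.sum_fiberwise_of_maps_to hmap]
  simp only [Finset.filter_filter]

/-- A partial matching can be forced into a uniform pairing without destroying edges
disjoint from it; the result is uniform among the pairings that contain it. -/
theorem exists_forcing {α : Finset (Sym2 d.HalfEdge)} (hα : IsPartialMatching α) :
    ∃ T : d.Pairing → d.Pairing, (∀ σ, α ⊆ edges (T σ)) ∧
      (∀ σ, ∀ e ∈ edges σ, (∀ h ∈ e, h ∉ cover α) → e ∈ edges (T σ)) ∧
      ∀ F : d.Pairing → ℝ,
        ∑ σ, F (T σ) = oddProd d α.card * ∑ σ with α ⊆ edges σ, F σ := by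
  classical
  induction α using Finset.induction_on with
  | empty => exact ⟨id, by simp, fun σ e he _ => he, by simp [oddProd]⟩
  | insert e α he ih =>
    obtain ⟨T, h1, h2, h3⟩ := ih (hα.mono (Finset.subset_insert _ _))
    induction e with | _ a b =>
    have hab : a ≠ b := fun h => hα.1 _ (Finset.mem_insert_self _ _) (by simpa using h)
    have hnot : ∀ x ∈ s(a, b), ∀ f ∈ α, x ∉ f := fun x hx f hf hxf => by
      have := hα.2 _ (Finset.mem_insert_self _ _) f (Finset.mem_insert_of_mem hf) x hx hxf
      exact he (this ▸ hf)
    have ha : ∀ f ∈ α, a ∉ f := hnot a (Sym2.mem_mk_left _ _)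
    have hb : ∀ f ∈ α, b ∉ f := hnot b (Sym2.mem_mk_right _ _)
    -- The edges of `α` are forced one at a time; a later switching moves only edges at `a` or `b`,
    -- so it leaves the edges already forced in place.
    refine ⟨fun σ => switch a b (T σ), fun σ => ?_, fun σ f hf hfc => ?_, fun F => ?_⟩
    · rw [Finset.insert_subset_iff]
      exact ⟨apply_left_switch hab _, fun f hf => mem_edges_switch (h1 σ hf) (ha f hf) (hb f hf)⟩
    · refine mem_edges_switch (h2 σ f hf fun h hh hc => hfc h hh ?_) ?_ ?_
      · obtain ⟨g, hg, hhg⟩ := mem_cover.1 hc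
        exact mem_cover.2 ⟨g, Finset.mem_insert_of_mem hg, hhg⟩
      · exact fun h => hfc a h (mem_cover.2 ⟨_, Finset.mem_insert_self _ _, Sym2.mem_mk_left _ _⟩)
      · exact fun h => hfc b h (mem_cover.2 ⟨_, Finset.mem_insert_self _ _, Sym2.mem_mk_right _ _⟩)
    · rw [h3 fun σ => F (switch a b σ), sum_switch (hα.mono (Finset.subset_insert _ _)) hab
        (fun h => ?_) (fun h => ?_), Finset.card_insert_of_notMem he, oddProd, oddProd,
        Finset.prod_range_succ, mul_assoc]
      · obtain ⟨f, hf, h⟩ := mem_cover.1 h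
        exact ha f hf h
      · obtain ⟨f, hf, h⟩ := mem_cover.1 h
        exact hb f hf h

/-- The expectation of a function of a uniform pairing. -/
noncomputable def expect (F : d.Pairing → ℝ) : ℝ := (∑ σ, F σ) / Fintype.card d.Pairing

/-- The probability that a uniform pairing contains the given pairs. -/
noncomputable def edgeProb (α : Finset (Sym2 d.HalfEdge)) : ℝ :=
  expect fun σ => if α ⊆ edges σ then 1 else 0

lemma card_pairing_pos : (0 : ℝ) < Fintype.card d.Pairing := by
  exact_mod_cast Fintype.card_pos

lemma expect_mono {F G : d.Pairing → ℝ} (h : ∀ σ, F σ ≤ G σ) : expect F ≤ expect G :=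
  div_le_div_of_nonneg_right (Finset.sum_le_sum fun σ _ => h σ) card_pairing_pos.le

lemma expect_nonneg {F : d.Pairing → ℝ} (h : ∀ σ, 0 ≤ F σ) : 0 ≤ expect F :=
  div_nonneg (Finset.sum_nonneg fun σ _ => h σ) card_pairing_pos.le

lemma expect_const (c : ℝ) : expect (fun _ : d.Pairing => c) = c := by
  rw [expect, Finset.sum_const, Finset.card_univ, nsmul_eq_mul]
  exact mul_div_cancel_left₀ _ card_pairing_pos.ne'

lemma expect_add (F G : d.Pairing → ℝ) :
    expect (fun σ => F σ + G σ) = expect F + expect G := by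
  simp [expect, Finset.sum_add_distrib, add_div]

lemma expect_sub (F G : d.Pairing → ℝ) :
    expect (fun σ => F σ - G σ) = expect F - expect G := by
  simp [expect, Finset.sum_sub_distrib, sub_div]

lemma expect_const_mul (c : ℝ) (F : d.Pairing → ℝ) :
    expect (fun σ => c * F σ) = c * expect F := by
  simp [expect, ← Finset.mul_sum, mul_div_assoc]

lemma expect_sum {κ : Type*} (s : Finset κ) (F : κ → d.Pairing → ℝ) :
    expect (fun σ => ∑ k ∈ s, F k σ) = ∑ k ∈ s, expect (F k) := by
  simp only [expect]
  rw [Finset.sum_comm, Finset.sum_div]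

lemma abs_expect_le (F : d.Pairing → ℝ) : |expect F| ≤ expect fun σ => |F σ| := by
  rw [expect, abs_div, abs_of_pos card_pairing_pos]
  exact div_le_div_of_nonneg_right (Finset.abs_sum_le_sum_abs _ _) card_pairing_pos.le

lemma edgeProb_nonneg (α : Finset (Sym2 d.HalfEdge)) : 0 ≤ edgeProb α :=
  expect_nonneg fun σ => by split_ifs <;> norm_num

/-- This is forcing with `F = 1`. In particular the product cannot vanish once a partial matching of
that size exists, so no lower bound on the number of half-edges is needed. -/
lemma oddProd_mul_edgeProb {α : Finset (Sym2 d.HalfEdge)} (hα : IsPartialMatching α) :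
    oddProd d α.card * edgeProb α = 1 := by
  obtain ⟨T, -, -, h⟩ := exists_forcing hα
  have := h fun _ => 1
  rw [edgeProb, expect, ← mul_div_assoc, ← Finset.sum_filter, ← this]
  simp [card_pairing_pos.ne']

lemma edgeProb_eq {α : Finset (Sym2 d.HalfEdge)} (hα : IsPartialMatching α) :
    edgeProb α = (oddProd d α.card)⁻¹ :=
  eq_inv_of_mul_eq_one_right (oddProd_mul_edgeProb hα)

lemma edgeProb_eq_zero {α : Finset (Sym2 d.HalfEdge)} (hα : ¬ IsPartialMatching α) :
    edgeProb α = 0 := by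
  rw [edgeProb, expect, Finset.sum_eq_zero, zero_div]
  intro σ _
  rw [if_neg]
  exact fun h => hα ((isPartialMatching_edges σ).mono h)

/-- The conditional expectation given the presence of a partial matching. -/
theorem exists_forcing_expect {α : Finset (Sym2 d.HalfEdge)} (hα : IsPartialMatching α) :
    ∃ T : d.Pairing → d.Pairing, (∀ σ, α ⊆ edges (T σ)) ∧
      (∀ σ, ∀ e ∈ edges σ, (∀ h ∈ e, h ∉ cover α) → e ∈ edges (T σ)) ∧
      ∀ F : d.Pairing → ℝ,
        edgeProb α * expect (fun σ => F (T σ)) =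
          expect fun σ => (if α ⊆ edges σ then 1 else 0) * F σ := by
  obtain ⟨T, h1, h2, h3⟩ := exists_forcing hα
  refine ⟨T, h1, h2, fun F => ?_⟩
  rw [expect, h3 F, ← mul_div_assoc, ← mul_assoc, mul_comm (edgeProb α), oddProd_mul_edgeProb hα,
    one_mul, expect, Finset.sum_filter]
  simp

end DegreeSequence
end ConfigModel

namespace ConfigModel
namespace DegreeSequence

variable {n : ℕ} {d : DegreeSequence n}

/-! ### The Stein equation for pattern counts -/

/-- The number of patterns of a family that occur in a pairing. -/
def patternCount (A : Finset (Finset (Sym2 d.HalfEdge))) (σ : d.Pairing) : ℕ :=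
  (A.filter fun α => α ⊆ edges σ).card

open Classical in
/-- The probability of an event for a uniform pairing. -/
noncomputable def prob (p : d.Pairing → Prop) : ℝ := expect fun σ => if p σ then 1 else 0

lemma prob_eq (p : d.Pairing → Prop) [DecidablePred p] :
    prob p = expect fun σ => if p σ then 1 else 0 := by
  unfold prob
  congr!

lemma prob_nonneg (p : d.Pairing → Prop) : 0 ≤ prob p :=
  expect_nonneg fun σ => by split_ifs <;> norm_num

lemma prob_mono {p q : d.Pairing → Prop} (h : ∀ σ, p σ → q σ) : prob p ≤ prob q := by
  refine expect_mono fun σ => ?_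
  by_cases hp : p σ
  · simp [hp, h σ hp]
  · simp only [hp, if_false]
    split_ifs <;> norm_num

lemma expect_patternCount (A : Finset (Finset (Sym2 d.HalfEdge))) :
    expect (fun σ => (patternCount A σ : ℝ)) = ∑ α ∈ A, edgeProb α := by
  simp only [patternCount, Finset.card_filter, edgeProb]
  rw [← expect_sum]
  push_cast
  rfl

/-- The edge probability depends only on the number of edges, and disjoint covers make the numbers
of edges add up. The ratio of odd products measures the departure from independence and tends to
one. -/
lemma edgeProb_union {α β : Finset (Sym2 d.HalfEdge)}
    (hα : IsPartialMatching α) (hβ : IsPartialMatching β) (hd : Disjoint (cover α) (cover β)) :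
    edgeProb (α ∪ β) = (oddProd d α.card * oddProd d β.card /
      oddProd d (α.card + β.card)) * (edgeProb α * edgeProb β) := by
  have hcard : (α ∪ β).card = α.card + β.card := by
    rw [Finset.card_union_of_disjoint]
    rw [Finset.disjoint_left]
    intro e he he'
    induction e with | _ a b =>
    exact (Finset.disjoint_left.1 hd) (mem_cover.2 ⟨_, he, Sym2.mem_mk_left a b⟩)
      (mem_cover.2 ⟨_, he', Sym2.mem_mk_left a b⟩)
  have e1 := oddProd_mul_edgeProb hα
  have e2 := oddProd_mul_edgeProb hβ
  rw [edgeProb_eq (hα.union hβ hd), hcard]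
  calc _ = (oddProd d α.card * edgeProb α) * (oddProd d β.card * edgeProb β) *
      (oddProd d (α.card + β.card))⁻¹ := by rw [e1, e2]; ring
    _ = _ := by ring

/-- If the covers are disjoint, forcing `α` never destroys `β`, so the absolute value can be dropped
and what remains is the covariance of the two indicators. If the covers meet, the two indicators are
bounded separately; when moreover no edge is shared, `α ∪ β` is not a matching and has probability
zero. -/
lemma edgeProb_mul_expect_forcing_le {α β : Finset (Sym2 d.HalfEdge)}
    (hα : IsPartialMatching α) (hβ : IsPartialMatching β) {ε : ℝ}
    (hε : |oddProd d α.card * oddProd d β.card / oddProd d (α.card + β.card) - 1| ≤ ε)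
    {T : d.Pairing → d.Pairing}
    (h2 : ∀ σ, ∀ e ∈ edges σ, (∀ h ∈ e, h ∉ cover α) → e ∈ edges (T σ))
    (h3 : ∀ F : d.Pairing → ℝ, edgeProb α * expect (fun σ => F (T σ)) =
          expect fun σ => (if α ⊆ edges σ then 1 else 0) * F σ) :
    edgeProb α * expect (fun σ => |(if β ⊆ edges (T σ) then 1 else 0) -
        (if β ⊆ edges σ then 1 else 0)|) ≤
      (if ¬ Disjoint (cover α) (cover β) then edgeProb α * edgeProb β else 0) +
      (if ¬ Disjoint α β then edgeProb (α ∪ β) else 0) + ε * (edgeProb α * edgeProb β) := by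
  have hpq : edgeProb α * expect (fun σ => if β ⊆ edges (T σ) then (1 : ℝ) else 0) =
      edgeProb (α ∪ β) := by
    rw [h3 fun σ => if β ⊆ edges σ then (1 : ℝ) else 0, edgeProb]
    congr 1
    ext σ
    simp only [Finset.union_subset_iff, ite_and, mul_ite, mul_one, mul_zero]
    split_ifs <;> rfl
  have hε0 : 0 ≤ ε := (abs_nonneg _).trans hε
  have hpp : 0 ≤ edgeProb α * edgeProb β := mul_nonneg (edgeProb_nonneg _) (edgeProb_nonneg _)
  by_cases hd : Disjoint (cover α) (cover β)
  · have hmono : ∀ σ, β ⊆ edges σ → β ⊆ edges (T σ) := fun σ hσ e he =>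
      h2 σ e (hσ he) fun h hh hc =>
        (Finset.disjoint_left.1 hd) hc (mem_cover.2 ⟨e, he, hh⟩)
    have habs : (fun σ => |(if β ⊆ edges (T σ) then (1 : ℝ) else 0) -
        (if β ⊆ edges σ then 1 else 0)|) =
        fun σ => (if β ⊆ edges (T σ) then 1 else 0) - (if β ⊆ edges σ then 1 else 0) := by
      ext σ
      by_cases hσ : β ⊆ edges σ
      · simp [hσ, hmono σ hσ]
      · simp only [hσ, if_false, sub_zero]
        split_ifs <;> simp
    rw [habs, expect_sub, mul_sub, hpq]
    have h0 : (0 : ℝ) ≤ if ¬ Disjoint α β then edgeProb (α ∪ β) else 0 := by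
      split_ifs
      · exact le_rfl
      · exact edgeProb_nonneg _
    have : edgeProb (α ∪ β) - edgeProb α * edgeProb β ≤ ε * (edgeProb α * edgeProb β) := by
      rw [edgeProb_union hα hβ hd, ← sub_one_mul]
      exact mul_le_mul_of_nonneg_right ((le_abs_self _).trans hε) hpp
    change edgeProb (α ∪ β) - edgeProb α * edgeProb β ≤ _
    simp only [hd, not_true_eq_false, if_false]
    linarith
  · have hle : expect (fun σ => |(if β ⊆ edges (T σ) then (1 : ℝ) else 0) -
        (if β ⊆ edges σ then 1 else 0)|) ≤
        expect (fun σ => if β ⊆ edges (T σ) then (1 : ℝ) else 0) + edgeProb β := by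
      rw [edgeProb, ← expect_add]
      refine expect_mono fun σ => ?_
      split_ifs <;> norm_num
    have h1 := mul_le_mul_of_nonneg_left hle (edgeProb_nonneg α)
    rw [mul_add, hpq] at h1
    have h4 : edgeProb (α ∪ β) ≤ if ¬ Disjoint α β then edgeProb (α ∪ β) else 0 := by
      split_ifs with h
      · refine (edgeProb_eq_zero fun hm => hd ?_).le
        rw [Finset.disjoint_left] at h ⊢
        intro x hx hx'
        obtain ⟨e, he, hxe⟩ := mem_cover.1 hx
        obtain ⟨f, hf, hxf⟩ := mem_cover.1 hx'
        have := hm.2 e (Finset.mem_union_left _ he) f (Finset.mem_union_right _ hf) x hxe hxf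
        exact h he (this ▸ hf)
      · exact le_rfl
    simp only [hd, not_false_eq_true, if_true]
    have := mul_nonneg hε0 hpp
    linarith

variable {ι : Type*} [Fintype ι] [DecidableEq ι]

/-- The error term in the Stein equation for a pair of patterns. -/
noncomputable def steinError (ε : ℝ) (i j : ι) (α β : Finset (Sym2 d.HalfEdge)) : ℝ :=
  (if ¬ Disjoint (cover α) (cover β) then edgeProb α * edgeProb β else 0) +
    (if ¬ (j = i ∧ β = α) ∧ ¬ Disjoint α β then edgeProb (α ∪ β) else 0) +
      ε * (edgeProb α * edgeProb β)

/-- The approximate Stein equation satisfied by the joint law of pattern counts. -/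
theorem abs_stein_le (I : ι → Finset (Finset (Sym2 d.HalfEdge)))
    (hI : ∀ i, ∀ α ∈ I i, IsPartialMatching α) (hne : ∀ i, ∅ ∉ I i) {ε : ℝ}
    (hε : ∀ i j, ∀ α ∈ I i, ∀ β ∈ I j,
      |oddProd d α.card * oddProd d β.card / oddProd d (α.card + β.card) - 1| ≤ ε)
    (i : ι) (x : ι → ℕ) :
    |(x i + 1) * prob (fun σ => (fun j => patternCount (I j) σ) = x + Pi.single i 1) -
      (∑ α ∈ I i, edgeProb α) * prob (fun σ => (fun j => patternCount (I j) σ) = x)| ≤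
    ∑ α ∈ I i, ∑ j, ∑ β ∈ I j, steinError ε i j α β := by
  set N : d.Pairing → ι → ℕ := fun σ j => patternCount (I j) σ with hN
  -- On the event in question exactly `x i + 1` patterns of type `i` occur, so the factor can be
  -- replaced by the sum of their indicators.
  have step1 : (x i + 1) * prob (fun σ => N σ = x + Pi.single i 1) =
      ∑ α ∈ I i, expect fun σ => (if α ⊆ edges σ then 1 else 0) *
        (if N σ = x + Pi.single i 1 then 1 else 0) := by
    rw [← expect_sum, prob_eq, ← expect_const_mul]
    congr 1
    ext σ
    rw [← Finset.sum_mul]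
    split_ifs with h
    · have h1 : N σ i = x i + 1 := by rw [h]; simp
      simp only [hN, patternCount, Finset.card_filter] at h1
      have h2 := congrArg (Nat.cast : ℕ → ℝ) h1
      push_cast at h2
      rw [h2]
    · simp
  rw [step1, Finset.sum_mul, ← Finset.sum_sub_distrib]
  refine (Finset.abs_sum_le_sum_abs _ _).trans (Finset.sum_le_sum fun α hαI => ?_)
  have hα := hI i α hαI
  obtain ⟨T, h1, h2, h3⟩ := exists_forcing_expect hα
  have h4 : expect (fun σ => (if α ⊆ edges σ then 1 else 0) *
      (if N σ = x + Pi.single i 1 then 1 else 0)) = edgeProb α * expect (fun σ =>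
        if N (T σ) = x + Pi.single i 1 then 1 else 0) :=
    (h3 fun σ => if N σ = x + Pi.single i 1 then 1 else 0).symm
  rw [h4, prob_eq, ← mul_sub, ← expect_sub,
    abs_mul, abs_of_nonneg (edgeProb_nonneg α)]
  -- `D` marks the defects of the coupling: `α` itself was already present, or another pattern
  -- changed its status. Without any defect, `T` raises the count of type `i` by exactly one and
  -- fixes the others.
  let D : ι → Finset (Sym2 d.HalfEdge) → d.Pairing → ℝ := fun j β σ =>
    if j = i ∧ β = α then (if β ⊆ edges σ then 1 else 0) else
      |(if β ⊆ edges (T σ) then 1 else 0) - (if β ⊆ edges σ then 1 else 0)|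
  have hD0 : ∀ j β σ, 0 ≤ D j β σ := by
    intro j β σ
    simp only [D]
    split_ifs <;> norm_num
  have hbound : ∀ σ, |(if N (T σ) = x + Pi.single i 1 then (1 : ℝ) else 0) -
      (if N σ = x then 1 else 0)| ≤ ∑ j, ∑ β ∈ I j, D j β σ := by
    intro σ
    by_cases hz : ∀ j, ∀ β ∈ I j, D j β σ = 0
    · have hNT : N (T σ) = N σ + Pi.single i 1 := by
        have hiff : ∀ j, ∀ β ∈ I j, ¬ (j = i ∧ β = α) → (β ⊆ edges (T σ) ↔ β ⊆ edges σ) := by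
          intro j β hβ hjβ
          have := hz j β hβ
          simp only [D, hjβ, if_false] at this
          by_cases p : β ⊆ edges (T σ) <;> by_cases q : β ⊆ edges σ <;> simp_all
        have hno : ¬ α ⊆ edges σ := by
          have := hz i α hαI
          simpa [D] using this
        ext j
        simp only [hN, patternCount, Pi.add_apply]
        by_cases hj : j = i
        · subst hj
          rw [Pi.single_eq_same]
          have : (I j).filter (fun β => β ⊆ edges (T σ)) =
              insert α ((I j).filter fun β => β ⊆ edges σ) := by
            ext β
            simp only [Finset.mem_filter, Finset.mem_insert]
            by_cases hβα : β = α
            · simp [hβα, hαI, h1 σ]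
            · constructor
              · rintro ⟨hβ, hs⟩
                exact Or.inr ⟨hβ, (hiff j β hβ (by simp [hβα])).1 hs⟩
              · rintro (h | ⟨hβ, hs⟩)
                · exact absurd h hβα
                · exact ⟨hβ, (hiff j β hβ (by simp [hβα])).2 hs⟩
          rw [this, Finset.card_insert_of_notMem (by simp [hno])]
        · rw [Pi.single_eq_of_ne hj, add_zero]
          congr 1
          exact Finset.filter_congr fun β hβ => hiff j β hβ (by simp [hj])
      rw [hNT]
      simp only [add_left_inj]
      rw [sub_self, abs_zero]
      exact Finset.sum_nonneg fun j _ => Finset.sum_nonneg fun β _ => hD0 j β σ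
    · push Not at hz
      obtain ⟨j, β, hβ, hne0⟩ := hz
      have hone : 1 ≤ D j β σ := by
        revert hne0
        simp only [D]
        split_ifs <;> norm_num
      calc _ ≤ (1 : ℝ) := by split_ifs <;> norm_num
        _ ≤ D j β σ := hone
        _ ≤ ∑ β ∈ I j, D j β σ := Finset.single_le_sum (fun β _ => hD0 j β σ) hβ
        _ ≤ _ := Finset.single_le_sum
          (f := fun j => ∑ β ∈ I j, D j β σ)
          (fun j _ => Finset.sum_nonneg fun β _ => hD0 j β σ) (Finset.mem_univ j)
  have hexp := (abs_expect_le (d := d) _).trans (expect_mono hbound)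
  refine (mul_le_mul_of_nonneg_left hexp (edgeProb_nonneg α)).trans ?_
  rw [expect_sum, Finset.mul_sum]
  refine Finset.sum_le_sum fun j _ => ?_
  rw [expect_sum, Finset.mul_sum]
  refine Finset.sum_le_sum fun β hβI => ?_
  have hβ := hI j β hβI
  by_cases c : j = i ∧ β = α
  -- The defect of `α` with itself costs `P(α)²`. It is absorbed in the first error term, since a
  -- nonempty pattern shares half-edges with itself.
  · have hDe : D j β = fun σ => if α ⊆ edges σ then 1 else 0 := by
      ext σ
      simp [D, c]
    have hcov : ¬ Disjoint (cover α) (cover α) := by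
      rw [disjoint_self, Finset.bot_eq_empty, ← Finset.card_eq_zero, card_cover hα]
      have : α ≠ ∅ := fun h => hne i (h ▸ hαI)
      simpa using this
    have hε0 : 0 ≤ ε := (abs_nonneg _).trans (hε i j α hαI β hβI)
    have hpp : 0 ≤ edgeProb α * edgeProb β := mul_nonneg (edgeProb_nonneg _) (edgeProb_nonneg _)
    rw [hDe, steinError]
    simp only [c, hcov, not_false_eq_true, if_true, and_self, not_true_eq_false, false_and,
      if_false, add_zero]
    change edgeProb α * edgeProb α ≤ _
    rw [c.2] at hpp
    have := mul_nonneg hε0 hpp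
    linarith
  · have hDe : D j β = fun σ => |(if β ⊆ edges (T σ) then 1 else 0) -
        (if β ⊆ edges σ then 1 else 0)| := by
      ext σ
      simp only [D, c, if_false]
    rw [hDe, steinError]
    simp only [c, not_false_eq_true, true_and]
    exact edgeProb_mul_expect_forcing_le hα hβ (hε i j α hαI β hβI) h2 h3

end DegreeSequence
end ConfigModel

namespace ConfigModel

/-! ### From approximate Stein equations to Poisson limits -/

section PoissonLimit

variable {ι : Type*} [Fintype ι] [DecidableEq ι] {κ : Type*} {l : Filter κ}

/-- The unnormalised Poisson weights. -/
noncomputable def poissonWeight (lam : ι → ℝ) (x : ι → ℕ) : ℝ :=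
  ∏ i, lam i ^ x i / (x i).factorial

lemma poissonWeight_add_single (lam : ι → ℝ) (x : ι → ℕ) (i : ι) :
    (x i + 1) * poissonWeight lam (x + Pi.single i 1) = lam i * poissonWeight lam x := by
  rw [poissonWeight, poissonWeight, ← Finset.mul_prod_erase _ _ (Finset.mem_univ i),
    ← Finset.mul_prod_erase Finset.univ (fun j => lam j ^ x j / _) (Finset.mem_univ i)]
  have : ∏ j ∈ Finset.univ.erase i, lam j ^ (x + Pi.single i 1 : ι → ℕ) j /
      (((x + Pi.single i 1 : ι → ℕ) j).factorial : ℝ) =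
      ∏ j ∈ Finset.univ.erase i, lam j ^ x j / ((x j).factorial : ℝ) := by
    refine Finset.prod_congr rfl fun j hj => ?_
    rw [Pi.add_apply, Pi.single_eq_of_ne (Finset.ne_of_mem_erase hj), add_zero]
  rw [this, Pi.add_apply, Pi.single_eq_same, Nat.factorial_succ, pow_succ]
  have h1 : ((x i).factorial : ℝ) ≠ 0 := by positivity
  have h2 : (x i : ℝ) + 1 ≠ 0 := by positivity
  push_cast
  field_simp

lemma tendsto_sum_poissonWeight (lam : ι → ℝ) :
    Tendsto (fun K : ℕ => ∑ x ∈ Fintype.piFinset fun _ : ι => Finset.range K,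
      poissonWeight lam x) atTop (𝓝 (∏ i, Real.exp (lam i))) := by
  have : (fun K : ℕ => ∑ x ∈ Fintype.piFinset fun _ : ι => Finset.range K,
      poissonWeight lam x) =
      fun K => ∏ i, ∑ k ∈ Finset.range K, lam i ^ k / k.factorial := by
    ext K
    rw [Finset.prod_univ_sum]
    rfl
  rw [this]
  refine tendsto_finsetProd _ fun i _ => ?_
  have := (NormedSpace.expSeries_div_hasSum_exp (lam i)).tendsto_sum_nat
  rwa [← Real.exp_eq_exp_ℝ] at this

/-- A sequence of laws on `ι → ℕ` that approximately satisfies the Stein equations of a product of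
Poisson distributions, with bounded means, converges to it. -/
theorem tendsto_of_stein {p : κ → (ι → ℕ) → ℝ} {Lam : κ → ι → ℝ} {lam : ι → ℝ}
    (hlam : ∀ i, 0 ≤ lam i) (hp0 : ∀ n x, 0 ≤ p n x) (hp1 : ∀ n x, p n x ≤ 1)
    (hstein : ∀ x i, Tendsto (fun n => (x i + 1) * p n (x + Pi.single i 1) - Lam n i * p n x)
      l (𝓝 0))
    (hLam : ∀ i, Tendsto (fun n => Lam n i) l (𝓝 (lam i)))
    (hmass1 : ∀ n (K : ℕ), ∑ x ∈ Fintype.piFinset fun _ : ι => Finset.range K, p n x ≤ 1)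
    (hmass : ∀ n (K : ℕ), 0 < K →
      1 - (∑ i, Lam n i) / K ≤ ∑ x ∈ Fintype.piFinset fun _ : ι => Finset.range K, p n x)
    (x : ι → ℕ) :
    Tendsto (fun n => p n x) l
      (𝓝 (∏ i, Real.exp (-lam i) * lam i ^ x i / (x i).factorial)) := by
  -- By induction on the total of `x`, the Stein equations express `p n x` through `p n 0`, with the
  -- Poisson weight as limiting ratio.
  have hA : ∀ (m : ℕ) (x : ι → ℕ), ∑ i, x i = m →
      Tendsto (fun n => p n x - p n 0 * poissonWeight lam x) l (𝓝 0) := by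
    intro m
    induction m with
    | zero =>
      intro x hx
      have : x = 0 := by
        ext i
        simpa using (Finset.sum_eq_zero_iff.1 hx) i (Finset.mem_univ i)
      subst this
      simpa [poissonWeight] using tendsto_const_nhds
    | succ m ih =>
      intro x hx
      obtain ⟨i, hi⟩ : ∃ i, x i ≠ 0 := by
        by_contra! h
        simp [h] at hx
      obtain ⟨y, rfl⟩ : ∃ y : ι → ℕ, x = y + Pi.single i 1 := by
        refine ⟨x - Pi.single i 1, ?_⟩
        ext j
        by_cases hj : j = i
        · subst hj
          simp
          omega
        · simp [Pi.single_eq_of_ne hj]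
      have hy : ∑ j, y j = m := by
        simp only [Pi.add_apply, Finset.sum_add_distrib, Finset.sum_pi_single', Finset.mem_univ,
          if_true] at hx
        simpa using hx
      have h1 := ih y hy
      have h2 : Tendsto (fun n => (Lam n i - lam i) * p n y) l (𝓝 0) := by
        have h3 : Tendsto (fun n => Lam n i - lam i) l (𝓝 0) := by
          simpa using (hLam i).sub_const (lam i)
        refine squeeze_zero_norm (a := fun n => |Lam n i - lam i|) (fun n => ?_) ?_
        · rw [norm_mul, Real.norm_eq_abs, Real.norm_eq_abs, abs_of_nonneg (hp0 n y)]
          exact mul_le_of_le_one_right (abs_nonneg _) (hp1 n y)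
        · simpa using h3.abs
      have h4 := ((hstein y i).add h2).add (h1.const_mul (lam i))
      have h5 := h4.const_mul (((y i : ℝ) + 1)⁻¹)
      simp only [add_zero, mul_zero] at h5
      refine h5.congr fun n => ?_
      have hne : (y i : ℝ) + 1 ≠ 0 := by positivity
      have hw := poissonWeight_add_single lam y i
      have hw' : poissonWeight lam (y + Pi.single i 1) =
          ((y i : ℝ) + 1)⁻¹ * (lam i * poissonWeight lam y) := by
        rw [← hw]; field_simp
      rw [hw']
      field_simp
      ring
  set S := ∏ i, Real.exp (lam i) with hS
  have hSpos : 0 < S := Finset.prod_pos fun i _ => Real.exp_pos _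
  -- It remains to normalise. On a large box `[0, K)^ι` the mass lies between `1 - C/K` and `1`, it
  -- is close to `p n 0` times the truncated weight sum, and that sum is close to `S`; each error
  -- takes `ε / 3`.
  have hB : Tendsto (fun n => p n 0 * S) l (𝓝 1) := by
    rw [Metric.tendsto_nhds]
    intro ε hε
    set C := ∑ i, lam i + 1 with hC
    have hCpos : 0 < C := by
      have := Finset.sum_nonneg fun i (_ : i ∈ Finset.univ) => hlam i
      linarith
    have e1 : ∀ᶠ K : ℕ in atTop, |(∑ x ∈ Fintype.piFinset fun _ : ι => Finset.range K,
        poissonWeight lam x) - S| < ε / 3 := by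
      have := Metric.tendsto_nhds.1 (tendsto_sum_poissonWeight lam) (ε / 3) (by positivity)
      simpa [Real.dist_eq] using this
    have e2 : ∀ᶠ K : ℕ in atTop, C / K < ε / 3 :=
      (tendsto_const_div_atTop_nhds_zero_nat C).eventually (gt_mem_nhds (by positivity))
    obtain ⟨K, hK1, hK2, hK0⟩ := (e1.and (e2.and (eventually_gt_atTop 0))).exists
    have e3 : Tendsto (fun n => ∑ x ∈ Fintype.piFinset fun _ : ι => Finset.range K,
        (p n x - p n 0 * poissonWeight lam x)) l (𝓝 0) := by
      simpa using tendsto_finsetSum _ fun x _ => hA _ x rfl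
    have e4 : Tendsto (fun n => ∑ i, Lam n i) l (𝓝 (∑ i, lam i)) :=
      tendsto_finsetSum _ fun i _ => hLam i
    have e3' := Metric.tendsto_nhds.1 e3 (ε / 3) (by positivity)
    have e4' := e4.eventually (gt_mem_nhds (show ∑ i, lam i < C by rw [hC]; linarith))
    filter_upwards [e3', e4'] with n h3 h4
    rw [Real.dist_eq, sub_zero, Finset.sum_sub_distrib, ← Finset.mul_sum] at h3
    rw [Real.dist_eq]
    set SK := ∑ x ∈ Fintype.piFinset fun _ : ι => Finset.range K, poissonWeight lam x
    have m1 := hmass1 n K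
    have m2 := hmass n K hK0
    have m3 : (∑ i, Lam n i) / K ≤ C / K := by gcongr
    have a1 : |p n 0 * (S - SK)| < ε / 3 := by
      rw [abs_mul, abs_of_nonneg (hp0 n 0), abs_sub_comm]
      exact (mul_le_of_le_one_left (abs_nonneg _) (hp1 n 0)).trans_lt hK1
    rw [mul_sub] at a1
    rw [abs_lt] at h3 a1 ⊢
    constructor <;> linarith [h3.1, h3.2, a1.1, a1.2]
  have hq : Tendsto (fun n => p n 0) l (𝓝 S⁻¹) := by
    have := hB.mul_const S⁻¹
    simp only [mul_assoc, mul_inv_cancel₀ hSpos.ne', mul_one, one_mul] at this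
    exact this
  have hfin := (hA _ x rfl).add (hq.mul_const (poissonWeight lam x))
  simp only [sub_add_cancel, zero_add] at hfin
  convert! hfin using 2
  rw [hS, poissonWeight, ← Finset.prod_inv_distrib, ← Finset.prod_mul_distrib]
  refine Finset.prod_congr rfl fun i _ => ?_
  rw [Real.exp_neg, mul_div_assoc]

end PoissonLimit

/-! ### Poisson convergence of pattern counts. -/

namespace DegreeSequence

section

variable {n : ℕ} {d : DegreeSequence n}

lemma prob_true : prob (fun _ : d.Pairing => True) = 1 := by
  simp [prob, expect_const]

lemma prob_le_one (p : d.Pairing → Prop) : prob p ≤ 1 :=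
  (prob_mono fun _ _ => trivial).trans prob_true.le

lemma sum_prob_eq {β : Type*} (s : Finset β) (f : d.Pairing → β) :
    ∑ x ∈ s, prob (fun σ => f σ = x) = prob fun σ => f σ ∈ s := by
  classical
  simp only [prob]
  rw [← expect_sum]
  congr 1
  ext σ
  rw [Finset.sum_ite_eq]
  split_ifs <;> rfl

lemma prob_not (p : d.Pairing → Prop) : prob (fun σ => ¬ p σ) = 1 - prob p := by
  rw [← expect_const (d := d) 1, prob, prob, ← expect_sub]
  congr 1
  ext σ
  by_cases h : p σ <;> simp [h]

lemma prob_le_expect_div {N : d.Pairing → ℝ} (hN : ∀ σ, 0 ≤ N σ) {K : ℝ} (hK : 0 < K) :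
    prob (fun σ => K ≤ N σ) ≤ expect N / K := by
  rw [div_eq_inv_mul, ← expect_const_mul]
  refine expect_mono fun σ => ?_
  split_ifs with h
  · rw [← div_eq_inv_mul]
    exact (one_le_div hK).2 h
  · exact mul_nonneg (inv_nonneg.2 hK.le) (hN σ)

lemma prob_exists_le {ι : Type*} [Fintype ι] (p : ι → d.Pairing → Prop) :
    prob (fun σ => ∃ i, p i σ) ≤ ∑ i, prob (p i) := by
  classical
  simp only [prob]
  rw [← expect_sum]
  refine expect_mono fun σ => ?_
  split_ifs with h
  · obtain ⟨i, hi⟩ := h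
    calc (1 : ℝ) = if p i σ then 1 else 0 := by simp [hi]
      _ ≤ _ := Finset.single_le_sum (f := fun i => if p i σ then (1 : ℝ) else 0)
        (fun i _ => by split_ifs <;> norm_num) (Finset.mem_univ i)
  · exact Finset.sum_nonneg fun i _ => by split_ifs <;> norm_num

end

variable {d : (n : ℕ+) → DegreeSequence n}

lemma tendsto_oddProd_div (hl : Tendsto (fun n => (Fintype.card (d n).HalfEdge : ℝ)) atTop atTop)
    (r : ℕ) :
    Tendsto (fun n => oddProd (d n) r / (Fintype.card (d n).HalfEdge : ℝ) ^ r) atTop (𝓝 1) := by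
  have h : ∀ i ∈ Finset.range r, Tendsto (fun n => 1 - (1 + 2 * (i : ℝ)) *
      (Fintype.card (d n).HalfEdge : ℝ)⁻¹) atTop (𝓝 1) := by
    intro i _
    simpa using (((tendsto_inv_atTop_zero.comp hl).const_mul (1 + 2 * (i : ℝ))).const_sub 1)
  have h2 := tendsto_finsetProd _ h
  simp only [Finset.prod_const_one] at h2
  refine h2.congr' ?_
  filter_upwards [hl.eventually_gt_atTop 0] with n hn
  have : (Fintype.card (d n).HalfEdge : ℝ) ^ r =
      ∏ i ∈ Finset.range r, (Fintype.card (d n).HalfEdge : ℝ) := by simp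
  rw [oddProd, this, ← Finset.prod_div_distrib]
  refine Finset.prod_congr rfl fun i _ => ?_
  field_simp
  ring

lemma tendsto_oddProd_ratio (hl : Tendsto (fun n => (Fintype.card (d n).HalfEdge : ℝ)) atTop atTop)
    (r s : ℕ) :
    Tendsto (fun n => oddProd (d n) r * oddProd (d n) s / oddProd (d n) (r + s)) atTop (𝓝 1) := by
  have := ((tendsto_oddProd_div hl r).mul (tendsto_oddProd_div hl s)).div
    (tendsto_oddProd_div hl (r + s)) one_ne_zero
  simp only [mul_one, div_one] at this
  refine this.congr' ?_
  filter_upwards [hl.eventually_gt_atTop 0] with n hn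
  simp only [Pi.div_apply]
  rw [div_mul_div_comm, ← pow_add, div_div_div_cancel_right₀ (pow_pos hn _).ne']

variable {ι : Type*} [Fintype ι] [DecidableEq ι]

/-- **Poisson convergence of pattern counts.** -/
theorem tendsto_prob_patternCount
    (hl : Tendsto (fun n => (Fintype.card (d n).HalfEdge : ℝ)) atTop atTop)
    (I : (n : ℕ+) → ι → Finset (Finset (Sym2 (d n).HalfEdge))) (r : ι → ℕ) (lam : ι → ℝ)
    (hI : ∀ n i, ∀ α ∈ I n i, IsPartialMatching α) (hr : ∀ i, 0 < r i)
    (hcard : ∀ n i, ∀ α ∈ I n i, α.card = r i)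
    (hmean : ∀ i, Tendsto (fun n => ∑ α ∈ I n i, edgeProb α) atTop (𝓝 (lam i)))
    (hloc : ∀ i, ∃ δ : ℕ+ → ℝ, Tendsto δ atTop (𝓝 0) ∧ ∀ᶠ n in atTop, ∀ h,
      ∑ β ∈ I n i with h ∈ cover β, edgeProb β ≤ δ n)
    (hover : ∀ i j, Tendsto (fun n => ∑ α ∈ I n i, ∑ β ∈ I n j,
      if ¬ (j = i ∧ β = α) ∧ ¬ Disjoint α β then edgeProb (α ∪ β) else 0) atTop (𝓝 0))
    (x : ι → ℕ) :
    Tendsto (fun n => prob fun σ => (fun j => patternCount (I n j) σ) = x) atTop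
      (𝓝 (∏ i, Real.exp (-lam i) * lam i ^ x i / (x i).factorial)) := by
  have hLam0 : ∀ n i, 0 ≤ ∑ α ∈ I n i, edgeProb α := fun n i =>
    Finset.sum_nonneg fun α _ => edgeProb_nonneg α
  refine tendsto_of_stein (p := fun n x => prob fun σ => (fun j => patternCount (I n j) σ) = x)
    (Lam := fun n i => ∑ α ∈ I n i, edgeProb α)
    (fun i => ge_of_tendsto' (hmean i) fun n => hLam0 n i) (fun n x => prob_nonneg _)
    (fun n x => prob_le_one _) ?_ hmean ?_ ?_ x
  · intro x i
    -- Summing over all pairs of types gives one `ε` that serves every pair of patterns; the sum is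
    -- finite, so it still tends to zero.
    let ε : ℕ+ → ℝ := fun n => ∑ i, ∑ j,
      |oddProd (d n) (r i) * oddProd (d n) (r j) / oddProd (d n) (r i + r j) - 1|
    have hε : Tendsto ε atTop (𝓝 0) := by
      have : Tendsto ε atTop (𝓝 (∑ i : ι, ∑ j : ι, 0)) := by
        refine tendsto_finsetSum _ fun i _ => tendsto_finsetSum _ fun j _ => ?_
        have := ((tendsto_oddProd_ratio hl (r i) (r j)).sub_const 1).abs
        simpa using this
      simpa using this
    choose δ hδ0 hδ using hloc
    have hδ' : ∀ᶠ n in atTop, ∀ i, ∀ h, ∑ β ∈ I n i with h ∈ cover β, edgeProb β ≤ δ i n :=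
      eventually_all.2 hδ
    let B : ℕ+ → ℝ := fun n => ∑ j, (2 * r i * δ j n * (∑ α ∈ I n i, edgeProb α) +
      (∑ α ∈ I n i, ∑ β ∈ I n j,
        if ¬ (j = i ∧ β = α) ∧ ¬ Disjoint α β then edgeProb (α ∪ β) else 0) +
      ε n * ((∑ α ∈ I n i, edgeProb α) * ∑ β ∈ I n j, edgeProb β))
    have hB : Tendsto B atTop (𝓝 0) := by
      have : Tendsto B atTop (𝓝 (∑ j : ι, (2 * r i * 0 * lam i + 0 + 0 * (lam i * lam j)))) := by
        refine tendsto_finsetSum _ fun j _ => ?_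
        exact ((((hδ0 j).const_mul _).mul (hmean i)).add (hover i j)).add
          (hε.mul ((hmean i).mul (hmean j)))
      simpa using this
    refine squeeze_zero_norm' ?_ hB
    filter_upwards [hδ'] with n hn
    rw [Real.norm_eq_abs]
    refine (abs_stein_le (I n) (hI n) (fun i h => ?_) (ε := ε n) ?_ i x).trans ?_
    · have := hcard n i _ h
      have := hr i
      simp_all
    · intro i j α hα β hβ
      rw [hcard n i α hα, hcard n j β hβ]
      calc _ ≤ ∑ j, |oddProd (d n) (r i) * oddProd (d n) (r j) / oddProd (d n) (r i + r j) - 1| :=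
            Finset.single_le_sum (f := fun j => |oddProd (d n) (r i) * oddProd (d n) (r j) /
              oddProd (d n) (r i + r j) - 1|) (fun _ _ => abs_nonneg _) (Finset.mem_univ j)
        _ ≤ _ := Finset.single_le_sum (f := fun i => ∑ j, |oddProd (d n) (r i) *
              oddProd (d n) (r j) / oddProd (d n) (r i + r j) - 1|)
              (fun _ _ => Finset.sum_nonneg fun _ _ => abs_nonneg _) (Finset.mem_univ i)
    · rw [Finset.sum_comm]
      refine Finset.sum_le_sum fun j _ => ?_
      simp only [steinError, Finset.sum_add_distrib]
      refine add_le_add (add_le_add ?_ le_rfl) ?_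
      · rw [Finset.mul_sum]
        refine Finset.sum_le_sum fun α hα => ?_
        -- Union bound over the `2 * r i` half-edges of `α`, each of which is covered by patterns of
        -- type `j` of total probability at most `δ j n`.
        have h1 : ∀ β ∈ I n j, (if ¬ Disjoint (cover α) (cover β) then
            edgeProb α * edgeProb β else 0) ≤
            ∑ h ∈ cover α, if h ∈ cover β then edgeProb α * edgeProb β else 0 := by
          intro β _
          have hpp : 0 ≤ edgeProb α * edgeProb β :=
            mul_nonneg (edgeProb_nonneg _) (edgeProb_nonneg _)
          have h0 : ∀ h ∈ cover α, 0 ≤ if h ∈ cover β then edgeProb α * edgeProb β else 0 :=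
            fun h _ => by split_ifs; exacts [hpp, le_rfl]
          split_ifs with hd
          · exact Finset.sum_nonneg h0
          · rw [Finset.not_disjoint_iff] at hd
            obtain ⟨h, h1, h2⟩ := hd
            calc _ = if h ∈ cover β then edgeProb α * edgeProb β else 0 := by simp [h2]
              _ ≤ _ := Finset.single_le_sum h0 h1
        refine (Finset.sum_le_sum h1).trans ?_
        rw [Finset.sum_comm]
        calc _ ≤ ∑ h ∈ cover α, edgeProb α * δ j n := by
              refine Finset.sum_le_sum fun h _ => ?_
              rw [← Finset.sum_filter, ← Finset.mul_sum]
              exact mul_le_mul_of_nonneg_left (hn j h) (edgeProb_nonneg _)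
          _ = _ := by
              rw [Finset.sum_const, card_cover (hI n i α hα), hcard n i α hα, nsmul_eq_mul]
              push_cast
              ring
      · rw [Finset.sum_mul_sum, Finset.mul_sum]
        refine Finset.sum_le_sum fun α _ => ?_
        rw [Finset.mul_sum]
  · intro n K
    rw [sum_prob_eq]
    exact prob_le_one _
  · intro n K hK
    have hK' : (0 : ℝ) < K := by exact_mod_cast hK
    rw [sum_prob_eq]
    have h1 := prob_not fun σ : (d n).Pairing => (fun j => patternCount (I n j) σ) ∈
      Fintype.piFinset fun _ : ι => Finset.range K
    have h2 : prob (fun σ : (d n).Pairing => ¬ (fun j => patternCount (I n j) σ) ∈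
        Fintype.piFinset fun _ : ι => Finset.range K) ≤ (∑ i, ∑ α ∈ I n i, edgeProb α) / K := by
      calc _ ≤ prob (fun σ : (d n).Pairing => ∃ j, (K : ℝ) ≤ patternCount (I n j) σ) := by
            refine prob_mono fun σ hσ => ?_
            simpa [Fintype.mem_piFinset] using hσ
        _ ≤ ∑ j, prob (fun σ : (d n).Pairing => (K : ℝ) ≤ patternCount (I n j) σ) :=
            prob_exists_le _
        _ ≤ ∑ j, (∑ α ∈ I n j, edgeProb α) / K := by
            refine Finset.sum_le_sum fun j _ => ?_
            rw [← expect_patternCount]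
            exact prob_le_expect_div (fun σ => Nat.cast_nonneg _) hK'
        _ = _ := (Finset.sum_div _ _ _).symm
    linarith

end DegreeSequence
end ConfigModel

namespace ConfigModel

/-! ### Convergence in distribution of families of counts -/

/-- The points of `ℕ` are isolated and closed, and the tails `Ioi k = Ici (k + 1)` are clopen
neighbourhoods of `⊤`. Clopen sets have empty boundary, which makes them convenient test sets for
weak convergence. -/
lemma exists_isClopen_enat {u : Set ℕ∞} (hu : IsOpen u) {x : ℕ∞} (hx : x ∈ u) :
    ∃ t : Set ℕ∞, IsClopen t ∧ x ∈ t ∧ t ⊆ u := by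
  by_cases h : x = ⊤
  · subst h
    obtain ⟨a, ha, hau⟩ := exists_Ioc_subset_of_mem_nhds (hu.mem_nhds hx) ⟨0, ENat.top_pos⟩
    obtain ⟨k, rfl⟩ := ENat.ne_top_iff_exists.1 ha.ne
    refine ⟨Set.Ioi (k : ℕ∞), ⟨?_, isOpen_Ioi⟩, ha, fun y hy => hau ⟨hy, le_top⟩⟩
    have : Set.Ioi (k : ℕ∞) = Set.Ici ((k : ℕ∞) + 1) := by
      ext y
      exact (ENat.add_one_le_iff (ENat.natCast_ne_top k)).symm
    rw [this]
    exact isClosed_Ici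
  · exact ⟨{x}, ⟨isClosed_singleton, ENat.isOpen_singleton h⟩, rfl,
      Set.singleton_subset_iff.2 hx⟩

lemma exists_forall_ge_natCast_mem {t : Set ℕ∞} (ht : IsOpen t) (h : ⊤ ∈ t) :
    ∃ K : ℕ, ∀ m ≥ K, (m : ℕ∞) ∈ t :=
  eventually_atTop.1 (ENat.tendsto_natCast_nhds_top.eventually (ht.mem_nhds h))

/-- The sets with at most one point form a π-system containing a neighbourhood basis of a discrete
space, so convergence of the mass function implies weak convergence. Every set is clopen, hence
every probability converges. -/
lemma tendsto_real_of_singletons {E : Type*} [Countable E] [TopologicalSpace E] [DiscreteTopology E]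
    [MeasurableSpace E] [DiscreteMeasurableSpace E] {κ : Type*} {l : Filter κ}
    [l.IsCountablyGenerated] {P : κ → Measure E} [∀ n, IsProbabilityMeasure (P n)]
    {Q : Measure E} [IsProbabilityMeasure Q]
    (h : ∀ x, Tendsto (fun n => (P n).real {x}) l (𝓝 (Q.real {x}))) (A : Set E) :
    Tendsto (fun n => (P n).real A) l (𝓝 (Q.real A)) := by
  let P' : κ → ProbabilityMeasure E := fun n => ⟨P n, inferInstance⟩
  let Q' : ProbabilityMeasure E := ⟨Q, inferInstance⟩
  have hP : Tendsto P' l (𝓝 Q') := by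
    refine IsPiSystem.tendsto_probabilityMeasure_of_tendsto_of_mem
      (S := {s : Set E | s.Subsingleton}) ?_ ?_ ?_ ?_
    · exact fun s hs t _ _ => hs.anti Set.inter_subset_left
    · exact fun s _ => .of_discrete
    · exact fun u _ x hx => ⟨{x}, Set.subsingleton_singleton, by simp, by simpa using hx⟩
    · intro s hs
      rcases hs.eq_empty_or_singleton with rfl | ⟨x, rfl⟩
      · simpa using tendsto_const_nhds
      · rw [← NNReal.tendsto_coe]
        exact h x
  have := ProbabilityMeasure.tendsto_measure_of_isClopen_of_tendsto hP (isClopen_discrete A)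
  rw [← NNReal.tendsto_coe] at this
  exact this

lemma poisson_apply {r : ℝ≥0∞} (hr : r ≠ ∞) (t : Set ℕ∞) :
    poisson r t = poissonMeasure r.toNNReal ((fun m : ℕ => (m : ℕ∞)) ⁻¹' t) := by
  rw [poisson, if_neg hr, Measure.map_apply .of_discrete .of_discrete]

variable {ι : Type*} {Ω : ℕ+ → Type*} [∀ n, MeasurableSpace (Ω n)]
  [∀ n, DiscreteMeasurableSpace (Ω n)] {μ : (n : ℕ+) → Measure (Ω n)}
  [∀ n, IsProbabilityMeasure (μ n)] {Y : (n : ℕ+) → Ω n → ι → ℕ} {r : ι → ℝ≥0∞}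

lemma tendsto_real_pi_of_ne_top {F : Finset ι}
    (h : ∀ x : F → ℕ, Tendsto (fun n => (μ n).real {ω | (fun i : F => Y n ω i) = x}) atTop
      (𝓝 (∏ i : F, (poissonMeasure (r i).toNNReal).real {x i})))
    (hr : ∀ i ∈ F, r i ≠ ∞) (t : ι → Set ℕ∞) :
    Tendsto (fun n => (μ n).real {ω | ∀ i ∈ F, (Y n ω i : ℕ∞) ∈ t i}) atTop
      (𝓝 (∏ i ∈ F, (poisson (r i)).real (t i))) := by
  have hm : ∀ n, Measurable fun ω i => Y n ω ((i : F) : ι) := fun n => .of_discrete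
  have hP : ∀ n, IsProbabilityMeasure ((μ n).map fun ω (i : F) => Y n ω i) :=
    fun n => Measure.isProbabilityMeasure_map (hm n).aemeasurable
  have key := tendsto_real_of_singletons (l := atTop)
    (P := fun n => (μ n).map fun ω (i : F) => Y n ω i)
    (Q := Measure.pi fun i : F => poissonMeasure (r i).toNNReal) (fun x => ?_)
    (Set.pi Set.univ fun i : F => (fun m : ℕ => (m : ℕ∞)) ⁻¹' t i)
  · have e1 : ∏ i ∈ F, (poisson (r i)).real (t i) =
        (Measure.pi fun i : F => poissonMeasure (r i).toNNReal).real
          (Set.pi Set.univ fun i : F => (fun m : ℕ => (m : ℕ∞)) ⁻¹' t i) := by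
      rw [measureReal_def, Measure.pi_pi, ENNReal.toReal_prod, ← Finset.prod_coe_sort]
      refine Finset.prod_congr rfl fun i _ => ?_
      rw [measureReal_def, poisson_apply (hr i i.2)]
    rw [e1]
    refine key.congr fun n => ?_
    rw [map_measureReal_apply (hm n) .of_discrete]
    congr 1
    ext ω
    simp [Set.mem_pi]
  · have e2 : (Measure.pi fun i : F => poissonMeasure (r i).toNNReal).real {x} =
        ∏ i : F, (poissonMeasure (r i).toNNReal).real {x i} := by
      rw [measureReal_def, Measure.pi_singleton, ENNReal.toReal_prod]
      rfl
    rw [e2]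
    refine (h x).congr fun n => ?_
    rw [map_measureReal_apply (hm n) .of_discrete]
    rfl

/-- Convergence in distribution of a countable family of counts to independent Poisson variables,
some of them possibly infinite, from the convergence of finite-dimensional probability mass
functions of the finite coordinates and divergence in probability of the infinite ones. -/
theorem tendstoInDistribution_poisson [Countable ι]
    (h : ∀ F : Finset ι, (∀ i ∈ F, r i ≠ ∞) → ∀ x : F → ℕ,
      Tendsto (fun n => (μ n).real {ω | (fun i : F => Y n ω i) = x}) atTop
        (𝓝 (∏ i : F, (poissonMeasure (r i).toNNReal).real {x i})))
    (hinf : ∀ i, r i = ∞ → ∀ K : ℕ, Tendsto (fun n => (μ n).real {ω | Y n ω i < K}) atTop (𝓝 0)) :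
    TendstoInDistribution (fun n ω i => (Y n ω i : ℕ∞)) atTop
      (id : (ι → ℕ∞) → (ι → ℕ∞)) μ (Measure.infinitePi fun i => poisson (r i)) := by
  classical
  refine ⟨fun n => Measurable.aemeasurable .of_discrete, aemeasurable_id, ?_⟩
  -- Finite-dimensional cylinders with clopen sides are stable under intersection and form a basis
  -- of the product topology, so they determine the weak limit.
  refine IsPiSystem.tendsto_probabilityMeasure_of_tendsto_of_mem
    (S := {s | ∃ (F : Finset ι) (t : ι → Set ℕ∞), (∀ i, IsClopen (t i)) ∧
      s = Set.pi (F : Set ι) t}) ?_ ?_ ?_ ?_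
  · rintro _ ⟨F, t, ht, rfl⟩ _ ⟨F', t', ht', rfl⟩ -
    refine ⟨F ∪ F', fun i => (if i ∈ F then t i else Set.univ) ∩
      (if i ∈ F' then t' i else Set.univ), fun i => ?_, ?_⟩
    · refine IsClopen.inter ?_ ?_
      · split_ifs
        exacts [ht i, isClopen_univ]
      · split_ifs
        exacts [ht' i, isClopen_univ]
    · ext x
      simp only [Set.mem_inter_iff, Set.mem_pi, Finset.mem_coe, Finset.coe_union, Set.mem_union]
      constructor
      · rintro ⟨h1, h2⟩ i -
        refine ⟨?_, ?_⟩
        · split_ifs with hi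
          exacts [h1 i hi, trivial]
        · split_ifs with hi
          exacts [h2 i hi, trivial]
      · intro h
        refine ⟨fun i hi => ?_, fun i hi => ?_⟩
        · simpa [hi] using (h i (Or.inl hi)).1
        · simpa [hi] using (h i (Or.inr hi)).2
  · rintro _ ⟨F, t, ht, rfl⟩
    exact MeasurableSet.pi F.countable_toSet fun i _ => .of_discrete
  · intro u hu x hx
    obtain ⟨F, v, hv, hsub⟩ := isOpen_pi_iff.1 hu x hx
    have : ∀ i, ∃ t : Set ℕ∞, IsClopen t ∧ x i ∈ t ∧ (i ∈ F → t ⊆ v i) := by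
      intro i
      by_cases hi : i ∈ F
      · obtain ⟨t, h1, h2, h3⟩ := exists_isClopen_enat (hv i hi).1 (hv i hi).2
        exact ⟨t, h1, h2, fun _ => h3⟩
      · exact ⟨Set.univ, isClopen_univ, trivial, fun h => absurd h hi⟩
    choose t h1 h2 h3 using this
    refine ⟨_, ⟨F, t, h1, rfl⟩, ?_, ?_⟩
    · exact set_pi_mem_nhds F.finite_toSet fun i _ => (h1 i).isOpen.mem_nhds (h2 i)
    · exact (Set.pi_mono fun i hi => h3 i hi).trans hsub
  · rintro _ ⟨F, t, ht, rfl⟩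
    rw [← NNReal.tendsto_coe]
    change Tendsto (fun n => ((μ n).map fun ω i => (Y n ω i : ℕ∞)).real (Set.pi (F : Set ι) t)) atTop
      (𝓝 (((Measure.infinitePi fun i => poisson (r i)).map id).real (Set.pi (F : Set ι) t)))
    have hmeas : MeasurableSet (Set.pi (F : Set ι) t) :=
      MeasurableSet.pi F.countable_toSet fun i _ => .of_discrete
    rw [Measure.map_id, measureReal_def (Measure.infinitePi _),
      Measure.infinitePi_pi _ (fun i _ => .of_discrete),
      ENNReal.toReal_prod]
    have hmap : ∀ n, ((μ n).map fun ω i => (Y n ω i : ℕ∞)).real (Set.pi (F : Set ι) t) =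
        (μ n).real {ω | ∀ i ∈ F, (Y n ω i : ℕ∞) ∈ t i} := fun n => by
      rw [map_measureReal_apply .of_discrete hmeas]
      rfl
    simp_rw [hmap]
    -- If some infinite coordinate is confined to a clopen set missing `⊤`, it must stay below a
    -- fixed `K`, and both sides of the limit vanish. Otherwise each infinite coordinate satisfies
    -- its constraint as soon as it is large, so only the finite coordinates matter up to an error
    -- tending to zero.
    by_cases hc : ∃ i ∈ F, r i = ∞ ∧ ⊤ ∉ t i
    · obtain ⟨i, hi, hri, hti⟩ := hc
      rw [Finset.prod_eq_zero hi]
      · obtain ⟨K, hK⟩ := exists_forall_ge_natCast_mem (ht i).compl.isOpen hti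
        refine squeeze_zero (fun n => measureReal_nonneg) (fun n => ?_) (hinf i hri K)
        refine measureReal_mono fun ω hω => ?_
        by_contra hlt
        exact hK _ (not_lt.1 hlt) (hω i hi)
      · rw [poisson, if_pos hri, Measure.dirac_apply' _ .of_discrete]
        simp [hti]
    · push Not at hc
      have hA := tendsto_real_pi_of_ne_top (Y := Y) (μ := μ) (r := r)
        (F := F.filter fun i => r i ≠ ∞) (h _ fun i hi => (Finset.mem_filter.1 hi).2)
        (fun i hi => (Finset.mem_filter.1 hi).2) t
      have hprod : ∏ i ∈ F.filter (fun i => r i ≠ ∞), (poisson (r i)).real (t i) =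
          ∏ i ∈ F, ((poisson (r i)) (t i)).toReal := by
        rw [Finset.prod_filter]
        refine Finset.prod_congr rfl fun i hi => ?_
        split_ifs with hri
        · rfl
        · rw [not_not] at hri
          rw [poisson, if_pos hri, Measure.dirac_apply' _ .of_discrete]
          simp [hc i hi hri]
      rw [hprod] at hA
      have hK : ∀ i, ∃ K : ℕ, i ∈ F → r i = ∞ → ∀ m ≥ K, (m : ℕ∞) ∈ t i := by
        intro i
        by_cases hi : i ∈ F ∧ r i = ∞
        · obtain ⟨K, hK⟩ := exists_forall_ge_natCast_mem (ht i).isOpen (hc i hi.1 hi.2)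
          exact ⟨K, fun _ _ => hK⟩
        · exact ⟨0, fun h1 h2 => absurd ⟨h1, h2⟩ hi⟩
      choose K hK using hK
      have hB : Tendsto (fun n => ∑ i ∈ F.filter (fun i => r i = ∞),
          (μ n).real {ω | Y n ω i < K i}) atTop (𝓝 0) := by
        simpa using tendsto_finsetSum (F.filter fun i => r i = ∞)
          fun i hi => hinf i (Finset.mem_filter.1 hi).2 (K i)
      have hlow := hA.sub hB
      rw [sub_zero] at hlow
      refine tendsto_of_tendsto_of_tendsto_of_le_of_le hlow hA (fun n => ?_) (fun n => ?_)
      · simp only [sub_le_iff_le_add]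
        refine (measureReal_mono (s₂ := {ω | ∀ i ∈ F, (Y n ω i : ℕ∞) ∈ t i} ∪
          ⋃ i ∈ F.filter (fun i => r i = ∞), {ω | Y n ω i < K i}) fun ω hω => ?_).trans ?_
        · by_cases hex : ∃ i ∈ F.filter (fun i => r i = ∞), Y n ω i < K i
          · obtain ⟨i, hi, hlt⟩ := hex
            exact Or.inr (Set.mem_biUnion hi hlt)
          · push Not at hex
            refine Or.inl fun i hi => ?_
            by_cases hri : r i = ∞
            · exact hK i hi hri _ (hex i (Finset.mem_filter.2 ⟨hi, hri⟩))
            · exact hω i (Finset.mem_filter.2 ⟨hi, hri⟩)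
        · refine (measureReal_union_le _ _).trans (add_le_add le_rfl ?_)
          exact measureReal_biUnion_finset_le _ _
      · exact measureReal_mono fun ω hω i hi => hω i (Finset.mem_filter.1 hi).1

end ConfigModel

namespace ConfigModel
namespace DegreeSequence

/-! ### The second moment method for pattern counts -/

/-- The square of the count is a double sum of indicators of `α ∪ β`. The diagonal gives the mean;
off the diagonal a union is either impossible or made of two disjoint patterns. The absolute value
makes the off-diagonal bound nonnegative without a lower bound on the number of half-edges. -/
lemma expect_patternCount_sq_le {n : ℕ} {d : DegreeSequence n}
    {A : Finset (Finset (Sym2 d.HalfEdge))} {r : ℕ}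
    (hA : ∀ α ∈ A, IsPartialMatching α) (hr : ∀ α ∈ A, α.card = r)
    (hex : ∀ α ∈ A, ∀ β ∈ A, α ≠ β → IsPartialMatching (α ∪ β) →
      Disjoint (cover α) (cover β)) :
    expect (fun σ => (patternCount A σ : ℝ) ^ 2) ≤ (∑ α ∈ A, edgeProb α) +
      |oddProd d r * oddProd d r / oddProd d (r + r)| * (∑ α ∈ A, edgeProb α) ^ 2 := by
  set ρ := oddProd d r * oddProd d r / oddProd d (r + r) with hρ
  have h1 : expect (fun σ => (patternCount A σ : ℝ) ^ 2) =
      ∑ α ∈ A, ∑ β ∈ A, edgeProb (α ∪ β) := by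
    simp only [edgeProb]
    simp_rw [← expect_sum]
    congr 1
    ext σ
    simp only [patternCount, Finset.card_filter]
    push_cast
    rw [sq, Finset.sum_mul_sum]
    refine Finset.sum_congr rfl fun α _ => Finset.sum_congr rfl fun β _ => ?_
    simp only [Finset.union_subset_iff, ite_and, mul_ite, mul_one, mul_zero]
    split_ifs <;> rfl
  rw [h1, sq, Finset.sum_mul_sum, Finset.mul_sum, ← Finset.sum_add_distrib]
  refine Finset.sum_le_sum fun α hα => ?_
  have h2 : ∀ β ∈ A, edgeProb (α ∪ β) ≤ (if α = β then edgeProb α else 0) +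
      |ρ| * (edgeProb α * edgeProb β) := by
    intro β hβ
    have hpp : 0 ≤ |ρ| * (edgeProb α * edgeProb β) :=
      mul_nonneg (abs_nonneg _) (mul_nonneg (edgeProb_nonneg _) (edgeProb_nonneg _))
    by_cases hab : α = β
    · subst hab
      simpa using hpp
    · simp only [hab, if_false, zero_add]
      by_cases hm : IsPartialMatching (α ∪ β)
      · rw [edgeProb_union (hA α hα) (hA β hβ) (hex α hα β hβ hab hm), hr α hα, hr β hβ]
        exact mul_le_mul_of_nonneg_right (le_abs_self _)
          (mul_nonneg (edgeProb_nonneg _) (edgeProb_nonneg _))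
      · rw [edgeProb_eq_zero hm]
        exact hpp
  refine (Finset.sum_le_sum h2).trans_eq ?_
  rw [Finset.sum_add_distrib, Finset.sum_ite_eq, if_pos hα, Finset.mul_sum]

/-- If the expected number of patterns tends to infinity and distinct compatible patterns are
disjoint, then the number of patterns tends to infinity in probability. -/
theorem tendsto_prob_patternCount_lt {d : (n : ℕ+) → DegreeSequence n}
    (hl : Tendsto (fun n => (Fintype.card (d n).HalfEdge : ℝ)) atTop atTop)
    (A : (n : ℕ+) → Finset (Finset (Sym2 (d n).HalfEdge))) (r : ℕ)
    (hA : ∀ n, ∀ α ∈ A n, IsPartialMatching α) (hr : ∀ n, ∀ α ∈ A n, α.card = r)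
    (hex : ∀ n, ∀ α ∈ A n, ∀ β ∈ A n, α ≠ β → IsPartialMatching (α ∪ β) →
      Disjoint (cover α) (cover β))
    (hmean : Tendsto (fun n => ∑ α ∈ A n, edgeProb α) atTop atTop) (K : ℕ) :
    Tendsto (fun n => prob fun σ => patternCount (A n) σ < K) atTop (𝓝 0) := by
  have hB : Tendsto (fun n => 4 * ((∑ α ∈ A n, edgeProb α)⁻¹ +
      (|oddProd (d n) r * oddProd (d n) r / oddProd (d n) (r + r)| - 1))) atTop (𝓝 0) := by
    have := ((tendsto_inv_atTop_zero.comp hmean).add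
      ((tendsto_oddProd_ratio hl r r).abs.sub_const 1)).const_mul 4
    simpa using this
  refine squeeze_zero' (Eventually.of_forall fun n => prob_nonneg _) ?_ hB
  filter_upwards [hmean.eventually_ge_atTop (2 * K), hmean.eventually_gt_atTop 0] with n h2 h0
  set Λ := ∑ α ∈ A n, edgeProb α with hΛ
  set ρ := |oddProd (d n) r * oddProd (d n) r / oddProd (d n) (r + r)|
  have hsq := expect_patternCount_sq_le (hA n) (hr n) (hex n)
  have hm := expect_patternCount (A n)
  rw [← hΛ] at hsq hm
  have hvar : expect (fun σ => ((patternCount (A n) σ : ℝ) - Λ) ^ 2) ≤ Λ + (ρ - 1) * Λ ^ 2 := by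
    have : (fun σ : (d n).Pairing => ((patternCount (A n) σ : ℝ) - Λ) ^ 2) = fun σ =>
        ((patternCount (A n) σ : ℝ) ^ 2 - (2 * Λ) * patternCount (A n) σ) + Λ ^ 2 := by
      ext σ; ring
    rw [this, expect_add, expect_sub, expect_const_mul, hm, expect_const]
    nlinarith
  -- Chebyshev: since `Λ ≥ 2 * K`, a count below `K` is at distance at least `Λ / 2` from its mean.
  calc _ ≤ prob (fun σ : (d n).Pairing => Λ ^ 2 / 4 ≤ ((patternCount (A n) σ : ℝ) - Λ) ^ 2) := by
        refine prob_mono fun σ hσ => ?_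
        have : (patternCount (A n) σ : ℝ) < K := by exact_mod_cast hσ
        nlinarith
    _ ≤ _ := prob_le_expect_div (fun σ => sq_nonneg _) (by positivity)
    _ ≤ (Λ + (ρ - 1) * Λ ^ 2) / (Λ ^ 2 / 4) := by gcongr
    _ = _ := by
      field_simp

end DegreeSequence
end ConfigModel

namespace ConfigModel
namespace DegreeSequence

variable {n : ℕ} {d : DegreeSequence n}

/-! ### Walks along vertices of degree one and two -/

/-- The other half-edge at a vertex of degree two; at a vertex of degree one, the only one. -/
def opp (h : d.HalfEdge) : d.HalfEdge := ⟨h.1, Fin.rev h.2⟩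

@[simp] lemma opp_fst (h : d.HalfEdge) : (opp h).1 = h.1 := rfl

@[simp] lemma opp_opp (h : d.HalfEdge) : opp (opp h) = h := by
  simp [opp]

lemma eq_or_eq_opp {g h : d.HalfEdge} (hgh : g.1 = h.1) (hd : d.deg h.1 ≤ 2) :
    g = h ∨ g = opp h := by
  obtain ⟨v, i⟩ := g
  obtain ⟨w, j⟩ := h
  obtain rfl : v = w := hgh
  simp only [opp, Sigma.mk.injEq, heq_eq_eq, true_and, Fin.ext_iff, Fin.val_rev]
  have := i.2
  have := j.2
  simp only at hd
  omega

lemma opp_eq_self {h : d.HalfEdge} (hd : d.deg h.1 = 1) : opp h = h := by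
  obtain ⟨v, i⟩ := h
  simp only [opp, Sigma.mk.injEq, heq_eq_eq, true_and, Fin.ext_iff, Fin.val_rev]
  have := i.2
  simp only at hd
  omega

lemma opp_ne_self {h : d.HalfEdge} (hd : d.deg h.1 = 2) : opp h ≠ h := by
  obtain ⟨v, i⟩ := h
  simp only [opp, ne_eq, Sigma.mk.injEq, heq_eq_eq, true_and, Fin.ext_iff, Fin.val_rev]
  have := i.2
  simp only at hd
  omega

/-- Cross the edge at `h`, then move to the other half-edge of the vertex that is reached. -/
def step (σ : d.Pairing) (h : d.HalfEdge) : d.HalfEdge := opp (σ.1 h)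

lemma apply_opp_step (σ : d.Pairing) (h : d.HalfEdge) : σ.1 (opp (step σ h)) = h := by
  rw [step, opp_opp, σ.2.1]

lemma step_injective (σ : d.Pairing) : Function.Injective (step σ) :=
  Function.LeftInverse.injective (g := fun h => σ.1 (opp h)) (apply_opp_step σ)

/-- If a walk comes back to the reversal of an earlier half-edge, it was reflected in between. -/
lemma exists_opp_eq_self (σ : d.Pairing) (h : d.HalfEdge) (m : ℕ) : ∀ i,
    -- Undoing one step at the far end and making one at the near end shortens the gap by two. Gap
    -- one would give a fixed point of `σ`; gap two exhibits the reflected half-edge in the middle.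
    (step σ)^[i + (m + 1)] h = opp ((step σ)^[i] h) →
      ∃ j, i < j ∧ j < i + (m + 1) ∧ opp ((step σ)^[j] h) = (step σ)^[j] h := by
  induction m using Nat.twoStepInduction with
  | zero =>
    intro i hi
    rw [zero_add, Function.iterate_succ_apply', step] at hi
    have := congrArg opp hi
    rw [opp_opp, opp_opp] at this
    exact absurd this (σ.2.2 _)
  | one =>
    intro i hi
    refine ⟨i + 1, by omega, by omega, ?_⟩
    have h1 := congrArg (fun x => σ.1 (opp x)) hi
    simp only [opp_opp, show i + (1 + 1) = (i + 1) + 1 by omega] at h1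
    rw [Function.iterate_succ_apply' _ (i + 1), apply_opp_step] at h1
    conv_lhs => rw [Function.iterate_succ_apply', step, opp_opp]
    exact h1.symm
  | more m ih _ =>
    intro i hi
    have h1 := congrArg (fun x => σ.1 (opp x)) hi
    simp only [opp_opp, show i + (m + 2 + 1) = ((i + 1) + (m + 1)) + 1 by omega] at h1
    rw [Function.iterate_succ_apply' _ ((i + 1) + (m + 1)), apply_opp_step] at h1
    obtain ⟨j, h2, h3, h4⟩ := ih (i + 1) (by
      rw [h1, Function.iterate_succ_apply' _ i, step, opp_opp])
    exact ⟨j, by omega, by omega, h4⟩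

/-! ### Connected components -/

lemma graph_adj {σ : d.Pairing} {u v : Fin n} :
    (graph σ).Adj u v ↔ u ≠ v ∧ ∃ h : d.HalfEdge, h.1 = u ∧ (σ.1 h).1 = v := by
  rw [graph, SimpleGraph.fromEdgeSet_adj, and_comm]
  refine and_congr_right fun _ => ?_
  simp only [Set.mem_ofPred_eq]
  constructor
  · rintro ⟨e, he, hz⟩
    induction e with | _ a b =>
    rw [mk_mem_edges] at he
    simp only [ends, Sym2.map_mk, Sym2.eq_iff] at hz
    rcases hz with ⟨h1, h2⟩ | ⟨h1, h2⟩
    · exact ⟨a, h1, by rw [he, h2]⟩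
    · exact ⟨b, h2, by rw [← he, σ.2.1, h1]⟩
  · rintro ⟨h, rfl, rfl⟩
    exact ⟨s(h, σ.1 h), mk_mem_edges.2 rfl, by simp [ends]⟩

lemma apply_fst_mem_supp {σ : d.Pairing} {c : (graph σ).ConnectedComponent} {h : d.HalfEdge}
    (hh : h.1 ∈ c.supp) : (σ.1 h).1 ∈ c.supp := by
  by_cases heq : h.1 = (σ.1 h).1
  · rwa [← heq]
  · exact c.mem_supp_of_adj_mem_supp hh (graph_adj.2 ⟨heq, h, rfl, rfl⟩)

lemma apply_fst_mem_supp_iff {σ : d.Pairing} {c : (graph σ).ConnectedComponent} {h : d.HalfEdge} :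
    (σ.1 h).1 ∈ c.supp ↔ h.1 ∈ c.supp :=
  ⟨fun hh => by simpa [σ.2.1] using apply_fst_mem_supp hh, apply_fst_mem_supp⟩

lemma supp_subset_of_closed {σ : d.Pairing} {c : (graph σ).ConnectedComponent} {W : Set (Fin n)}
    {v : Fin n} (hv : v ∈ c.supp) (hvW : v ∈ W)
    (hW : ∀ h : d.HalfEdge, h.1 ∈ W → (σ.1 h).1 ∈ W) : c.supp ⊆ W := by
  intro w hw
  have hr : (graph σ).Reachable v w := c.reachable_of_mem_supp hv hw
  obtain ⟨p⟩ := hr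
  clear hw hv
  induction p with
  | nil => exact hvW
  | cons hadj _ ih =>
    obtain ⟨-, h, rfl, rfl⟩ := graph_adj.1 hadj
    exact ih (hW h hvW)

/-- The successor of an index in the cyclic order. -/
def rot {k : ℕ} (i : Fin k) : Fin k := if h : i.1 + 1 < k then ⟨i.1 + 1, h⟩ else ⟨0, i.pos⟩

lemma rot_val {k : ℕ} (i : Fin k) : (rot i : ℕ) = if i.1 + 1 < k then i.1 + 1 else 0 := by
  unfold rot
  split_ifs <;> rfl

lemma rot_injective {k : ℕ} : Function.Injective (rot : Fin k → Fin k) := by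
  intro i j h
  have h1 := congrArg Fin.val h
  rw [rot_val, rot_val] at h1
  have := i.2
  have := j.2
  ext
  split_ifs at h1 <;> omega

/-- The degrees along a cycle (`b = true`) or a line (`b = false`) of length `k`. -/
def seqDeg (b : Bool) (k i : ℕ) : ℕ := if b = false ∧ (i = 0 ∨ i + 1 = k) then 1 else 2

/-- The indices that carry an edge in a cycle or line. -/
def IsEdgeIndex (b : Bool) {k : ℕ} (i : Fin k) : Prop := b = true ∨ i.1 + 1 < k

instance (b : Bool) {k : ℕ} : DecidablePred (IsEdgeIndex b : Fin k → Prop) :=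
  fun i => inferInstanceAs (Decidable (b = true ∨ i.1 + 1 < k))

/-- Sequences of half-edges at distinct vertices of the prescribed degrees. -/
def compSeqs (d : DegreeSequence n) (b : Bool) (k : ℕ) : Finset (Fin k → d.HalfEdge) :=
  {f | Function.Injective (fun i => (f i).1) ∧ ∀ i, d.deg (f i).1 = seqDeg b k i}

/-- The edges of the cycle or line that leaves its vertices through the given half-edges. -/
def compPattern (b : Bool) {k : ℕ} (f : Fin k → d.HalfEdge) : Finset (Sym2 d.HalfEdge) :=
  ({i | IsEdgeIndex b i} : Finset (Fin k)).image fun i => s(f i, opp (f (rot i)))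

lemma mem_compSeqs {b : Bool} {k : ℕ} {f : Fin k → d.HalfEdge} :
    f ∈ compSeqs d b k ↔ Function.Injective (fun i => (f i).1) ∧
      ∀ i, d.deg (f i).1 = seqDeg b k i := by
  simp [compSeqs]

lemma mem_compPattern {b : Bool} {k : ℕ} {f : Fin k → d.HalfEdge} {e : Sym2 d.HalfEdge} :
    e ∈ compPattern b f ↔ ∃ i, IsEdgeIndex b i ∧ s(f i, opp (f (rot i))) = e := by
  simp [compPattern]

lemma compPattern_subset_iff {b : Bool} {k : ℕ} {f : Fin k → d.HalfEdge} {σ : d.Pairing} :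
    compPattern b f ⊆ edges σ ↔ ∀ i, IsEdgeIndex b i → f (rot i) = step σ (f i) := by
  simp only [Finset.subset_iff, mem_compPattern, forall_exists_index, and_imp,
    forall_apply_eq_imp_iff₂, mk_mem_edges, step]
  refine forall₂_congr fun i _ => ?_
  constructor
  · intro h
    rw [h, opp_opp]
  · intro h
    rw [h, opp_opp]

lemma seqDeg_le (b : Bool) (k i : ℕ) : seqDeg b k i ≤ 2 := by
  unfold seqDeg
  split_ifs <;> omega

/-- Equality would put both half-edges at one vertex, so `i = rot j` and `f i` would be fixed by
`opp`, which is impossible in degree two. A vertex with an edge leaving and an edge entering is not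
an end of a line, so its degree is two. -/
lemma apply_ne_opp_apply_rot {b : Bool} {k : ℕ} {f : Fin k → d.HalfEdge}
    (hf : f ∈ compSeqs d b k) {i j : Fin k} (hi : IsEdgeIndex b i) (hj : IsEdgeIndex b j) :
    f i ≠ opp (f (rot j)) := by
  intro h
  rw [mem_compSeqs] at hf
  have hfst := congrArg Sigma.fst h
  have hij : i = rot j := hf.1 hfst
  rw [← hij] at h
  refine opp_ne_self ?_ h.symm
  rw [hf.2, seqDeg, if_neg]
  rintro ⟨hb, h2⟩
  simp only [IsEdgeIndex, hb, Bool.false_eq_true, false_or] at hi hj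
  have := congrArg Fin.val hij
  rw [rot_val, if_pos hj] at this
  omega

lemma index_eq_of_mem {b : Bool} {k : ℕ} {f : Fin k → d.HalfEdge}
    (hf : f ∈ compSeqs d b k) {i j : Fin k} (hi : IsEdgeIndex b i) (hj : IsEdgeIndex b j)
    {h : d.HalfEdge} (h1 : h ∈ s(f i, opp (f (rot i)))) (h2 : h ∈ s(f j, opp (f (rot j)))) :
    i = j := by
  have hinj := (mem_compSeqs.1 hf).1
  rw [Sym2.mem_iff] at h1 h2
  rcases h1 with h1 | h1 <;> rcases h2 with h2 | h2
  · exact hinj (congrArg Sigma.fst (h1.symm.trans h2))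
  · exact absurd (h1.symm.trans h2) (apply_ne_opp_apply_rot hf hi hj)
  · exact absurd (h2.symm.trans h1) (apply_ne_opp_apply_rot hf hj hi)
  · have hfst := congrArg Sigma.fst (h1.symm.trans h2)
    exact rot_injective (hinj hfst)

lemma isPartialMatching_compPattern {b : Bool} {k : ℕ} {f : Fin k → d.HalfEdge}
    (hf : f ∈ compSeqs d b k) : IsPartialMatching (compPattern b f) := by
  refine ⟨fun e he => ?_, fun e he e' he' h h1 h2 => ?_⟩
  · obtain ⟨i, hi, rfl⟩ := mem_compPattern.1 he
    rw [Sym2.mk_isDiag_iff]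
    exact apply_ne_opp_apply_rot hf hi hi
  · obtain ⟨i, hi, rfl⟩ := mem_compPattern.1 he
    obtain ⟨j, hj, rfl⟩ := mem_compPattern.1 he'
    rw [index_eq_of_mem hf hi hj h1 h2]

/-- The number of edges of a cycle or line of length `k`. -/
def seqEdges (b : Bool) (k : ℕ) : ℕ := if b then k else k - 1

lemma card_compPattern {b : Bool} {k : ℕ} {f : Fin k → d.HalfEdge}
    (hf : f ∈ compSeqs d b k) : (compPattern b f).card = seqEdges b k := by
  rw [compPattern, Finset.card_image_of_injOn]
  · cases b
    · simp only [IsEdgeIndex, Bool.false_eq_true, false_or, seqEdges, if_false]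
      cases k with
      | zero => rfl
      | succ k =>
        have : (Finset.univ.filter fun i : Fin (k + 1) => i.1 + 1 < k + 1) =
            Finset.univ.filter fun i : Fin (k + 1) => i ≠ Fin.last k := by
          ext i
          simp only [Finset.mem_filter, Finset.mem_univ, true_and, ne_eq, Fin.ext_iff, Fin.val_last]
          have := i.2
          omega
        rw [this, Finset.filter_ne', Finset.card_erase_of_mem (Finset.mem_univ _)]
        simp
    · simp [IsEdgeIndex, seqEdges]
  · intro i hi j hj hij
    simp only [Finset.coe_filter, Finset.mem_univ, true_and, Set.mem_ofPred_eq] at hi hj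
    simp only at hij
    exact index_eq_of_mem hf hi hj (Sym2.mem_mk_left _ _) (hij ▸ Sym2.mem_mk_left _ _)

/-- The edges at the vertices of a line or cycle all belong to it. -/
lemma mk_apply_mem_compPattern {b : Bool} {k : ℕ} (hk : b = false → 2 ≤ k)
    {f : Fin k → d.HalfEdge} (hf : f ∈ compSeqs d b k) {σ : d.Pairing}
    (hσ : compPattern b f ⊆ edges σ) {h : d.HalfEdge} {i : Fin k} (hi : h.1 = (f i).1) :
    s(h, σ.1 h) ∈ compPattern b f := by
  have hdeg := (mem_compSeqs.1 hf).2
  have hstep := compPattern_subset_iff.1 hσ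
  have fwd : ∀ i, IsEdgeIndex b i → s(f i, σ.1 (f i)) ∈ compPattern b f := fun i hi =>
    mem_compPattern.2 ⟨i, hi, by rw [hstep i hi, step, opp_opp]⟩
  have bwd : ∀ j, IsEdgeIndex b j → s(opp (f (rot j)), σ.1 (opp (f (rot j)))) ∈ compPattern b f :=
    fun j hj => mem_compPattern.2 ⟨j, hj, by
      rw [Sym2.eq_swap]
      congr 1
      rw [hstep j hj, apply_opp_step]⟩
  -- Every index but the start of a line has a predecessor carrying an edge; in a cycle the
  -- predecessor of `0` is `k - 1`.
  have hpred : ∀ i : Fin k, (b = true ∨ i.1 ≠ 0) → ∃ j, IsEdgeIndex b j ∧ rot j = i := by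
    intro i hi
    have hik := i.2
    by_cases h0 : i.1 = 0
    · refine ⟨⟨k - 1, by omega⟩, Or.inl (hi.resolve_right (by simpa using h0)), ?_⟩
      ext
      rw [rot_val, if_neg (by simp only; omega), h0]
    · refine ⟨⟨i.1 - 1, by omega⟩, Or.inr (by simp only; omega), ?_⟩
      ext
      rw [rot_val, if_pos (by simp only; omega)]
      simp only
      omega
  -- At an end of a line `opp` fixes the only half-edge, so whichever of the forward and backward
  -- edges is missing there, the other covers it.
  have hend : ∀ i : Fin k, b = false → (i.1 = 0 ∨ i.1 + 1 = k) → opp (f i) = f i := by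
    intro i hb hi
    apply opp_eq_self
    rw [hdeg, seqDeg, if_pos ⟨hb, hi⟩]
  have hik := i.2
  rcases eq_or_eq_opp hi (by rw [hdeg]; exact seqDeg_le _ _ _) with rfl | rfl
  · by_cases hE : IsEdgeIndex b i
    · exact fwd i hE
    · simp only [IsEdgeIndex, not_or, Bool.not_eq_true] at hE
      obtain ⟨j, hj, hji⟩ := hpred i (Or.inr (by have := hk hE.1; omega))
      have := bwd j hj
      rwa [hji, hend i hE.1 (Or.inr (by omega))] at this
  · by_cases hE : b = true ∨ i.1 ≠ 0
    · obtain ⟨j, hj, rfl⟩ := hpred i hE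
      exact bwd j hj
    · simp only [not_or, Bool.not_eq_true, ne_eq, not_not] at hE
      rw [hend i hE.1 (Or.inl hE.2)]
      exact fwd i (Or.inr (by have := hk hE.1; omega))

/-- Vertices of degree at most two have no room for further edges, so the listed vertices are closed
under crossing edges and contain the component. Consecutive ones are joined, so they all belong to
it. -/
lemma supp_eq_range {b : Bool} {k : ℕ} (hk : b = false → 2 ≤ k)
    {f : Fin k → d.HalfEdge} (hf : f ∈ compSeqs d b k) {σ : d.Pairing}
    (hσ : compPattern b f ⊆ edges σ) {c : (graph σ).ConnectedComponent} {i₀ : Fin k}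
    (hc : (f i₀).1 ∈ c.supp) : c.supp = Set.range fun i => (f i).1 := by
  have hstep := compPattern_subset_iff.1 hσ
  apply Set.Subset.antisymm
  · refine supp_subset_of_closed hc ⟨i₀, rfl⟩ ?_
    rintro h ⟨i, hi⟩
    obtain ⟨j, hj, he⟩ := mem_compPattern.1 (mk_apply_mem_compPattern hk hf hσ hi.symm)
    rw [Sym2.eq_iff] at he
    rcases he with ⟨-, h2⟩ | ⟨h1, -⟩
    · exact ⟨rot j, by simp [← h2]⟩
    · exact ⟨j, by simp [h1]⟩
  · have hsucc : ∀ i : Fin k, IsEdgeIndex b i → ((f i).1 ∈ c.supp ↔ (f (rot i)).1 ∈ c.supp) := by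
      intro i hi
      rw [hstep i hi, step, opp_fst]
      exact apply_fst_mem_supp_iff.symm
    have h0 : ∀ m (hm : m < k), ((f ⟨m, hm⟩).1 ∈ c.supp ↔ (f ⟨0, by omega⟩).1 ∈ c.supp) := by
      intro m
      induction m with
      | zero => exact fun _ => Iff.rfl
      | succ m ih =>
        intro hm
        rw [← ih (by omega), hsucc ⟨m, by omega⟩ (Or.inr hm)]
        have : rot (⟨m, by omega⟩ : Fin k) = ⟨m + 1, hm⟩ := by
          ext
          rw [rot_val, if_pos hm]
        rw [this]
    rintro _ ⟨i, rfl⟩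
    exact (h0 i.1 i.2).2 ((h0 i₀.1 i₀.2).1 hc)

/-- The components that are cycles (`b = true`) or lines (`b = false`) of length `k`. -/
def IsComp (σ : d.Pairing) (b : Bool) (k : ℕ) (c : (graph σ).ConnectedComponent) : Prop :=
  c.supp.ncard = k ∧ if b then ∀ v ∈ c.supp, d.deg v = 2 else
    {v ∈ c.supp | d.deg v = 1}.ncard = 2 ∧ {v ∈ c.supp | d.deg v = 2}.ncard = k - 2

/-- The component has exactly the vertices of `f`, so its degree counts can be read off `seqDeg`.
For a line the two indices of degree one are `0` and `k - 1`, distinct because `2 ≤ k`. -/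
lemma isComp_of_compPattern_subset {b : Bool} {k : ℕ} (hk : b = false → 2 ≤ k)
    {f : Fin k → d.HalfEdge} (hf : f ∈ compSeqs d b k) {σ : d.Pairing}
    (hσ : compPattern b f ⊆ edges σ) {c : (graph σ).ConnectedComponent} {i₀ : Fin k}
    (hc : (f i₀).1 ∈ c.supp) : IsComp σ b k c := by
  have hs := supp_eq_range hk hf hσ hc
  obtain ⟨hinj, hdeg⟩ := mem_compSeqs.1 hf
  have hcount : ∀ j, {v ∈ c.supp | d.deg v = j}.ncard =
      (Finset.univ.filter fun i : Fin k => seqDeg b k i = j).card := by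
    intro j
    rw [← Set.ncard_coe_finset, ← Set.ncard_image_of_injective _ hinj]
    congr 1
    ext v
    rw [hs]
    simp only [Set.mem_ofPred_eq, Set.mem_range, Finset.coe_filter, Finset.mem_univ, true_and,
      Set.mem_image]
    constructor
    · rintro ⟨⟨i, rfl⟩, h⟩
      exact ⟨i, by rw [← hdeg, h], rfl⟩
    · rintro ⟨i, h, rfl⟩
      exact ⟨⟨i, rfl⟩, by rw [hdeg, h]⟩
  refine ⟨?_, ?_⟩
  · rw [hs, ← Set.image_univ, Set.ncard_image_of_injective _ hinj, Set.ncard_univ]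
    simp
  · cases b
    · have hk2 := hk rfl
      simp only [Bool.false_eq_true, if_false]
      have h1 : (Finset.univ.filter fun i : Fin k => seqDeg false k i = 1) =
          {⟨0, by omega⟩, ⟨k - 1, by omega⟩} := by
        ext i
        have := i.2
        simp only [seqDeg, true_and, Finset.mem_filter, Finset.mem_univ, Finset.mem_insert,
          Finset.mem_singleton, Fin.ext_iff]
        split_ifs <;> simp <;> omega
      have h1c : (Finset.univ.filter fun i : Fin k => seqDeg false k i = 1).card = 2 := by
        rw [h1, Finset.card_pair]
        simp only [ne_eq, Fin.mk.injEq]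
        omega
      have h2c : (Finset.univ.filter fun i : Fin k => seqDeg false k i = 2) =
          Finset.univ.filter fun i : Fin k => ¬ seqDeg false k i = 1 := by
        refine Finset.filter_congr fun i _ => ?_
        unfold seqDeg
        split_ifs <;> simp
      refine ⟨by rw [hcount, h1c], ?_⟩
      rw [hcount, h2c]
      have := Finset.card_filter_add_card_filter_not (s := (Finset.univ : Finset (Fin k)))
        (fun i => seqDeg false k i = 1)
      rw [h1c, Finset.card_univ, Fintype.card_fin] at this
      omega
    · simp only [if_true]
      rw [hs]
      rintro _ ⟨i, rfl⟩
      rw [hdeg]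
      simp [seqDeg]

end DegreeSequence
end ConfigModel

/-! ### Components that are lines or cycles correspond to occurring patterns. -/

namespace ConfigModel
namespace DegreeSequence

variable {n : ℕ} {d : DegreeSequence n}

/-- The first `k` half-edges of the walk from `h`. -/
def walkSeq (σ : d.Pairing) (h : d.HalfEdge) (k : ℕ) (i : Fin k) : d.HalfEdge := (step σ)^[i] h

/-- An occurring sequence is determined by its first half-edge. This reduces the counting of
labelled sequences along a component to the counting of starting half-edges. -/
lemma eq_walkSeq {b : Bool} {k : ℕ} {f : Fin k → d.HalfEdge} {σ : d.Pairing}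
    (hσ : compPattern b f ⊆ edges σ) (hk : 0 < k) : f = walkSeq σ (f ⟨0, hk⟩) k := by
  have hstep := compPattern_subset_iff.1 hσ
  have : ∀ m (hm : m < k), f ⟨m, hm⟩ = (step σ)^[m] (f ⟨0, hk⟩) := by
    intro m
    induction m with
    | zero => exact fun _ => rfl
    | succ m ih =>
      intro hm
      rw [Function.iterate_succ_apply', ← ih (by omega), ← hstep ⟨m, by omega⟩ (Or.inr hm)]
      congr 1
      ext
      rw [rot_val, if_pos hm]
  ext1 i
  exact this i.1 i.2

lemma iterate_fst_mem_supp {σ : d.Pairing} {c : (graph σ).ConnectedComponent} {h : d.HalfEdge}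
    (hh : h.1 ∈ c.supp) (i : ℕ) : ((step σ)^[i] h).1 ∈ c.supp := by
  induction i with
  | zero => exact hh
  | succ i ih =>
    rw [Function.iterate_succ_apply', step, opp_fst]
    exact apply_fst_mem_supp ih

lemma compPattern_walkSeq_subset {b : Bool} {k : ℕ} {σ : d.Pairing} {h : d.HalfEdge}
    (hb : b = true → (step σ)^[k] h = h) : compPattern b (walkSeq σ h k) ⊆ edges σ := by
  rw [compPattern_subset_iff]
  intro i hi
  rw [walkSeq, walkSeq, ← Function.iterate_succ_apply' (step σ), rot_val]
  split_ifs with h1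
  · rfl
  · have hik := i.2
    have h2 : i.1.succ = k := by omega
    rw [h2, hb (hi.resolve_right h1)]
    rfl

lemma exists_periodic (σ : d.Pairing) (h : d.HalfEdge) : h ∈ Function.periodicPts (step σ) :=
  (step_injective σ).mem_periodicPts h

/-- Run the walk for its minimal period `p`. Returning earlier to a vertex by the same half-edge
contradicts minimality; returning by the opposite one forces a reflection, hence a vertex of degree
one. The walk therefore traces a cycle component of length `p`, and comparing sizes gives `p = k`.
-/
lemma walkSeq_mem_of_cycle {σ : d.Pairing} {k : ℕ} {c : (graph σ).ConnectedComponent}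
    (hc : IsComp σ true k c) {h : d.HalfEdge} (hh : h.1 ∈ c.supp) :
    walkSeq σ h k ∈ compSeqs d true k ∧ compPattern true (walkSeq σ h k) ⊆ edges σ := by
  have hdeg : ∀ i, d.deg ((step σ)^[i] h).1 = 2 := fun i =>
    (by simpa using hc.2 : ∀ v ∈ c.supp, d.deg v = 2) _ (iterate_fst_mem_supp hh i)
  set p := Function.minimalPeriod (step σ) h with hp
  have hp0 : 0 < p := Function.minimalPeriod_pos_of_mem_periodicPts (exists_periodic σ h)
  have hsub : compPattern true (walkSeq σ h p) ⊆ edges σ :=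
    compPattern_walkSeq_subset fun _ => Function.iterate_minimalPeriod
  have hlt : ∀ i j, i < j → j < p → ((step σ)^[i] h).1 ≠ ((step σ)^[j] h).1 := by
    intro i j hij hj heq
    rcases eq_or_eq_opp heq.symm (hdeg i).le with h1 | h1
    · have := Function.iterate_injOn_Iio_minimalPeriod (f := step σ) (x := h) hj (hij.trans hj) h1
      omega
    · obtain ⟨m, rfl⟩ : ∃ m, j = i + (m + 1) := ⟨j - i - 1, by omega⟩
      obtain ⟨l, -, -, hl⟩ := exists_opp_eq_self σ h m i h1
      exact opp_ne_self (hdeg l) hl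
  have hmem : walkSeq σ h p ∈ compSeqs d true p := by
    rw [mem_compSeqs]
    refine ⟨fun i j hij => ?_, fun i => ?_⟩
    · by_contra hne
      rcases Nat.lt_or_gt_of_ne (fun h => hne (Fin.ext h)) with h1 | h1
      · exact hlt i j h1 j.2 hij
      · exact hlt j i h1 i.2 hij.symm
    · rw [walkSeq, hdeg, seqDeg]
      simp
  have hcomp : IsComp σ true p c :=
    isComp_of_compPattern_subset (by simp) hmem hsub (i₀ := ⟨0, hp0⟩) hh
  have hpk : p = k := hcomp.1.symm.trans hc.1
  rw [← hpk]
  exact ⟨hmem, hsub⟩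

lemma deg_of_mem_line {σ : d.Pairing} {k : ℕ} (hk : 2 ≤ k) {c : (graph σ).ConnectedComponent}
    (hc : IsComp σ false k c) {v : Fin n} (hv : v ∈ c.supp) : d.deg v = 1 ∨ d.deg v = 2 := by
  obtain ⟨h0, h1, h2⟩ := hc
  have hun : ({v ∈ c.supp | d.deg v = 1} ∪ {v ∈ c.supp | d.deg v = 2}).ncard = k := by
    rw [Set.ncard_union_eq, h1, h2]
    · omega
    · rw [Set.disjoint_left]
      rintro x ⟨-, hx⟩ ⟨-, hx'⟩
      omega
  have hsub : {v ∈ c.supp | d.deg v = 1} ∪ {v ∈ c.supp | d.deg v = 2} ⊆ c.supp :=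
    Set.union_subset (Set.sep_subset _ _) (Set.sep_subset _ _)
  have heq := Set.eq_of_subset_of_ncard_le hsub (by rw [hun, h0])
  rw [← heq] at hv
  exact hv.imp And.right And.right

/-- Run the walk until it first meets a vertex of degree one again, at time `m`; periodicity
guarantees that this happens. No vertex repeats: a reversal would need a reflection strictly
between, at a vertex of degree two, and a repetition of the same half-edge can be pulled back to an
early return to `h`. Comparing sizes gives `m + 1 = k`. -/
lemma walkSeq_mem_of_line {σ : d.Pairing} {k : ℕ} (hk : 2 ≤ k) {c : (graph σ).ConnectedComponent}
    (hc : IsComp σ false k c) {h : d.HalfEdge} (hh : h.1 ∈ c.supp) (h1 : d.deg h.1 = 1) :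
    walkSeq σ h k ∈ compSeqs d false k ∧ compPattern false (walkSeq σ h k) ⊆ edges σ := by
  have hdeg : ∀ i, d.deg ((step σ)^[i] h).1 = 1 ∨ d.deg ((step σ)^[i] h).1 = 2 := fun i =>
    deg_of_mem_line hk hc (iterate_fst_mem_supp hh i)
  have hex : ∃ m, 0 < m ∧ d.deg ((step σ)^[m] h).1 = 1 := by
    obtain ⟨p, hp, hper⟩ := exists_periodic σ h
    exact ⟨p, hp, by rw [hper.eq, h1]⟩
  classical
  set m := Nat.find hex with hm
  obtain ⟨hm0, hm1⟩ := Nat.find_spec hex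
  rw [← hm] at hm0 hm1
  have hmid : ∀ i, 0 < i → i < m → d.deg ((step σ)^[i] h).1 = 2 := fun i hi0 him =>
    (hdeg i).resolve_left fun hi => Nat.find_min hex him ⟨hi0, hi⟩
  have hrefl : ∀ i j, i < j → j ≤ m → (step σ)^[j] h ≠ opp ((step σ)^[i] h) := by
    intro i j hij hj heq
    obtain ⟨a, rfl⟩ : ∃ a, j = i + (a + 1) := ⟨j - i - 1, by omega⟩
    obtain ⟨l, h2, h3, hl⟩ := exists_opp_eq_self σ h a i heq
    exact opp_ne_self (hmid l (by omega) (by omega)) hl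
  have hlt : ∀ i j, i < j → j ≤ m → ((step σ)^[i] h).1 ≠ ((step σ)^[j] h).1 := by
    intro i j hij hj heq
    rcases eq_or_eq_opp heq.symm (by rcases hdeg i with h | h <;> omega) with h2 | h2
    -- At the start `opp` fixes `h`, so a return to `h` counts as a reversal. Later coincidences are
    -- cancelled by injectivity of `step`.
    · rcases Nat.eq_zero_or_pos i with rfl | hi
      · refine hrefl 0 j hij hj ?_
        rw [h2]
        exact (opp_eq_self h1).symm
      · obtain ⟨a, rfl⟩ : ∃ a, j = i + a := ⟨j - i, by omega⟩
        rw [Function.iterate_add_apply] at h2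
        have h3 := (step_injective σ).iterate i h2
        have h4 := hmid a (by omega) (by omega)
        rw [h3] at h4
        omega
    · exact hrefl i j hij hj h2
  have hsub : compPattern false (walkSeq σ h (m + 1)) ⊆ edges σ :=
    compPattern_walkSeq_subset (by simp)
  have hmem : walkSeq σ h (m + 1) ∈ compSeqs d false (m + 1) := by
    rw [mem_compSeqs]
    refine ⟨fun i j hij => ?_, fun i => ?_⟩
    · have hi := i.2
      have hj := j.2
      by_contra hne
      rcases Nat.lt_or_gt_of_ne (fun h => hne (Fin.ext h)) with h1 | h1
      · exact hlt i j h1 (by omega) hij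
      · exact hlt j i h1 (by omega) hij.symm
    · have hi := i.2
      rw [walkSeq, seqDeg]
      split_ifs with h2
      · rcases h2.2 with h2 | h2
        · rw [h2]
          exact h1
        · rw [show i.1 = m by omega, hm1]
      · simp only [true_and, not_or] at h2
        exact hmid _ (by omega) (by omega)
  have hcomp : IsComp σ false (m + 1) c :=
    isComp_of_compPattern_subset (fun _ => by omega) hmem hsub (i₀ := ⟨0, by omega⟩) hh
  have hpk : m + 1 = k := hcomp.1.symm.trans hc.1
  rw [← hpk]
  exact ⟨hmem, hsub⟩

lemma walkSeq_mem {σ : d.Pairing} {b : Bool} {k : ℕ} (hk : 2 ≤ k)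
    {c : (graph σ).ConnectedComponent} (hc : IsComp σ b k c) {h : d.HalfEdge} (hh : h.1 ∈ c.supp)
    (h1 : d.deg h.1 = seqDeg b k 0) :
    walkSeq σ h k ∈ compSeqs d b k ∧ compPattern b (walkSeq σ h k) ⊆ edges σ := by
  cases b
  · exact walkSeq_mem_of_line hk hc hh (by simpa [seqDeg] using h1)
  · exact walkSeq_mem_of_cycle hc hh

open Classical in
/-- The edges of a connected component. -/
noncomputable def compEdges (σ : d.Pairing) (c : (graph σ).ConnectedComponent) :
    Finset (Sym2 d.HalfEdge) :=
  (edges σ).filter fun e => ∃ h ∈ e, h.1 ∈ c.supp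

lemma compEdges_eq {b : Bool} {k : ℕ} (hk : 2 ≤ k)
    {f : Fin k → d.HalfEdge} (hf : f ∈ compSeqs d b k) {σ : d.Pairing}
    (hσ : compPattern b f ⊆ edges σ) {c : (graph σ).ConnectedComponent} {i₀ : Fin k}
    (hc : (f i₀).1 ∈ c.supp) : compEdges σ c = compPattern b f := by
  have hs := supp_eq_range (fun _ => hk) hf hσ hc
  ext e
  simp only [compEdges, Finset.mem_filter]
  constructor
  · rintro ⟨he, h, hhe, hh⟩
    rw [hs] at hh
    obtain ⟨i, hi⟩ := hh
    have h1 := mk_apply_mem_compPattern (fun _ => hk) hf hσ hi.symm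
    have h2 := (isPartialMatching_edges σ).2 e he _ (hσ h1) h hhe (Sym2.mem_mk_left _ _)
    rwa [h2]
  · intro he
    refine ⟨hσ he, ?_⟩
    obtain ⟨i, hi, rfl⟩ := mem_compPattern.1 he
    exact ⟨f i, Sym2.mem_mk_left _ _, hs ▸ ⟨i, rfl⟩⟩

/-- The cycles or lines of length `k`, as patterns. -/
def compPatterns (d : DegreeSequence n) (b : Bool) (k : ℕ) : Finset (Finset (Sym2 d.HalfEdge)) :=
  (compSeqs d b k).image (compPattern b)

lemma mem_compPatterns {b : Bool} {k : ℕ} {α : Finset (Sym2 d.HalfEdge)} :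
    α ∈ compPatterns d b k ↔ ∃ f ∈ compSeqs d b k, compPattern b f = α := by
  simp [compPatterns]

lemma eq_of_mem_compEdges {σ : d.Pairing} {c c' : (graph σ).ConnectedComponent}
    {e : Sym2 d.HalfEdge} (h : e ∈ compEdges σ c) (h' : e ∈ compEdges σ c') : c = c' := by
  simp only [compEdges, Finset.mem_filter] at h h'
  obtain ⟨he, x, hx, hxc⟩ := h
  obtain ⟨-, y, hy, hyc⟩ := h'
  obtain ⟨z, rfl⟩ := hx
  rw [mk_mem_edges] at he
  rw [Sym2.mem_iff] at hy
  rcases hy with rfl | rfl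
  · exact SimpleGraph.ConnectedComponent.eq_of_common_vertex hxc hyc
  · rw [← he, apply_fst_mem_supp_iff] at hyc
    exact SimpleGraph.ConnectedComponent.eq_of_common_vertex hxc hyc

lemma exists_start {σ : d.Pairing} {b : Bool} {k : ℕ}
    {c : (graph σ).ConnectedComponent} (hc : IsComp σ b k c) :
    ∃ h : d.HalfEdge, h.1 ∈ c.supp ∧ d.deg h.1 = seqDeg b k 0 := by
  have : ∃ v ∈ c.supp, d.deg v = seqDeg b k 0 := by
    cases b
    · have h1 := hc.2.1
      obtain ⟨v, hv, hv1⟩ := Set.nonempty_of_ncard_ne_zero (by rw [h1]; norm_num)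
      exact ⟨v, hv, by simpa [seqDeg] using hv1⟩
    · obtain ⟨v, hv⟩ := c.nonempty_supp
      have h2 : ∀ v ∈ c.supp, d.deg v = 2 := by simpa using hc.2
      exact ⟨v, hv, by simpa [seqDeg] using h2 v hv⟩
  obtain ⟨v, hv, hdv⟩ := this
  have h0 : 0 < d.deg v := by
    rw [hdv, seqDeg]
    split_ifs <;> omega
  exact ⟨⟨v, ⟨0, h0⟩⟩, hv, hdv⟩

/-- A component of line or cycle type is the same thing as an occurring pattern. -/
lemma ncard_isComp (σ : d.Pairing) (b : Bool) {k : ℕ} (hk : 2 ≤ k) :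
    {c | IsComp σ b k c}.ncard = patternCount (compPatterns d b k) σ := by
  rw [patternCount, ← Set.ncard_coe_finset]
  -- The map sending a component to its set of edges is onto the occurring patterns; it is injective
  -- because an edge lies in only one component.
  have himg : (((compPatterns d b k).filter fun α => α ⊆ edges σ : Finset _) : Set _) =
      compEdges σ '' {c | IsComp σ b k c} := by
    ext α
    simp only [Finset.coe_filter, mem_compPatterns, Set.mem_ofPred_eq, Set.mem_image]
    constructor
    · rintro ⟨⟨f, hf, rfl⟩, hσ⟩
      have hmem : (f ⟨0, by omega⟩).1 ∈
          ((graph σ).connectedComponentMk (f ⟨0, by omega⟩).1).supp := rfl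
      exact ⟨_, isComp_of_compPattern_subset (fun _ => hk) hf hσ hmem, compEdges_eq hk hf hσ hmem⟩
    · rintro ⟨c, hc, rfl⟩
      obtain ⟨h, hh, hd⟩ := exists_start hc
      obtain ⟨h1, h2⟩ := walkSeq_mem hk hc hh hd
      have h3 := compEdges_eq hk h1 h2 (i₀ := ⟨0, by omega⟩) hh
      exact ⟨⟨_, h1, h3.symm⟩, h3 ▸ h2⟩
  rw [himg, Set.InjOn.ncard_image]
  intro c hc c' hc' heq
  obtain ⟨h, hh, -⟩ := exists_start hc
  have hmem : s(h, σ.1 h) ∈ compEdges σ c := by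
    simp only [compEdges, Finset.mem_filter]
    exact ⟨mk_mem_edges.2 rfl, h, Sym2.mem_mk_left _ _, hh⟩
  have hmem' := hmem
  rw [heq] at hmem'
  exact eq_of_mem_compEdges hmem hmem'

lemma cycles_eq_patternCount (σ : d.Pairing) {k : ℕ} (hk : 2 ≤ k) :
    cycles σ k = patternCount (compPatterns d true k) σ := by
  rw [← ncard_isComp σ true hk, cycles]
  simp [IsComp]

lemma lines_eq_patternCount (σ : d.Pairing) {k : ℕ} (hk : 2 ≤ k) :
    lines σ k = patternCount (compPatterns d false k) σ := by
  rw [← ncard_isComp σ false hk, lines]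
  simp [IsComp]

/-- The number of labelled walks along a given line or cycle of length `k`. -/
def seqMult (b : Bool) (k : ℕ) : ℕ := if b then 2 * k else 2

lemma card_start {σ : d.Pairing} {b : Bool} {k : ℕ}
    {c : (graph σ).ConnectedComponent} (hc : IsComp σ b k c) :
    {h : d.HalfEdge | h.1 ∈ c.supp ∧ d.deg h.1 = seqDeg b k 0}.ncard = seqMult b k := by
  classical
  have h1 : {h : d.HalfEdge | h.1 ∈ c.supp ∧ d.deg h.1 = seqDeg b k 0} =
      (((Finset.univ.filter fun v : Fin n => v ∈ c.supp ∧ d.deg v = seqDeg b k 0).sigma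
        fun _ => Finset.univ : Finset d.HalfEdge) : Set d.HalfEdge) := by
    ext h
    simp
  rw [h1, Set.ncard_coe_finset, Finset.card_sigma]
  have h2 : ∀ v ∈ Finset.univ.filter (fun v : Fin n => v ∈ c.supp ∧ d.deg v = seqDeg b k 0),
      (Finset.univ : Finset (Fin (d.deg v))).card = seqDeg b k 0 := fun v hv => by
    rw [Finset.card_univ, Fintype.card_fin, (Finset.mem_filter.1 hv).2.2]
  rw [Finset.sum_congr rfl h2, Finset.sum_const, smul_eq_mul, ← Set.ncard_coe_finset]
  cases b
  · have h3 := hc.2.1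
    simp only [seqDeg, true_and, true_or, if_true, mul_one, seqMult, Bool.false_eq_true, if_false,
      Finset.coe_filter, Finset.mem_univ]
    exact h3
  · have h3 : ∀ v ∈ c.supp, d.deg v = 2 := by simpa using hc.2
    have h4 : {v | v ∈ c.supp ∧ d.deg v = 2} = c.supp :=
      Set.ext fun v => ⟨And.left, fun h => ⟨h, h3 v h⟩⟩
    simp only [seqDeg, Bool.true_eq_false, false_and, if_false, seqMult, if_true,
      Finset.coe_filter, Finset.mem_univ, true_and]
    rw [h4, hc.1, mul_comm]

/-- Each line or cycle of length `k` corresponds to `seqMult b k` labelled walks. -/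
lemma card_filter_compSeqs (σ : d.Pairing) (b : Bool) {k : ℕ} (hk : 2 ≤ k) :
    ((compSeqs d b k).filter fun f => compPattern b f ⊆ edges σ).card =
      seqMult b k * patternCount (compPatterns d b k) σ := by
  classical
  have hk0 : 0 < k := by omega
  rw [← ncard_isComp σ b hk]
  set C : Finset (graph σ).ConnectedComponent := (Set.toFinite {c | IsComp σ b k c}).toFinset
    with hC
  have hCmem : ∀ c, c ∈ C ↔ IsComp σ b k c := fun c => by simp [hC]
  have hCcard : {c | IsComp σ b k c}.ncard = C.card := Set.ncard_eq_toFinset_card _ _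
  rw [hCcard, mul_comm, ← smul_eq_mul, ← Finset.sum_const]
  -- Group the sequences by the component of their first vertex. Within a component they are the
  -- walks from its admissible starts: every half-edge of a cycle, the two end half-edges of a line.
  rw [Finset.card_eq_sum_card_fiberwise (t := C)
    (f := fun f => (graph σ).connectedComponentMk (f ⟨0, hk0⟩).1)]
  · refine Finset.sum_congr rfl fun c hcC => ?_
    have hc := (hCmem c).1 hcC
    rw [← card_start hc, ← Set.ncard_coe_finset]
    have hinj : Set.InjOn (fun h => walkSeq σ h k)
        {h : d.HalfEdge | h.1 ∈ c.supp ∧ d.deg h.1 = seqDeg b k 0} := by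
      intro h _ h' _ heq
      exact congrFun heq ⟨0, hk0⟩
    rw [← hinj.ncard_image]
    congr 1
    ext f
    simp only [Finset.coe_filter, Set.mem_ofPred_eq, Finset.mem_filter, Set.mem_image]
    constructor
    · rintro ⟨⟨hf, hσ⟩, hfc⟩
      refine ⟨f ⟨0, hk0⟩, ⟨hfc, (mem_compSeqs.1 hf).2 ⟨0, hk0⟩⟩, (eq_walkSeq hσ hk0).symm⟩
    · rintro ⟨h, ⟨hh, hd⟩, rfl⟩
      exact ⟨walkSeq_mem hk hc hh hd, hh⟩
  · intro f hf
    simp only [Finset.coe_filter, Set.mem_ofPred_eq] at hf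
    exact (hCmem _).2 (isComp_of_compPattern_subset (fun _ => hk) hf.1 hf.2 (i₀ := ⟨0, hk0⟩) rfl)

/-- The number of sequences per pattern is never computed pattern by pattern: the identity of
`card_filter_compSeqs` holds for each pairing, and its expectation is taken. -/
lemma sum_edgeProb_compPatterns (b : Bool) {k : ℕ} (hk : 2 ≤ k) :
    ∑ α ∈ compPatterns d b k, edgeProb α =
      (compSeqs d b k).card / (seqMult b k * oddProd d (seqEdges b k)) := by
  have h1 : (seqMult b k : ℝ) * ∑ α ∈ compPatterns d b k, edgeProb α =
      ∑ f ∈ compSeqs d b k, edgeProb (compPattern b f) := by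
    rw [← expect_patternCount, ← expect_const_mul]
    simp only [edgeProb]
    rw [← expect_sum]
    congr 1
    ext σ
    have := card_filter_compSeqs σ b hk
    rw [Finset.card_filter] at this
    exact_mod_cast this.symm
  have h2 : ∑ f ∈ compSeqs d b k, edgeProb (compPattern b f) =
      (compSeqs d b k).card * (oddProd d (seqEdges b k))⁻¹ := by
    rw [← nsmul_eq_mul, ← Finset.sum_const]
    refine Finset.sum_congr rfl fun f hf => ?_
    rw [edgeProb_eq (isPartialMatching_compPattern hf), card_compPattern hf]
  have h3 : (seqMult b k : ℝ) ≠ 0 := by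
    unfold seqMult
    split_ifs <;> simp
    omega
  rw [h2] at h1
  rw [div_mul_eq_div_div, eq_div_of_mul_eq h3 ((mul_comm _ _).trans h1)]
  rw [div_right_comm, div_eq_mul_inv _ (oddProd d _)]

end DegreeSequence
end ConfigModel

namespace ConfigModel
namespace DegreeSequence

variable {n : ℕ} {d : DegreeSequence n}

/-! ### Edge multiplicities -/

lemma card_halfEdge_at (v : Fin n) : Fintype.card {h : d.HalfEdge // h.1 = v} = d.deg v := by
  rw [Fintype.card_congr (Equiv.sigmaSubtype v), Fintype.card_fin]

lemma card_halfEdge (d : DegreeSequence n) : Fintype.card d.HalfEdge = ∑ v, d.deg v := by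
  simp [HalfEdge]

lemma ends_mk (a b : d.HalfEdge) : ends s(a, b) = s(a.1, b.1) := rfl

/-- An edge between distinct vertices has exactly one half-edge at `u`. For a loop this would count
every edge twice. -/
lemma mult_eq_card {u v : Fin n} (huv : u ≠ v) (σ : d.Pairing) :
    mult σ s(u, v) = Fintype.card {h : {h : d.HalfEdge // h.1 = u} // (σ.1 h.1).1 = v} := by
  rw [mult, ← Fintype.card_coe]
  have hmem : ∀ h : {h : {h : d.HalfEdge // h.1 = u} // (σ.1 h.1).1 = v},
      s(h.1.1, σ.1 h.1.1) ∈ (edges σ).filter fun e => ends e = s(u, v) := fun h => by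
    rw [Finset.mem_filter, mk_mem_edges, ends_mk, h.1.2, h.2]
    exact ⟨rfl, rfl⟩
  refine (Fintype.card_congr (Equiv.ofBijective (fun h => ⟨_, hmem h⟩) ⟨?_, ?_⟩)).symm
  · rintro ⟨⟨h, hu⟩, hv⟩ ⟨⟨h', hu'⟩, hv'⟩ heq
    simp only [Subtype.mk.injEq, Sym2.eq_iff] at heq ⊢
    rcases heq with heq | heq
    · exact heq.1
    · exact absurd (hu.symm.trans ((congrArg Sigma.fst heq.1).trans hv')) huv
  · rintro ⟨e, he⟩
    rw [Finset.mem_filter] at he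
    induction e with | _ a b =>
    rw [mk_mem_edges, ends_mk, Sym2.eq_iff] at he
    obtain ⟨hab, ⟨h1, h2⟩ | ⟨h1, h2⟩⟩ := he
    · exact ⟨⟨⟨a, h1⟩, by simp only; rw [hab, h2]⟩, by simp [hab]⟩
    · have hba : σ.1 b = a := by rw [← hab, σ.2.1]
      exact ⟨⟨⟨b, h2⟩, by simp only; rw [hba, h1]⟩, by simp [hba, Sym2.eq_swap]⟩

/-- The pattern that joins a tuple of half-edges at `u` to a tuple of half-edges at `v`. -/
def tuplePattern {u v : Fin n} {k : ℕ}
    (p : (Fin k ↪ {h : d.HalfEdge // h.1 = u}) × (Fin k ↪ {h : d.HalfEdge // h.1 = v})) :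
    Finset (Sym2 d.HalfEdge) :=
  Finset.univ.image fun i => s((p.1 i).1, (p.2 i).1)

lemma tuplePattern_subset_iff {u v : Fin n} {k : ℕ}
    {p : (Fin k ↪ {h : d.HalfEdge // h.1 = u}) × (Fin k ↪ {h : d.HalfEdge // h.1 = v})}
    {σ : d.Pairing} :
    tuplePattern p ⊆ edges σ ↔ ∀ i, σ.1 (p.1 i).1 = (p.2 i).1 := by
  simp [tuplePattern, Finset.image_subset_iff, mk_mem_edges]

lemma tuplePattern_index_eq {u v : Fin n} (huv : u ≠ v) {k : ℕ}
    (p : (Fin k ↪ {h : d.HalfEdge // h.1 = u}) × (Fin k ↪ {h : d.HalfEdge // h.1 = v}))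
    {i j : Fin k} {h : d.HalfEdge} (hi : h ∈ s((p.1 i).1, (p.2 i).1))
    (hj : h ∈ s((p.1 j).1, (p.2 j).1)) : i = j := by
  rw [Sym2.mem_iff] at hi hj
  rcases hi with hi | hi <;> rcases hj with hj | hj
  · exact p.1.injective (Subtype.ext (hi.symm.trans hj))
  · exact absurd ((p.1 i).2.symm.trans ((congrArg Sigma.fst (hi.symm.trans hj)).trans (p.2 j).2))
      huv
  · exact absurd ((p.1 j).2.symm.trans ((congrArg Sigma.fst (hj.symm.trans hi)).trans (p.2 i).2))
      huv
  · exact p.2.injective (Subtype.ext (hi.symm.trans hj))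

lemma isPartialMatching_tuplePattern {u v : Fin n} (huv : u ≠ v) {k : ℕ}
    (p : (Fin k ↪ {h : d.HalfEdge // h.1 = u}) × (Fin k ↪ {h : d.HalfEdge // h.1 = v})) :
    IsPartialMatching (tuplePattern p) := by
  simp only [IsPartialMatching, tuplePattern, Finset.mem_image, Finset.mem_univ, true_and,
    forall_exists_index, forall_apply_eq_imp_iff]
  refine ⟨fun i => ?_, fun i j h hi hj => by rw [tuplePattern_index_eq huv p hi hj]⟩
  rw [Sym2.mk_isDiag_iff]
  intro h
  exact huv ((p.1 i).2.symm.trans ((congrArg Sigma.fst h).trans (p.2 i).2))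

lemma card_tuplePattern {u v : Fin n} (huv : u ≠ v) {k : ℕ}
    (p : (Fin k ↪ {h : d.HalfEdge // h.1 = u}) × (Fin k ↪ {h : d.HalfEdge // h.1 = v})) :
    (tuplePattern p).card = k := by
  rw [tuplePattern, Finset.card_image_of_injective, Finset.card_univ, Fintype.card_fin]
  intro i j hij
  exact tuplePattern_index_eq huv p (Sym2.mem_mk_left _ _)
    ((show s((p.1 i).1, (p.2 i).1) = s((p.1 j).1, (p.2 j).1) from hij) ▸ Sym2.mem_mk_left _ _)

/-- The factorial moments of edge multiplicities. -/
lemma expect_mult_descFactorial {u v : Fin n} (huv : u ≠ v) (k : ℕ) :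
    expect (fun σ : d.Pairing => ((mult σ s(u, v)).descFactorial k : ℝ)) =
      (d.deg u).descFactorial k * (d.deg v).descFactorial k / oddProd d k := by
  have h1 : ∀ σ : d.Pairing, ((mult σ s(u, v)).descFactorial k : ℝ) =
      ∑ p : (Fin k ↪ {h : d.HalfEdge // h.1 = u}) × (Fin k ↪ {h : d.HalfEdge // h.1 = v}),
        if tuplePattern p ⊆ edges σ then (1 : ℝ) else 0 := by
    intro σ
    rw [Finset.sum_boole, mult_eq_card huv]
    congr 1
    have h2 := Fintype.card_embedding_eq (α := Fin k)
      (β := {h : {h : d.HalfEdge // h.1 = u} // (σ.1 h.1).1 = v})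
    rw [Fintype.card_fin] at h2
    rw [← h2, ← Fintype.card_subtype]
    -- A `k`-tuple of distinct half-edges at `u` whose partners are at `v` is the same as a pair of
    -- tuples matched index by index; the second tuple is the image of the first under `σ`.
    refine Fintype.card_congr ⟨fun e => ⟨(e.trans (Function.Embedding.subtype _),
      ⟨fun i => ⟨σ.1 (e i).1.1, (e i).2⟩, fun i j hij => ?_⟩), ?_⟩, fun p => ⟨fun i =>
        ⟨p.1.1 i, ?_⟩, fun i j hij => ?_⟩, fun e => ?_, fun p => ?_⟩
    · simp only [Subtype.mk.injEq, EmbeddingLike.apply_eq_iff_eq] at hij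
      exact e.injective (Subtype.ext (Subtype.ext hij))
    · rw [tuplePattern_subset_iff]
      intro i
      rfl
    · rw [tuplePattern_subset_iff.1 p.2 i]
      exact (p.1.2 i).2
    · simp only [Subtype.mk.injEq] at hij
      exact p.1.1.injective hij
    · exact DFunLike.ext _ _ fun i => rfl
    · exact Subtype.ext (Prod.ext (DFunLike.ext _ _ fun i => rfl) (DFunLike.ext _ _ fun i =>
        Subtype.ext (tuplePattern_subset_iff.1 p.2 i)))
  simp_rw [h1]
  rw [expect_sum]
  have h3 : ∀ p : (Fin k ↪ {h : d.HalfEdge // h.1 = u}) × (Fin k ↪ {h : d.HalfEdge // h.1 = v}),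
      expect (fun σ => if tuplePattern p ⊆ edges σ then (1 : ℝ) else 0) = (oddProd d k)⁻¹ := by
    intro p
    have := edgeProb_eq (isPartialMatching_tuplePattern huv p)
    rwa [card_tuplePattern huv p] at this
  rw [Finset.sum_congr rfl fun p _ => h3 p, Finset.sum_const, Finset.card_univ, Fintype.card_prod,
    Fintype.card_embedding_eq, Fintype.card_embedding_eq, card_halfEdge_at, card_halfEdge_at,
    Fintype.card_fin, nsmul_eq_mul, div_eq_mul_inv]
  push_cast
  rfl

lemma expect_sum_mult_descFactorial (d : DegreeSequence n) (k : ℕ) :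
    expect (fun σ : d.Pairing =>
      ∑ z : Sym2 (Fin n) with ¬ z.IsDiag, ((mult σ z).descFactorial k : ℝ)) =
    ∑ p ∈ (Finset.univ : Finset (Fin n)).offDiag with p.1 < p.2,
      ((d.deg p.1).descFactorial k * (d.deg p.2).descFactorial k / oddProd d k : ℝ) := by
  rw [expect_sum, ← Finset.sym2_univ, Finset.sum_sym2_filter_not_isDiag]
  refine Finset.sum_congr rfl fun p hp => expect_mult_descFactorial ?_ k
  exact (Finset.mem_filter.1 hp).2.ne

lemma two_mul_sum_lt (w : Fin n → ℝ) :
    2 * ∑ p ∈ (Finset.univ : Finset (Fin n)).offDiag with p.1 < p.2, w p.1 * w p.2 =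
      (∑ v, w v) ^ 2 - ∑ v, w v ^ 2 := by
  have h1 : (∑ v, w v) ^ 2 = ∑ p : Fin n × Fin n, w p.1 * w p.2 := by
    rw [sq, Finset.sum_mul_sum, ← Finset.sum_product', Finset.univ_product_univ]
  have h2 : (Finset.univ : Finset (Fin n)).offDiag.filter (fun p => p.1 < p.2) =
      Finset.univ.filter fun p : Fin n × Fin n => p.1 < p.2 := by
    ext p
    simp only [Finset.mem_filter, Finset.mem_offDiag, Finset.mem_univ, true_and]
    exact ⟨And.right, fun h => ⟨h.ne, h⟩⟩
  have h3 : ∑ p : Fin n × Fin n with p.2 < p.1, w p.1 * w p.2 =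
      ∑ p : Fin n × Fin n with p.1 < p.2, w p.1 * w p.2 := by
    refine Finset.sum_bij' (fun p _ => p.swap) (fun p _ => p.swap) ?_ ?_ ?_ ?_ ?_
    · simp
    · simp
    · simp
    · simp
    · simp [mul_comm]
  have h4 : ∑ p : Fin n × Fin n with p.1 = p.2, w p.1 * w p.2 = ∑ v, w v ^ 2 := by
    rw [Finset.sum_filter, ← Finset.univ_product_univ, Finset.sum_product]
    refine Finset.sum_congr rfl fun v _ => ?_
    simp [sq]
  have h5 : ∑ p : Fin n × Fin n, w p.1 * w p.2 =
      ∑ p : Fin n × Fin n with p.1 < p.2, w p.1 * w p.2 +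
        (∑ p : Fin n × Fin n with p.1 = p.2, w p.1 * w p.2 +
          ∑ p : Fin n × Fin n with p.2 < p.1, w p.1 * w p.2) := by
    simp only [Finset.sum_filter]
    rw [← Finset.sum_add_distrib, ← Finset.sum_add_distrib]
    refine Finset.sum_congr rfl fun p _ => ?_
    rcases lt_trichotomy p.1 p.2 with h | h | h
    · simp [h, h.ne, h.not_gt]
    · simp [h]
    · simp [h, h.ne', h.not_gt]
  rw [h2, h1, h5, h4, h3]
  ring

/-! ### Patterns for pairs of parallel edges -/

open Classical in
/-- The pairs of parallel edges. -/
noncomputable def doublePatterns (d : DegreeSequence n) : Finset (Finset (Sym2 d.HalfEdge)) :=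
  (Finset.powersetCard 2 Finset.univ).filter fun α =>
    IsPartialMatching α ∧ ∃ z : Sym2 (Fin n), ¬ z.IsDiag ∧ ∀ e ∈ α, ends e = z

lemma mem_doublePatterns {α : Finset (Sym2 d.HalfEdge)} :
    α ∈ doublePatterns d ↔ α.card = 2 ∧ IsPartialMatching α ∧
      ∃ z : Sym2 (Fin n), ¬ z.IsDiag ∧ ∀ e ∈ α, ends e = z := by
  simp [doublePatterns]

lemma patternCount_doublePatterns (σ : d.Pairing) :
    patternCount (doublePatterns d) σ =
      ∑ z : Sym2 (Fin n) with ¬ z.IsDiag, (mult σ z).choose 2 := by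
  classical
  have h : (doublePatterns d).filter (fun α => α ⊆ edges σ) =
      (Finset.univ.filter fun z : Sym2 (Fin n) => ¬ z.IsDiag).biUnion fun z =>
        Finset.powersetCard 2 ((edges σ).filter fun e => ends e = z) := by
    ext α
    simp only [Finset.mem_filter, mem_doublePatterns, Finset.mem_biUnion, Finset.mem_univ, true_and,
      Finset.mem_powersetCard]
    constructor
    · rintro ⟨⟨h2, -, z, hz, he⟩, hσ⟩
      exact ⟨z, hz, fun e hα => Finset.mem_filter.2 ⟨hσ hα, he e hα⟩, h2⟩
    · rintro ⟨z, hz, hs, h2⟩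
      have hσ : α ⊆ edges σ := hs.trans (Finset.filter_subset _ _)
      exact ⟨⟨h2, (isPartialMatching_edges σ).mono hσ, z, hz,
        fun e he => (Finset.mem_filter.1 (hs he)).2⟩, hσ⟩
  rw [patternCount, h, Finset.card_biUnion]
  · refine Finset.sum_congr rfl fun z _ => ?_
    rw [Finset.card_powersetCard, mult]
  · intro z _ z' _ hzz'
    rw [Function.onFun, Finset.disjoint_left]
    intro α h1 h2
    rw [Finset.mem_powersetCard] at h1 h2
    obtain ⟨e, he⟩ := Finset.card_pos.1 (by rw [h1.2]; norm_num : 0 < α.card)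
    exact hzz' ((Finset.mem_filter.1 (h1.1 he)).2.symm.trans (Finset.mem_filter.1 (h2.1 he)).2)

/-- The factor `4` combines two halves: two edges form an unordered pair, and so do the two
vertices. -/
lemma sum_edgeProb_doublePatterns (d : DegreeSequence n) :
    ∑ α ∈ doublePatterns d, edgeProb α =
      ((∑ v, ((d.deg v).descFactorial 2 : ℝ)) ^ 2 - ∑ v, ((d.deg v).descFactorial 2 : ℝ) ^ 2) /
        (4 * oddProd d 2) := by
  have h1 : 2 * ∑ α ∈ doublePatterns d, edgeProb α = expect (fun σ : d.Pairing =>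
      ∑ z : Sym2 (Fin n) with ¬ z.IsDiag, ((mult σ z).descFactorial 2 : ℝ)) := by
    rw [← expect_patternCount, ← expect_const_mul]
    congr 1
    ext σ
    rw [patternCount_doublePatterns]
    push_cast
    rw [Finset.mul_sum]
    refine Finset.sum_congr rfl fun z _ => ?_
    rw [Nat.descFactorial_eq_factorial_mul_choose]
    simp
  have h2 := two_mul_sum_lt fun v => ((d.deg v).descFactorial 2 : ℝ)
  rw [expect_sum_mult_descFactorial, ← Finset.sum_div] at h1
  rw [← h2, mul_div_mul_comm]
  linarith

/-- A bound for the number of triples of parallel edges. -/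
noncomputable def tripleCount (σ : d.Pairing) : ℕ :=
  ∑ z : Sym2 (Fin n) with ¬ z.IsDiag, (mult σ z).descFactorial 3

/-- For `m ≤ 2` parallel edges the truncated difference `m - 1` equals `m.choose 2`; the two counts
can differ only if there is a triple edge. -/
lemma multiEdges_eq_or (σ : d.Pairing) :
    multiEdges σ = patternCount (doublePatterns d) σ ∨ 1 ≤ tripleCount σ := by
  by_cases h : ∃ z : Sym2 (Fin n), ¬ z.IsDiag ∧ 3 ≤ mult σ z
  · obtain ⟨z, hz, h3⟩ := h
    right
    calc 1 ≤ (mult σ z).descFactorial 3 := Nat.descFactorial_pos.2 h3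
      _ ≤ _ := Finset.single_le_sum (f := fun z => (mult σ z).descFactorial 3)
        (fun _ _ => Nat.zero_le _) (Finset.mem_filter.2 ⟨Finset.mem_univ z, hz⟩)
  · push Not at h
    left
    rw [patternCount_doublePatterns, multiEdges]
    refine Finset.sum_congr rfl fun z hz => ?_
    have := h z (Finset.mem_filter.1 hz).2
    interval_cases mult σ z <;> rfl

/-- Distinct pairs of parallel edges sharing an edge `e` are `{e, f}` and `{e, g}` with `f ≠ g`, all
three between the same vertices, so the ordered triple `(e, f, g)` recovers them. -/
lemma card_overlapping_doubles_le (σ : d.Pairing) :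
    (((doublePatterns d) ×ˢ (doublePatterns d)).filter fun p =>
      (p.1 ≠ p.2 ∧ ¬ Disjoint p.1 p.2) ∧ p.1 ∪ p.2 ⊆ edges σ).card ≤ tripleCount σ := by
  classical
  have hsub : (((doublePatterns d) ×ˢ (doublePatterns d)).filter fun p =>
      (p.1 ≠ p.2 ∧ ¬ Disjoint p.1 p.2) ∧ p.1 ∪ p.2 ⊆ edges σ) ⊆
      (Finset.univ.filter fun z : Sym2 (Fin n) => ¬ z.IsDiag).biUnion fun z =>
        (Finset.univ : Finset (Fin 3 ↪ {e // e ∈ (edges σ).filter fun e => ends e = z})).image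
          fun t => ({(t 0).1, (t 1).1}, {(t 0).1, (t 2).1}) := by
    rintro ⟨α, β⟩ hp
    simp only [Finset.mem_filter, Finset.mem_product, mem_doublePatterns] at hp
    obtain ⟨⟨⟨hα2, -, z, hz, hα⟩, ⟨hβ2, -, z', hz', hβ⟩⟩, ⟨hne, hdis⟩, hσ⟩ := hp
    rw [Finset.not_disjoint_iff] at hdis
    obtain ⟨e, heα, heβ⟩ := hdis
    obtain rfl : z = z' := (hα e heα).symm.trans (hβ e heβ)
    obtain ⟨f, hf⟩ : ∃ f, α.erase e = {f} := by
      rw [← Finset.card_eq_one, Finset.card_erase_of_mem heα, hα2]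
    obtain ⟨g, hg⟩ : ∃ g, β.erase e = {g} := by
      rw [← Finset.card_eq_one, Finset.card_erase_of_mem heβ, hβ2]
    have hα' : α = {e, f} := by rw [← Finset.insert_erase heα, hf]
    have hβ' : β = {e, g} := by rw [← Finset.insert_erase heβ, hg]
    have hfα : f ∈ α.erase e := by rw [hf]; exact Finset.mem_singleton_self f
    have hgβ : g ∈ β.erase e := by rw [hg]; exact Finset.mem_singleton_self g
    rw [Finset.mem_erase] at hfα hgβ
    have hfg : f ≠ g := by
      rintro rfl
      exact hne (hα'.trans hβ'.symm)
    have me : e ∈ (edges σ).filter fun e => ends e = z :=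
      Finset.mem_filter.2 ⟨hσ (Finset.mem_union_left _ heα), hα e heα⟩
    have mf : f ∈ (edges σ).filter fun e => ends e = z :=
      Finset.mem_filter.2 ⟨hσ (Finset.mem_union_left _ hfα.2), hα f hfα.2⟩
    have mg : g ∈ (edges σ).filter fun e => ends e = z :=
      Finset.mem_filter.2 ⟨hσ (Finset.mem_union_right _ hgβ.2), hβ g hgβ.2⟩
    rw [Finset.mem_biUnion]
    refine ⟨z, Finset.mem_filter.2 ⟨Finset.mem_univ _, hz⟩, Finset.mem_image.2 ⟨⟨![⟨e, me⟩, ⟨f, mf⟩,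
      ⟨g, mg⟩], ?_⟩, Finset.mem_univ _, ?_⟩⟩
    · intro i j hij
      have hij' := congrArg Subtype.val hij
      fin_cases i <;> fin_cases j <;> first
        | rfl
        | exact absurd hij' hfα.1
        | exact absurd hij' hfα.1.symm
        | exact absurd hij' hgβ.1
        | exact absurd hij' hgβ.1.symm
        | exact absurd hij' hfg
        | exact absurd hij' hfg.symm
    · exact Prod.ext hα'.symm hβ'.symm
  refine (Finset.card_le_card hsub).trans (Finset.card_biUnion_le.trans ?_)
  refine Finset.sum_le_sum fun z _ => ?_
  refine Finset.card_image_le.trans_eq ?_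
  rw [Finset.card_univ, Fintype.card_embedding_eq, Fintype.card_fin, Fintype.card_coe, mult]

lemma sum_overlapping_doubles_le (d : DegreeSequence n) :
    ∑ α ∈ doublePatterns d, ∑ β ∈ doublePatterns d,
      (if α ≠ β ∧ ¬ Disjoint α β then edgeProb (α ∪ β) else 0) ≤
    expect fun σ : d.Pairing => (tripleCount σ : ℝ) := by
  rw [← Finset.sum_product']
  have h1 : ∀ p : Finset (Sym2 d.HalfEdge) × Finset (Sym2 d.HalfEdge),
      (if p.1 ≠ p.2 ∧ ¬ Disjoint p.1 p.2 then edgeProb (p.1 ∪ p.2) else 0) =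
      expect fun σ => if (p.1 ≠ p.2 ∧ ¬ Disjoint p.1 p.2) ∧ p.1 ∪ p.2 ⊆ edges σ then 1 else 0 := by
    intro p
    split_ifs with h
    · refine congrArg expect (funext fun σ => ?_)
      by_cases hs : p.1 ∪ p.2 ⊆ edges σ
      · rw [if_pos hs, if_pos ⟨h, hs⟩]
      · rw [if_neg hs, if_neg fun hc => hs hc.2]
    · simp only [h, false_and, if_false]
      rw [expect_const]
  rw [Finset.sum_congr rfl fun p _ => h1 p, ← expect_sum]
  refine expect_mono fun σ => ?_
  rw [Finset.sum_boole]
  exact_mod_cast card_overlapping_doubles_le σ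

/-- Each factor `d(d-1)(d-2)` is at most `d_max` times `d(d-1)`. After division by `ℓ³` the bound is
of order `d_max² ν² / ℓ`, which is where `d_max = o(√n)` enters. -/
lemma expect_tripleCount_le (h3 : 0 < oddProd d 3) :
    expect (fun σ : d.Pairing => (tripleCount σ : ℝ)) ≤
      (d.maxDeg : ℝ) ^ 2 * (∑ v, ((d.deg v).descFactorial 2 : ℝ)) ^ 2 / oddProd d 3 := by
  simp only [tripleCount]
  push_cast
  rw [expect_sum_mult_descFactorial, ← Finset.sum_div]
  refine div_le_div_of_nonneg_right ?_ h3.le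
  have hdeg : ∀ v, ((d.deg v).descFactorial 3 : ℝ) ≤ d.maxDeg * (d.deg v).descFactorial 2 := by
    intro v
    have h1 : d.deg v ≤ d.maxDeg := Finset.le_sup (f := d.deg) (Finset.mem_univ v)
    have h2 : (d.deg v).descFactorial 3 ≤ d.maxDeg * (d.deg v).descFactorial 2 := by
      rw [Nat.descFactorial_succ]
      exact Nat.mul_le_mul_right _ ((Nat.sub_le _ _).trans h1)
    exact_mod_cast h2
  calc _ ≤ ∑ p ∈ (Finset.univ : Finset (Fin n)).offDiag with p.1 < p.2,
        (d.maxDeg : ℝ) ^ 2 * (((d.deg p.1).descFactorial 2 : ℝ) * (d.deg p.2).descFactorial 2) := by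
        refine Finset.sum_le_sum fun p _ => ?_
        calc _ ≤ ((d.maxDeg : ℝ) * (d.deg p.1).descFactorial 2) *
            (d.maxDeg * (d.deg p.2).descFactorial 2) :=
              mul_le_mul (hdeg _) (hdeg _) (by positivity) (by positivity)
          _ = _ := by ring
    _ ≤ _ := by
        rw [← Finset.mul_sum]
        refine mul_le_mul_of_nonneg_left ?_ (by positivity)
        have h2 := two_mul_sum_lt fun v => ((d.deg v).descFactorial 2 : ℝ)
        have h4 : (0 : ℝ) ≤ ∑ v, ((d.deg v).descFactorial 2 : ℝ) ^ 2 :=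
          Finset.sum_nonneg fun v _ => sq_nonneg _
        have h5 := sq_nonneg (∑ v, ((d.deg v).descFactorial 2 : ℝ))
        linarith

end DegreeSequence
end ConfigModel

namespace ConfigModel
namespace DegreeSequence

variable {n : ℕ} {d : DegreeSequence n}

/-! ### Patterns for self-loops -/

/-- The self-loops, as patterns. -/
def loopPatterns (d : DegreeSequence n) : Finset (Finset (Sym2 d.HalfEdge)) :=
  (Finset.univ.filter fun e : Sym2 d.HalfEdge => ¬ e.IsDiag ∧ (ends e).IsDiag).image fun e => {e}

lemma mem_loopPatterns {α : Finset (Sym2 d.HalfEdge)} :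
    α ∈ loopPatterns d ↔ ∃ e : Sym2 d.HalfEdge, (¬ e.IsDiag ∧ (ends e).IsDiag) ∧ {e} = α := by
  simp [loopPatterns]

lemma isPartialMatching_of_mem_loopPatterns {α : Finset (Sym2 d.HalfEdge)}
    (h : α ∈ loopPatterns d) : IsPartialMatching α := by
  obtain ⟨e, he, rfl⟩ := mem_loopPatterns.1 h
  refine ⟨fun f hf => ?_, fun f hf g hg _ _ _ => ?_⟩
  · rw [Finset.mem_singleton.1 hf]
    exact he.1
  · rw [Finset.mem_singleton.1 hf, Finset.mem_singleton.1 hg]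

lemma card_of_mem_loopPatterns {α : Finset (Sym2 d.HalfEdge)}
    (h : α ∈ loopPatterns d) : α.card = 1 := by
  obtain ⟨e, he, rfl⟩ := mem_loopPatterns.1 h
  exact Finset.card_singleton e

lemma selfLoops_eq_patternCount (σ : d.Pairing) :
    selfLoops σ = patternCount (loopPatterns d) σ := by
  rw [selfLoops, patternCount, loopPatterns, Finset.filter_image,
    Finset.card_image_of_injective _ Finset.singleton_injective]
  congr 1
  ext e
  simp only [Finset.mem_filter, Finset.mem_univ, true_and, Finset.singleton_subset_iff]
  exact ⟨fun h => ⟨⟨(isPartialMatching_edges σ).1 e h.1, h.2⟩, h.1⟩, fun h => ⟨h.2, h.1.2⟩⟩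

/-- The ordered pairs of distinct half-edges at a common vertex of a given set. -/
def twinPairs (d : DegreeSequence n) (B : Finset (Fin n)) : Finset (d.HalfEdge × d.HalfEdge) :=
  {p | p.1 ≠ p.2 ∧ p.1.1 = p.2.1 ∧ p.1.1 ∈ B}

lemma card_filter_fst_eq (v : Fin n) :
    (Finset.univ.filter fun h : d.HalfEdge => h.1 = v).card = d.deg v := by
  rw [← card_halfEdge_at v, Fintype.card_subtype]

lemma card_twinPairs (d : DegreeSequence n) (B : Finset (Fin n)) :
    (twinPairs d B).card = ∑ v ∈ B, (d.deg v).descFactorial 2 := by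
  rw [Finset.card_eq_sum_card_fiberwise (t := B) (f := fun p => p.1.1)]
  · refine Finset.sum_congr rfl fun v hv => ?_
    have : (twinPairs d B).filter (fun p => p.1.1 = v) =
        (Finset.univ.filter fun h : d.HalfEdge => h.1 = v).offDiag := by
      ext p
      simp only [twinPairs, Finset.mem_filter, Finset.mem_univ, true_and, Finset.mem_offDiag]
      constructor
      · rintro ⟨⟨h1, h2, -⟩, rfl⟩
        exact ⟨rfl, h2.symm, h1⟩
      · rintro ⟨rfl, h2, h1⟩
        exact ⟨⟨h1, h2.symm, hv⟩, rfl⟩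
    rw [this, Finset.offDiag_card, card_filter_fst_eq, Nat.descFactorial_succ,
      Nat.descFactorial_one, Nat.sub_mul, one_mul]
  · intro p hp
    exact (Finset.mem_filter.1 hp).2.2.2

lemma two_mul_card_loopPatterns (d : DegreeSequence n) :
    2 * (loopPatterns d).card = ∑ v, (d.deg v).descFactorial 2 := by
  rw [loopPatterns, Finset.card_image_of_injective _ Finset.singleton_injective]
  have : (Finset.univ.filter fun e : Sym2 d.HalfEdge => ¬ e.IsDiag ∧ (ends e).IsDiag) =
      Finset.univ.biUnion fun v : Fin n =>
        (Finset.univ.filter fun h : d.HalfEdge => h.1 = v).offDiag.image Sym2.mk.uncurry := by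
    ext e
    induction e with | _ a b =>
    simp only [Finset.mem_filter, Finset.mem_univ, true_and, Sym2.mk_isDiag_iff, ends_mk,
      Finset.mem_biUnion, Finset.mem_image, Finset.mem_offDiag, Prod.exists,
      Function.uncurry_apply_pair]
    constructor
    · rintro ⟨h1, h2⟩
      exact ⟨b.1, a, b, ⟨h2, rfl, h1⟩, rfl⟩
    · rintro ⟨v, x, y, ⟨hx, hy, hne⟩, h⟩
      rw [Sym2.eq_iff] at h
      rcases h with ⟨rfl, rfl⟩ | ⟨rfl, rfl⟩
      · exact ⟨hne, hx.trans hy.symm⟩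
      · exact ⟨hne.symm, hy.trans hx.symm⟩
  rw [this, Finset.card_biUnion, Finset.mul_sum]
  · refine Finset.sum_congr rfl fun v _ => ?_
    rw [Sym2.two_mul_card_image_offDiag, Finset.offDiag_card, card_filter_fst_eq,
      Nat.descFactorial_succ, Nat.descFactorial_one, Nat.sub_mul, one_mul]
  · intro v _ w _ hvw
    rw [Function.onFun, Finset.disjoint_left]
    intro e he he'
    simp only [Finset.mem_image, Finset.mem_offDiag, Finset.mem_filter, Finset.mem_univ, true_and,
      Prod.exists, Function.uncurry_apply_pair] at he he'
    obtain ⟨x, y, ⟨rfl, hy, -⟩, rfl⟩ := he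
    obtain ⟨x', y', ⟨rfl, hy', -⟩, he⟩ := he'
    rw [Sym2.eq_iff] at he
    rcases he with ⟨rfl, rfl⟩ | ⟨rfl, rfl⟩
    · exact hvw rfl
    · exact hvw hy'

lemma sum_edgeProb_eq_card_div {A : Finset (Finset (Sym2 d.HalfEdge))} {r : ℕ}
    (hA : ∀ α ∈ A, IsPartialMatching α) (hr : ∀ α ∈ A, α.card = r) :
    ∑ α ∈ A, edgeProb α = A.card / oddProd d r := by
  rw [div_eq_mul_inv, ← nsmul_eq_mul, ← Finset.sum_const]
  refine Finset.sum_congr rfl fun α hα => ?_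
  rw [edgeProb_eq (hA α hα), hr α hα]

lemma sum_edgeProb_le_of_subset_image {A : Finset (Finset (Sym2 d.HalfEdge))} {r : ℕ}
    (hA : ∀ α ∈ A, IsPartialMatching α) (hr : ∀ α ∈ A, α.card = r) (h0 : 0 < oddProd d r)
    {κ : Type*} {T : Finset κ} {g : κ → Finset (Sym2 d.HalfEdge)} (hsub : A ⊆ T.image g) :
    ∑ α ∈ A, edgeProb α ≤ T.card / oddProd d r := by
  rw [sum_edgeProb_eq_card_div hA hr]
  refine div_le_div_of_nonneg_right ?_ h0.le
  exact_mod_cast (Finset.card_le_card hsub).trans Finset.card_image_le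

lemma sum_edgeProb_loopPatterns (d : DegreeSequence n) :
    ∑ α ∈ loopPatterns d, edgeProb α =
      (∑ v, ((d.deg v).descFactorial 2 : ℝ)) / (2 * oddProd d 1) := by
  rw [sum_edgeProb_eq_card_div (fun α => isPartialMatching_of_mem_loopPatterns)
    (fun α => card_of_mem_loopPatterns)]
  have := two_mul_card_loopPatterns d
  have h2 : (2 : ℝ) * (loopPatterns d).card = ∑ v, ((d.deg v).descFactorial 2 : ℝ) := by
    exact_mod_cast this
  rw [← h2, mul_div_mul_left _ _ two_ne_zero]

lemma deg_le_maxDeg (v : Fin n) : d.deg v ≤ d.maxDeg :=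
  Finset.le_sup (f := d.deg) (Finset.mem_univ v)

lemma sum_loopPatterns_cover_le (h0 : 0 < oddProd d 1) (h : d.HalfEdge) :
    ∑ β ∈ loopPatterns d with h ∈ cover β, edgeProb β ≤ d.maxDeg / oddProd d 1 := by
  refine (sum_edgeProb_le_of_subset_image (r := 1)
    (T := Finset.univ.filter fun g : d.HalfEdge => g.1 = h.1) (g := fun g => {s(h, g)})
    (fun α hα => isPartialMatching_of_mem_loopPatterns (Finset.mem_filter.1 hα).1)
    (fun α hα => card_of_mem_loopPatterns (Finset.mem_filter.1 hα).1) h0 ?_).trans ?_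
  · intro β hβ
    obtain ⟨hβ, hc⟩ := Finset.mem_filter.1 hβ
    obtain ⟨e, ⟨-, he⟩, rfl⟩ := mem_loopPatterns.1 hβ
    obtain ⟨f, hf, g, rfl⟩ := mem_cover.1 hc
    obtain rfl := Finset.mem_singleton.1 hf
    rw [ends_mk, Sym2.mk_isDiag_iff] at he
    exact Finset.mem_image.2 ⟨g, by simp [he], rfl⟩
  · rw [card_filter_fst_eq]
    refine div_le_div_of_nonneg_right ?_ h0.le
    exact_mod_cast deg_le_maxDeg _

/-- A double edge through `h` consists of `h h'` and `g g'` with `g` at the vertex of `h` and `(h',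
g')` two half-edges at a common vertex: at most `d_max` choices for `g`, and `Σ d(d-1)` for the
pair. -/
lemma sum_doublePatterns_cover_le (h0 : 0 < oddProd d 2) (h : d.HalfEdge) :
    ∑ β ∈ doublePatterns d with h ∈ cover β, edgeProb β ≤
      d.maxDeg * (∑ v, ((d.deg v).descFactorial 2 : ℝ)) / oddProd d 2 := by
  refine (sum_edgeProb_le_of_subset_image (r := 2)
    (T := (Finset.univ.filter fun g : d.HalfEdge => g.1 = h.1) ×ˢ twinPairs d Finset.univ)
    (g := fun p => {s(h, p.2.1), s(p.1, p.2.2)})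
    (fun α hα => (mem_doublePatterns.1 (Finset.mem_filter.1 hα).1).2.1)
    (fun α hα => (mem_doublePatterns.1 (Finset.mem_filter.1 hα).1).1) h0 ?_).trans ?_
  · intro β hβ
    obtain ⟨hβ, hc⟩ := Finset.mem_filter.1 hβ
    obtain ⟨h2, hm, z, hz, he⟩ := mem_doublePatterns.1 hβ
    obtain ⟨f, hf, h', rfl⟩ := mem_cover.1 hc
    obtain ⟨e, hee⟩ : ∃ e, β.erase s(h, h') = {e} := by
      rw [← Finset.card_eq_one, Finset.card_erase_of_mem hf, h2]
    have heβ : e ∈ β.erase s(h, h') := by rw [hee]; exact Finset.mem_singleton_self e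
    rw [Finset.mem_erase] at heβ
    have hβe : β = {s(h, h'), e} := by rw [← Finset.insert_erase hf, hee]
    have key : ∀ g g' : d.HalfEdge, e = s(g, g') → g.1 = h.1 → g'.1 = h'.1 →
        β ∈ ((Finset.univ.filter fun g : d.HalfEdge => g.1 = h.1) ×ˢ
          twinPairs d Finset.univ).image fun p => {s(h, p.2.1), s(p.1, p.2.2)} := by
      rintro g g' rfl h1 h3
      refine Finset.mem_image.2 ⟨(g, (h', g')), ?_, hβe.symm⟩
      simp only [Finset.mem_product, Finset.mem_filter, Finset.mem_univ, true_and, twinPairs,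
        and_true]
      refine ⟨h1, ?_, h3.symm⟩
      rintro rfl
      exact heβ.1 (hm.2 _ heβ.2 _ hf h' (Sym2.mem_mk_right _ _) (Sym2.mem_mk_right _ _))
    have hends := (he e heβ.2).trans (he _ hf).symm
    revert key hends
    induction e with | _ a b =>
    intro key hends
    rw [ends_mk, ends_mk, Sym2.eq_iff] at hends
    rcases hends with ⟨h1, h3⟩ | ⟨h1, h3⟩
    · exact key a b rfl h1 h3
    · exact key b a Sym2.eq_swap h3 h1
  · refine div_le_div_of_nonneg_right ?_ h0.le
    rw [Finset.card_product, card_filter_fst_eq, card_twinPairs]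
    push_cast
    refine mul_le_mul_of_nonneg_right ?_ (Finset.sum_nonneg fun v _ => Nat.cast_nonneg _)
    exact_mod_cast deg_le_maxDeg _

/-! ### Patterns that witness multiple edges -/

/-- One of the first two half-edges at a vertex. -/
def firstHalf (A : Finset (Fin n)) (v : {v : Fin n // v ∈ A ∧ 2 ≤ d.deg v}) (i : Fin 2) :
    d.HalfEdge :=
  ⟨v.1, ⟨i.1, i.2.trans_le v.2.2⟩⟩

lemma firstHalf_inj {A : Finset (Fin n)} {v w : {v : Fin n // v ∈ A ∧ 2 ≤ d.deg v}} {i j : Fin 2}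
    (h : firstHalf A v i = firstHalf A w j) : v = w ∧ i = j := by
  obtain ⟨v, hv⟩ := v
  obtain ⟨w, hw⟩ := w
  obtain rfl : v = w := congrArg Sigma.fst h
  refine ⟨rfl, ?_⟩
  simp only [firstHalf, Sigma.mk.injEq, heq_eq_eq, true_and, Fin.mk.injEq] at h
  exact Fin.ext h

/-- Parameters of hub patterns: a vertex of degree at least two in `A`, and two distinct half-edges
at a vertex outside `A`. -/
abbrev HubParam (d : DegreeSequence n) (A : Finset (Fin n)) : Type :=
  {v : Fin n // v ∈ A ∧ 2 ≤ d.deg v} × {p // p ∈ twinPairs d Aᶜ}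

/-- The target of one of the first two half-edges in a hub pattern. -/
def hubTarget {A : Finset (Fin n)} (p : HubParam d A) (i : Fin 2) : d.HalfEdge :=
  if i = 0 then p.2.1.1 else p.2.1.2

/-- The pattern in which the first two half-edges of a vertex are joined to the same vertex. -/
def hubPattern {A : Finset (Fin n)} (p : HubParam d A) : Finset (Sym2 d.HalfEdge) :=
  Finset.univ.image fun i : Fin 2 => s(firstHalf A p.1 i, hubTarget p i)

/-- All hub patterns for a given set of vertices. -/
def hubPatterns (d : DegreeSequence n) (A : Finset (Fin n)) :
    Finset (Finset (Sym2 d.HalfEdge)) :=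
  Finset.univ.image fun p : HubParam d A => hubPattern p

lemma mem_hubPattern {A : Finset (Fin n)} {p : HubParam d A} {e : Sym2 d.HalfEdge} :
    e ∈ hubPattern p ↔ ∃ i, s(firstHalf A p.1 i, hubTarget p i) = e := by
  simp [hubPattern]

lemma hubTarget_fst {A : Finset (Fin n)} (p : HubParam d A) (i : Fin 2) :
    (hubTarget p i).1 = p.2.1.1.1 := by
  unfold hubTarget
  split_ifs
  · rfl
  · exact ((Finset.mem_filter.1 p.2.2).2.2.1).symm

lemma hubTarget_notMem {A : Finset (Fin n)} (p : HubParam d A) (i : Fin 2) :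
    (hubTarget p i).1 ∉ A := by
  rw [hubTarget_fst]
  exact Finset.mem_compl.1 (Finset.mem_filter.1 p.2.2).2.2.2

lemma hubTarget_injective {A : Finset (Fin n)} (p : HubParam d A) :
    Function.Injective (hubTarget p) := by
  have hne : p.2.1.1 ≠ p.2.1.2 := (Finset.mem_filter.1 p.2.2).2.1
  intro i j hij
  fin_cases i <;> fin_cases j <;> first
    | rfl
    | exact absurd hij hne
    | exact absurd hij hne.symm

lemma firstHalf_ne_hubTarget {A : Finset (Fin n)} (v : {v : Fin n // v ∈ A ∧ 2 ≤ d.deg v})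
    (p : HubParam d A) (i j : Fin 2) : firstHalf A v i ≠ hubTarget p j := by
  intro h
  refine hubTarget_notMem p j ?_
  rw [← h]
  exact v.2.1

lemma isPartialMatching_hubPattern {A : Finset (Fin n)} (p : HubParam d A) :
    IsPartialMatching (hubPattern p) := by
  refine ⟨fun e he => ?_, fun e he f hf h h1 h2 => ?_⟩
  · obtain ⟨i, rfl⟩ := mem_hubPattern.1 he
    rw [Sym2.mk_isDiag_iff]
    exact firstHalf_ne_hubTarget _ _ _ _
  · obtain ⟨i, rfl⟩ := mem_hubPattern.1 he
    obtain ⟨j, rfl⟩ := mem_hubPattern.1 hf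
    rw [Sym2.mem_iff] at h1 h2
    have : i = j := by
      rcases h1 with h1 | h1 <;> rcases h2 with h2 | h2
      · exact (firstHalf_inj (h1.symm.trans h2)).2
      · exact absurd (h1.symm.trans h2) (firstHalf_ne_hubTarget _ _ _ _)
      · exact absurd (h2.symm.trans h1) (firstHalf_ne_hubTarget _ _ _ _)
      · exact hubTarget_injective p (h1.symm.trans h2)
    rw [this]

lemma card_hubPattern {A : Finset (Fin n)} (p : HubParam d A) : (hubPattern p).card = 2 := by
  rw [hubPattern, Finset.card_image_of_injective, Finset.card_univ, Fintype.card_fin]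
  intro i j hij
  simp only [Sym2.eq_iff] at hij
  rcases hij with hij | hij
  · exact (firstHalf_inj hij.1).2
  · exact absurd hij.1 (firstHalf_ne_hubTarget _ _ _ _)

/-- At a given vertex of `A` all hub patterns use the same two half-edges, and a matching determines
their partners. This is why hub patterns use only the first two half-edges. -/
lemma eq_of_firstHalf_eq {A : Finset (Fin n)} {p q : HubParam d A}
    (hm : IsPartialMatching (hubPattern p ∪ hubPattern q)) (h : p.1 = q.1) : p = q := by
  have key : ∀ i, hubTarget p i = hubTarget q i := by
    intro i
    have h1 := hm.2 _ (Finset.mem_union_left _ (mem_hubPattern.2 ⟨i, rfl⟩)) _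
      (Finset.mem_union_right _ (mem_hubPattern.2 ⟨i, rfl⟩)) (firstHalf A p.1 i)
      (Sym2.mem_mk_left _ _) (h ▸ Sym2.mem_mk_left _ _)
    rw [Sym2.eq_iff] at h1
    rcases h1 with h1 | h1
    · exact h1.2
    · exact absurd h1.1 (firstHalf_ne_hubTarget _ _ _ _)
  exact Prod.ext h (Subtype.ext (Prod.ext (key 0) (key 1)))

/-- In a matching a common half-edge means a common edge. Each edge has exactly one end in `A`, so
the two patterns have the same vertex in `A`. -/
lemma eq_of_not_disjoint_cover {A : Finset (Fin n)} {p q : HubParam d A}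
    (hm : IsPartialMatching (hubPattern p ∪ hubPattern q))
    (h : ¬ Disjoint (cover (hubPattern p)) (cover (hubPattern q))) : p = q := by
  obtain ⟨x, hx, hx'⟩ := Finset.not_disjoint_iff.1 h
  obtain ⟨e, he, hxe⟩ := mem_cover.1 hx
  obtain ⟨f, hf, hxf⟩ := mem_cover.1 hx'
  have hef := hm.2 e (Finset.mem_union_left _ he) f (Finset.mem_union_right _ hf) x hxe hxf
  obtain ⟨i, rfl⟩ := mem_hubPattern.1 he
  obtain ⟨j, rfl⟩ := mem_hubPattern.1 hf
  rw [Sym2.eq_iff] at hef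
  rcases hef with h1 | h1
  · exact eq_of_firstHalf_eq hm (firstHalf_inj h1.1).1
  · exact absurd h1.1 (firstHalf_ne_hubTarget _ _ _ _)

lemma hubPattern_injective {A : Finset (Fin n)} :
    Function.Injective (hubPattern : HubParam d A → Finset (Sym2 d.HalfEdge)) := by
  intro p q hpq
  refine eq_of_not_disjoint_cover ?_ ?_
  · rw [hpq, Finset.union_self]
    exact isPartialMatching_hubPattern q
  · rw [hpq, disjoint_self, Finset.bot_eq_empty, ← Finset.card_eq_zero,
      card_cover (isPartialMatching_hubPattern q), card_hubPattern]
    norm_num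

lemma card_hubPatterns (d : DegreeSequence n) (A : Finset (Fin n)) :
    (hubPatterns d A).card = (A.filter fun v => 2 ≤ d.deg v).card *
      ∑ v ∈ Aᶜ, (d.deg v).descFactorial 2 := by
  rw [hubPatterns, Finset.card_image_of_injective _ hubPattern_injective, Finset.card_univ,
    Fintype.card_prod, Fintype.card_coe, card_twinPairs, Fintype.card_subtype]
  congr 2
  ext v
  simp

/-- Hub patterns that occur have distinct pairs of end vertices: the end in `A` singles out the
pattern. Each such pair of vertices contributes at least one to `multiEdges`. -/
lemma patternCount_hubPatterns_le (A : Finset (Fin n)) (σ : d.Pairing) :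
    patternCount (hubPatterns d A) σ ≤ multiEdges σ := by
  classical
  rw [patternCount, hubPatterns, Finset.filter_image,
    Finset.card_image_of_injective _ hubPattern_injective]
  have h1 : (Finset.univ.filter fun p : HubParam d A => hubPattern p ⊆ edges σ).card ≤
      (Finset.univ.filter fun z : Sym2 (Fin n) => ¬ z.IsDiag ∧ 2 ≤ mult σ z).card := by
    refine Finset.card_le_card_of_injOn (fun p => s(p.1.1, p.2.1.1.1)) ?_ ?_
    · intro p hp
      simp only [Finset.coe_filter, Finset.mem_univ, true_and, Set.mem_ofPred_eq] at hp ⊢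
      refine ⟨?_, ?_⟩
      · rw [Sym2.mk_isDiag_iff]
        intro h
        have := hubTarget_notMem p 0
        rw [hubTarget_fst, ← h] at this
        exact this p.1.2.1
      · rw [mult]
        refine (card_hubPattern p).ge.trans (Finset.card_le_card fun e he =>
          Finset.mem_filter.2 ⟨hp he, ?_⟩)
        obtain ⟨i, rfl⟩ := mem_hubPattern.1 he
        rw [ends_mk, hubTarget_fst]
        rfl
    · intro p hp q hq hpq
      simp only [Finset.coe_filter, Finset.mem_univ, true_and, Set.mem_ofPred_eq] at hp hq
      simp only [Sym2.eq_iff] at hpq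
      refine eq_of_firstHalf_eq
        ((isPartialMatching_edges σ).mono (Finset.union_subset hp hq)) ?_
      rcases hpq with h | h
      · exact Subtype.ext h.1
      · have := hubTarget_notMem q 0
        rw [hubTarget_fst, ← h.1] at this
        exact absurd p.1.2.1 this
  refine h1.trans ?_
  rw [multiEdges, ← Finset.filter_filter, Finset.card_filter]
  refine Finset.sum_le_sum fun z _ => ?_
  split_ifs <;> omega

end DegreeSequence
end ConfigModel

namespace ConfigModel
namespace DegreeSequence

/-! ### Asymptotic number of lines and cycles -/

section Counting

variable {n : ℕ} {d : DegreeSequence n}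

/-- The half-edges at vertices of degree `q`. -/
def degHalfEdges (d : DegreeSequence n) (q : ℕ) : Finset d.HalfEdge := {h | d.deg h.1 = q}

lemma card_degHalfEdges (d : DegreeSequence n) (q : ℕ) :
    (degHalfEdges d q).card = q * d.numDeg q := by
  have h1 : degHalfEdges d q = (Finset.univ.filter fun v : Fin n => d.deg v = q).sigma
      fun _ => Finset.univ := by
    ext h
    simp [degHalfEdges]
  rw [h1, Finset.card_sigma, Finset.sum_congr rfl (g := fun _ => q), Finset.sum_const, smul_eq_mul,
    mul_comm, numDeg]
  intro v hv
  rw [Finset.card_univ, Fintype.card_fin, (Finset.mem_filter.1 hv).2]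

/-- Sequences of half-edges at vertices, possibly repeated, of the prescribed degrees. -/
def seqSpace (d : DegreeSequence n) (b : Bool) (k : ℕ) : Finset (Fin k → d.HalfEdge) :=
  Fintype.piFinset fun l => degHalfEdges d (seqDeg b k l)

lemma mem_seqSpace {b : Bool} {k : ℕ} {f : Fin k → d.HalfEdge} :
    f ∈ seqSpace d b k ↔ ∀ i, d.deg (f i).1 = seqDeg b k i := by
  simp [seqSpace, degHalfEdges]

lemma card_seqSpace (d : DegreeSequence n) (b : Bool) (k : ℕ) :
    (seqSpace d b k).card = ∏ l : Fin k, (degHalfEdges d (seqDeg b k l)).card :=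
  Fintype.card_piFinset _

lemma compSeqs_subset_seqSpace (d : DegreeSequence n) (b : Bool) (k : ℕ) :
    compSeqs d b k ⊆ seqSpace d b k := fun _ hf => mem_seqSpace.2 (mem_compSeqs.1 hf).2

/-- The number of ways to choose all half-edges of a sequence but the `i`-th. -/
def punctured (d : DegreeSequence n) (b : Bool) (k : ℕ) (i : Fin k) : ℕ :=
  ∏ l : {l : Fin k // l ≠ i}, (degHalfEdges d (seqDeg b k l)).card

/-- If all but one of the half-edges determine the vertex of the remaining one, then they leave at
most two choices. -/
lemma card_le_two_mul_punctured {b : Bool} {k : ℕ} {i : Fin k} {S : Finset (Fin k → d.HalfEdge)}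
    (hS : S ⊆ seqSpace d b k)
    (hdet : ∀ f ∈ S, ∀ g ∈ S, (∀ l, l ≠ i → f l = g l) → (f i).1 = (g i).1) :
    S.card ≤ 2 * punctured d b k i := by
  classical
  set res : (Fin k → d.HalfEdge) → ({l : Fin k // l ≠ i} → d.HalfEdge) := fun f l => f l with hres
  have himg : (S.image res).card ≤ punctured d b k i := by
    rw [punctured, ← Fintype.card_piFinset]
    refine Finset.card_le_card fun w hw => ?_
    obtain ⟨f, hf, rfl⟩ := Finset.mem_image.1 hw
    rw [Fintype.mem_piFinset]
    intro l
    simpa [degHalfEdges, hres] using mem_seqSpace.1 (hS hf) l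
  refine (Finset.card_le_mul_card_image (f := res) S 2 fun w hw => ?_).trans
    (Nat.mul_le_mul_left _ himg)
  obtain ⟨g, hg, rfl⟩ := Finset.mem_image.1 hw
  have hfib : ((S.filter fun f => res f = res g)).card ≤
      (Finset.univ.filter fun h : d.HalfEdge => h.1 = (g i).1).card := by
    refine Finset.card_le_card_of_injOn (fun f => f i) ?_ ?_
    · intro f hf
      simp only [Finset.coe_filter, Set.mem_ofPred_eq, Finset.mem_univ, true_and] at hf ⊢
      exact hdet f hf.1 g hg fun l hl => congrFun hf.2 ⟨l, hl⟩
    · intro f hf f' hf' hff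
      simp only [Finset.coe_filter, Set.mem_ofPred_eq] at hf hf'
      ext1 l
      by_cases hl : l = i
      · rw [hl]
        exact hff
      · exact (congrFun hf.2 ⟨l, hl⟩).trans (congrFun hf'.2 ⟨l, hl⟩).symm
  refine hfib.trans ?_
  rw [card_filter_fst_eq, mem_seqSpace.1 (hS hg) i]
  exact seqDeg_le _ _ _

/-- A sequence with repeated vertices has a coincidence between some positions `i ≠ j`, and then the
half-edge at `j` determines the vertex at `i`. These sequences will be negligible. -/
lemma card_seqSpace_le (d : DegreeSequence n) (b : Bool) (k : ℕ) :
    (seqSpace d b k).card ≤ (compSeqs d b k).card + ∑ i, k * (2 * punctured d b k i) := by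
  classical
  have hsub : seqSpace d b k ⊆ compSeqs d b k ∪ Finset.univ.biUnion fun i : Fin k =>
      Finset.univ.biUnion fun j : Fin k =>
        (seqSpace d b k).filter fun f => i ≠ j ∧ (f i).1 = (f j).1 := by
    intro f hf
    by_cases hinj : Function.Injective fun i => (f i).1
    · exact Finset.mem_union_left _ (mem_compSeqs.2 ⟨hinj, mem_seqSpace.1 hf⟩)
    · simp only [Function.Injective, not_forall] at hinj
      obtain ⟨i, j, hij, hne⟩ := hinj
      refine Finset.mem_union_right _ (Finset.mem_biUnion.2 ⟨i, Finset.mem_univ _,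
        Finset.mem_biUnion.2 ⟨j, Finset.mem_univ _, Finset.mem_filter.2 ⟨hf, hne, hij⟩⟩⟩)
  refine (Finset.card_le_card hsub).trans ((Finset.card_union_le _ _).trans ?_)
  refine Nat.add_le_add_left (Finset.card_biUnion_le.trans (Finset.sum_le_sum fun i _ => ?_)) _
  refine (Finset.card_biUnion_le_card_mul _ _ (2 * punctured d b k i) fun j _ => ?_).trans
    (by simp)
  refine card_le_two_mul_punctured (Finset.filter_subset _ _) fun f hf g hg hfg => ?_
  rw [Finset.mem_filter] at hf hg
  rw [hf.2.2, hg.2.2, hfg j hf.2.1.symm]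

/-- If `h` is covered, the vertex of `h` is the `i`-th vertex of the sequence for some `i`, leaving
two half-edges for that position. -/
lemma sum_compPatterns_cover_le {b : Bool} {k : ℕ} (h0 : 0 < oddProd d (seqEdges b k))
    (h : d.HalfEdge) :
    ∑ β ∈ compPatterns d b k with h ∈ cover β, edgeProb β ≤
      (∑ i : Fin k, 2 * (punctured d b k i : ℝ)) / oddProd d (seqEdges b k) := by
  classical
  refine (sum_edgeProb_le_of_subset_image (g := compPattern b)
    (T := Finset.univ.biUnion fun i : Fin k =>
      (compSeqs d b k).filter fun f => (f i).1 = h.1) ?_ ?_ h0 ?_).trans ?_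
  · intro α hα
    obtain ⟨f, hf, rfl⟩ := mem_compPatterns.1 (Finset.mem_filter.1 hα).1
    exact isPartialMatching_compPattern hf
  · intro α hα
    obtain ⟨f, hf, rfl⟩ := mem_compPatterns.1 (Finset.mem_filter.1 hα).1
    exact card_compPattern hf
  · intro α hα
    obtain ⟨hα, hh⟩ := Finset.mem_filter.1 hα
    obtain ⟨f, hf, rfl⟩ := mem_compPatterns.1 hα
    refine Finset.mem_image_of_mem _ ?_
    obtain ⟨e, he, hhe⟩ := mem_cover.1 hh
    obtain ⟨i, hi, rfl⟩ := mem_compPattern.1 he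
    rw [Sym2.mem_iff] at hhe
    rcases hhe with rfl | rfl
    · exact Finset.mem_biUnion.2 ⟨i, Finset.mem_univ _, Finset.mem_filter.2 ⟨hf, rfl⟩⟩
    · exact Finset.mem_biUnion.2 ⟨rot i, Finset.mem_univ _, Finset.mem_filter.2 ⟨hf, rfl⟩⟩
  · refine div_le_div_of_nonneg_right ?_ h0.le
    have : (Finset.univ.biUnion fun i : Fin k =>
        (compSeqs d b k).filter fun f => (f i).1 = h.1).card ≤
          ∑ i : Fin k, 2 * punctured d b k i := by
      refine Finset.card_biUnion_le.trans (Finset.sum_le_sum fun i _ => ?_)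
      refine card_le_two_mul_punctured
        ((Finset.filter_subset _ _).trans (compSeqs_subset_seqSpace _ _ _)) fun f hf g hg _ => ?_
      rw [(Finset.mem_filter.1 hf).2, (Finset.mem_filter.1 hg).2]
    exact_mod_cast this

end Counting

section Limits

variable {d : (n : ℕ+) → DegreeSequence n}

lemma eventually_oddProd_pos
    (hl : Tendsto (fun n => (Fintype.card (d n).HalfEdge : ℝ)) atTop atTop) (r : ℕ) :
    ∀ᶠ n in atTop, 0 < oddProd (d n) r := by
  filter_upwards [(tendsto_oddProd_div hl r).eventually_const_lt one_pos, hl.eventually_gt_atTop 0]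
    with n h1 h2
  exact (div_pos_iff_of_pos_right (pow_pos h2 _)).1 h1

/-- Dividing by `(ℓ - 1)(ℓ - 3) ⋯ (ℓ - 2r + 1)` is asymptotically the same as dividing by `ℓ ^ r`. -/
lemma tendsto_div_oddProd
    (hl : Tendsto (fun n => (Fintype.card (d n).HalfEdge : ℝ)) atTop atTop) (r : ℕ)
    {a : ℕ+ → ℝ} {c : ℝ}
    (ha : Tendsto (fun n => a n / (Fintype.card (d n).HalfEdge : ℝ) ^ r) atTop (𝓝 c)) :
    Tendsto (fun n => a n / oddProd (d n) r) atTop (𝓝 c) := by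
  have h1 := ha.div (tendsto_oddProd_div hl r) one_ne_zero
  rw [div_one] at h1
  refine h1.congr' ?_
  filter_upwards [hl.eventually_gt_atTop 0] with n hn
  exact div_div_div_cancel_right₀ (pow_ne_zero _ hn.ne') _ _

variable {θ τ : ℝ}

/-- The limiting proportion of half-edges at vertices of degree `seqDeg b k l`. -/
lemma tendsto_degHalfEdges_div
    (h1 : Tendsto (fun n => ((d n).numDeg 1 : ℝ) / Fintype.card (d n).HalfEdge) atTop (𝓝 0))
    (h2 : Tendsto (fun n => 2 * ((d n).numDeg 2 : ℝ) / Fintype.card (d n).HalfEdge) atTop (𝓝 θ))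
    (b : Bool) (k l : ℕ) :
    Tendsto (fun n => ((degHalfEdges (d n) (seqDeg b k l)).card : ℝ) / Fintype.card (d n).HalfEdge)
      atTop (𝓝 (if seqDeg b k l = 1 then 0 else θ)) := by
  unfold seqDeg
  split_ifs with h h' h'
  · simpa [card_degHalfEdges] using h1
  · exact absurd rfl h'
  · norm_num at h'
  · simpa [card_degHalfEdges] using h2

/-- A cycle loses one factor out of `k` against `ℓ^k`, hence a factor `1/ℓ`. A line keeps `k - 1`
factors against `ℓ^(k-1)`, but at least one end remains, and it contributes `n_1/ℓ → 0`. -/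
lemma tendsto_punctured_div {b : Bool} {k : ℕ} (hk : 2 ≤ k)
    (hl : Tendsto (fun n => (Fintype.card (d n).HalfEdge : ℝ)) atTop atTop)
    (h1 : Tendsto (fun n => ((d n).numDeg 1 : ℝ) / Fintype.card (d n).HalfEdge) atTop (𝓝 0))
    (h2 : Tendsto (fun n => 2 * ((d n).numDeg 2 : ℝ) / Fintype.card (d n).HalfEdge) atTop (𝓝 θ))
    (i : Fin k) :
    Tendsto (fun n => (punctured (d n) b k i : ℝ) /
      (Fintype.card (d n).HalfEdge : ℝ) ^ seqEdges b k) atTop (𝓝 0) := by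
  have hprod := tendsto_finsetProd (Finset.univ : Finset {l : Fin k // l ≠ i})
    fun l _ => tendsto_degHalfEdges_div h1 h2 b k l
  have hcard : (Finset.univ : Finset {l : Fin k // l ≠ i}).card = k - 1 := by
    rw [Finset.card_univ, Fintype.card_subtype_compl]
    simp
  have heq : ∀ n, ∏ l : {l : Fin k // l ≠ i}, ((degHalfEdges (d n) (seqDeg b k l)).card : ℝ) /
      Fintype.card (d n).HalfEdge = (punctured (d n) b k i : ℝ) /
        (Fintype.card (d n).HalfEdge : ℝ) ^ (k - 1) := by
    intro n
    rw [Finset.prod_div_distrib, Finset.prod_const, hcard, punctured, Nat.cast_prod]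
  simp only [heq] at hprod
  cases b
  · have hlim : ∏ l : {l : Fin k // l ≠ i}, (if seqDeg false k l = 1 then 0 else θ) = 0 := by
      obtain ⟨j, hji, hj⟩ : ∃ j : Fin k, j ≠ i ∧ (j.1 = 0 ∨ j.1 + 1 = k) := by
        by_cases hi : i.1 = 0
        · exact ⟨⟨k - 1, by omega⟩, by simp only [ne_eq, Fin.ext_iff]; omega,
            Or.inr (by simp only; omega)⟩
        · exact ⟨⟨0, by omega⟩, by simp only [ne_eq, Fin.ext_iff]; omega, Or.inl rfl⟩
      refine Finset.prod_eq_zero (Finset.mem_univ ⟨j, hji⟩) ?_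
      simp [seqDeg, hj]
    rw [hlim] at hprod
    exact hprod
  · have := hprod.mul (tendsto_inv_atTop_zero.comp hl)
    rw [mul_zero] at this
    refine this.congr fun n => ?_
    simp only [Function.comp_apply, seqEdges, if_true]
    rw [← div_eq_mul_inv, div_div, ← pow_succ, show k - 1 + 1 = k by omega]

lemma tendsto_card_compSeqs_div {b : Bool} {k : ℕ} (hk : 2 ≤ k) {c : ℝ}
    (hl : Tendsto (fun n => (Fintype.card (d n).HalfEdge : ℝ)) atTop atTop)
    (h1 : Tendsto (fun n => ((d n).numDeg 1 : ℝ) / Fintype.card (d n).HalfEdge) atTop (𝓝 0))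
    (h2 : Tendsto (fun n => 2 * ((d n).numDeg 2 : ℝ) / Fintype.card (d n).HalfEdge) atTop (𝓝 θ))
    (hc : Tendsto (fun n => ((seqSpace (d n) b k).card : ℝ) /
      (Fintype.card (d n).HalfEdge : ℝ) ^ seqEdges b k) atTop (𝓝 c)) :
    Tendsto (fun n => ((compSeqs (d n) b k).card : ℝ) /
      (Fintype.card (d n).HalfEdge : ℝ) ^ seqEdges b k) atTop (𝓝 c) := by
  have hz := tendsto_finsetSum (Finset.univ : Finset (Fin k)) fun i _ =>
    (tendsto_punctured_div (b := b) hk hl h1 h2 i).const_mul ((k : ℝ) * 2)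
  simp only [mul_zero, Finset.sum_const_zero] at hz
  have hlow := hc.sub hz
  rw [sub_zero] at hlow
  refine tendsto_of_tendsto_of_tendsto_of_le_of_le hlow hc (fun n => ?_) fun n => ?_
  · have h3 : ((seqSpace (d n) b k).card : ℝ) ≤
        (compSeqs (d n) b k).card + ∑ i, (k : ℝ) * (2 * punctured (d n) b k i) := by
      exact_mod_cast card_seqSpace_le (d n) b k
    simp only
    have h4 : ∑ i, (k : ℝ) * 2 * ((punctured (d n) b k i : ℝ) /
        (Fintype.card (d n).HalfEdge : ℝ) ^ seqEdges b k) =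
        (∑ i, (k : ℝ) * (2 * punctured (d n) b k i)) /
          (Fintype.card (d n).HalfEdge : ℝ) ^ seqEdges b k := by
      rw [Finset.sum_div]
      refine Finset.sum_congr rfl fun i _ => ?_
      ring
    rw [h4, ← sub_div]
    exact div_le_div_of_nonneg_right (by linarith) (by positivity)
  · exact div_le_div_of_nonneg_right
      (Nat.cast_le.2 (Finset.card_le_card (compSeqs_subset_seqSpace _ _ _))) (by positivity)

lemma prod_seqDeg_false {M : Type*} [CommMonoid M] {k : ℕ} (hk : 2 ≤ k) (a : ℕ → M) :
    ∏ l : Fin k, a (seqDeg false k l) = a 1 ^ 2 * a 2 ^ (k - 2) := by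
  obtain ⟨m, rfl⟩ : ∃ m, k = m + 2 := ⟨k - 2, by omega⟩
  rw [Fin.prod_univ_succ, Fin.prod_univ_castSucc]
  have hmid : ∀ l : Fin m, a (seqDeg false (m + 2) ((Fin.succ (Fin.castSucc l) : Fin (m + 2)) : ℕ)) =
      a 2 := fun l => by
    have := l.2
    rw [seqDeg, if_neg]
    simp
    omega
  simp only [hmid]
  simp only [Fin.val_zero, Fin.val_succ, Fin.val_last, seqDeg, true_and, true_or, or_true, if_true,
    Finset.prod_const, Finset.card_univ, Fintype.card_fin, Nat.add_sub_cancel]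
  rw [sq, mul_comm (a 2 ^ m), mul_assoc]

theorem tendsto_sum_edgeProb_cycles {k : ℕ} (hk : 2 ≤ k)
    (hl : Tendsto (fun n => (Fintype.card (d n).HalfEdge : ℝ)) atTop atTop)
    (h1 : Tendsto (fun n => ((d n).numDeg 1 : ℝ) / Fintype.card (d n).HalfEdge) atTop (𝓝 0))
    (h2 : Tendsto (fun n => 2 * ((d n).numDeg 2 : ℝ) / Fintype.card (d n).HalfEdge) atTop (𝓝 θ)) :
    Tendsto (fun n => ∑ α ∈ compPatterns (d n) true k, edgeProb α) atTop
      (𝓝 (θ ^ k / (2 * k))) := by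
  have hs : Tendsto (fun n => ((seqSpace (d n) true k).card : ℝ) /
      (Fintype.card (d n).HalfEdge : ℝ) ^ seqEdges true k) atTop (𝓝 (θ ^ k)) := by
    refine (h2.pow k).congr fun n => ?_
    simp [card_seqSpace, seqDeg, card_degHalfEdges, seqEdges, div_pow]
  have h3 := (tendsto_div_oddProd hl _ (tendsto_card_compSeqs_div hk hl h1 h2 hs)).div_const
    (2 * (k : ℝ))
  refine h3.congr fun n => ?_
  rw [sum_edgeProb_compPatterns true hk, div_div, mul_comm (oddProd _ _)]
  simp [seqMult]

/-- A line has one edge fewer than vertices, so the two ends together contribute `n_1²/ℓ`, of order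
one in the critical window. -/
theorem tendsto_sum_edgeProb_lines {k : ℕ} (hk : 2 ≤ k)
    (hl : Tendsto (fun n => (Fintype.card (d n).HalfEdge : ℝ)) atTop atTop)
    (h1 : Tendsto (fun n => ((d n).numDeg 1 : ℝ) / Fintype.card (d n).HalfEdge) atTop (𝓝 0))
    (hτ : Tendsto (fun n => ((d n).numDeg 1 : ℝ) ^ 2 / Fintype.card (d n).HalfEdge) atTop (𝓝 τ))
    (h2 : Tendsto (fun n => 2 * ((d n).numDeg 2 : ℝ) / Fintype.card (d n).HalfEdge) atTop (𝓝 θ)) :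
    Tendsto (fun n => ∑ α ∈ compPatterns (d n) false k, edgeProb α) atTop
      (𝓝 (τ * θ ^ (k - 2) / 2)) := by
  have hs : Tendsto (fun n => ((seqSpace (d n) false k).card : ℝ) /
      (Fintype.card (d n).HalfEdge : ℝ) ^ seqEdges false k) atTop (𝓝 (τ * θ ^ (k - 2))) := by
    refine (hτ.mul (h2.pow (k - 2))).congr fun n => ?_
    rw [card_seqSpace, prod_seqDeg_false hk (fun q => (degHalfEdges (d n) q).card), div_pow,
      div_mul_div_comm, ← pow_succ']
    simp only [card_degHalfEdges, seqEdges, Bool.false_eq_true, if_false, one_mul]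
    rw [show k - 2 + 1 = k - 1 by omega]
    push_cast
    rfl
  have h3 := (tendsto_div_oddProd hl _ (tendsto_card_compSeqs_div hk hl h1 h2 hs)).div_const 2
  refine h3.congr fun n => ?_
  rw [sum_edgeProb_compPatterns false hk, div_div, mul_comm (oddProd _ _)]
  simp [seqMult]

lemma exists_tendsto_compPatterns_cover {b : Bool} {k : ℕ} (hk : 2 ≤ k)
    (hl : Tendsto (fun n => (Fintype.card (d n).HalfEdge : ℝ)) atTop atTop)
    (h1 : Tendsto (fun n => ((d n).numDeg 1 : ℝ) / Fintype.card (d n).HalfEdge) atTop (𝓝 0))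
    (h2 : Tendsto (fun n => 2 * ((d n).numDeg 2 : ℝ) / Fintype.card (d n).HalfEdge) atTop (𝓝 θ)) :
    ∃ δ : ℕ+ → ℝ, Tendsto δ atTop (𝓝 0) ∧ ∀ᶠ n in atTop, ∀ h,
      ∑ β ∈ compPatterns (d n) b k with h ∈ cover β, edgeProb β ≤ δ n := by
  refine ⟨fun n => (∑ i : Fin k, 2 * (punctured (d n) b k i : ℝ)) / oddProd (d n) (seqEdges b k),
    tendsto_div_oddProd hl _ ?_, ?_⟩
  · have hz := tendsto_finsetSum (Finset.univ : Finset (Fin k)) fun i _ =>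
      (tendsto_punctured_div (b := b) hk hl h1 h2 i).const_mul 2
    simp only [mul_zero, Finset.sum_const_zero] at hz
    refine hz.congr fun n => ?_
    rw [Finset.sum_div]
    exact Finset.sum_congr rfl fun i _ => (mul_div_assoc _ _ _).symm
  · filter_upwards [eventually_oddProd_pos hl (seqEdges b k)] with n hn h
    exact sum_compPatterns_cover_le hn h

end Limits

end DegreeSequence
end ConfigModel

namespace ConfigModel
namespace DegreeSequence

/-! ### Overlapping patterns -/

variable {n : ℕ} {d : DegreeSequence n}

lemma IsComp.unique {σ : d.Pairing} {b b' : Bool} {k k' : ℕ} {c : (graph σ).ConnectedComponent}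
    (h : IsComp σ b k c) (h' : IsComp σ b' k' c) : b = b' ∧ k = k' := by
  have key : ∀ {k k' : ℕ}, IsComp σ true k c → IsComp σ false k' c → False := by
    intro k k' h h'
    have h1 : ∀ v ∈ c.supp, d.deg v = 2 := by simpa using h.2
    have h2 : {v ∈ c.supp | d.deg v = 1}.ncard = 2 := h'.2.1
    obtain ⟨v, hv, hv1⟩ := Set.nonempty_of_ncard_ne_zero (by rw [h2]; norm_num)
    have := h1 v hv
    omega
  refine ⟨?_, h.1.symm.trans h'.1⟩
  cases b <;> cases b'
  · rfl
  · exact (key h' h).elim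
  · exact (key h h').elim
  · rfl

/-- Each pattern is the full edge set of a component of the graph, and a common edge makes the
components equal. -/
lemma compPatterns_overlap {b b' : Bool} {k k' : ℕ} (hk : 2 ≤ k) (hk' : 2 ≤ k') {σ : d.Pairing}
    {α β : Finset (Sym2 d.HalfEdge)} (hα : α ∈ compPatterns d b k) (hβ : β ∈ compPatterns d b' k')
    (hσα : α ⊆ edges σ) (hσβ : β ⊆ edges σ) {e : Sym2 d.HalfEdge} (heα : e ∈ α) (heβ : e ∈ β) :
    b = b' ∧ k = k' ∧ α = β := by
  obtain ⟨f, hf, rfl⟩ := mem_compPatterns.1 hα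
  obtain ⟨g, hg, rfl⟩ := mem_compPatterns.1 hβ
  set c := (graph σ).connectedComponentMk (f ⟨0, by omega⟩).1
  set c' := (graph σ).connectedComponentMk (g ⟨0, by omega⟩).1
  have hc : (f ⟨0, by omega⟩).1 ∈ c.supp := rfl
  have hc' : (g ⟨0, by omega⟩).1 ∈ c'.supp := rfl
  have hE := compEdges_eq hk hf hσα hc
  have hE' := compEdges_eq hk' hg hσβ hc'
  have hcc : c = c' := eq_of_mem_compEdges (hE ▸ heα) (hE' ▸ heβ)
  have h1 := isComp_of_compPattern_subset (fun _ => hk) hf hσα hc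
  have h2 := isComp_of_compPattern_subset (fun _ => hk') hg hσβ hc'
  rw [← hcc] at h2
  obtain ⟨hb, hkk⟩ := h1.unique h2
  refine ⟨hb, hkk, ?_⟩
  rw [← hE, ← hE', hcc]

lemma rot_ne_self {k : ℕ} (hk : 2 ≤ k) (i : Fin k) : rot i ≠ i := by
  intro h
  have := congrArg Fin.val h
  have := i.2
  rw [rot_val] at *
  split_ifs at * <;> omega

lemma not_isDiag_ends_of_mem_compPattern {b : Bool} {k : ℕ} (hk : 2 ≤ k)
    {α : Finset (Sym2 d.HalfEdge)} (hα : α ∈ compPatterns d b k) {e : Sym2 d.HalfEdge}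
    (he : e ∈ α) : ¬ (ends e).IsDiag := by
  obtain ⟨f, hf, rfl⟩ := mem_compPatterns.1 hα
  obtain ⟨i, hi, rfl⟩ := mem_compPattern.1 he
  rw [ends_mk, Sym2.mk_isDiag_iff, opp_fst]
  exact fun h => rot_ne_self hk i ((mem_compSeqs.1 hf).1 h).symm

/-- Edges of a line or of a cycle of length at least three have no parallel edges: two parallel
edges would require `j = rot i` and `i = rot j`. The cycle of length two, a double edge, is the
excluded exception. -/
lemma compPattern_eq_of_ends_eq {b : Bool} {k : ℕ} (hk : 2 ≤ k) (hb : b = true → 3 ≤ k)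
    {σ : d.Pairing} {α : Finset (Sym2 d.HalfEdge)} (hα : α ∈ compPatterns d b k)
    (hσα : α ⊆ edges σ) {e e' : Sym2 d.HalfEdge} (he : e ∈ α) (he' : e' ∈ edges σ)
    (hee : ends e' = ends e) : e' = e := by
  obtain ⟨f, hf, rfl⟩ := mem_compPatterns.1 hα
  obtain ⟨i, hi, rfl⟩ := mem_compPattern.1 he
  have hinj := (mem_compSeqs.1 hf).1
  have hmem : e' ∈ compPattern b f := by
    have h1 : (f i).1 ∈ ends e' := by
      rw [hee, ends_mk]
      exact Sym2.mem_mk_left _ _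
    obtain ⟨h, hh, hhi⟩ := Sym2.mem_map.1 h1
    have h2 := mk_apply_mem_compPattern (fun _ => hk) hf hσα hhi
    rwa [(isPartialMatching_edges σ).2 e' he' _ (hσα h2) h hh (Sym2.mem_mk_left _ _)]
  obtain ⟨j, hj, rfl⟩ := mem_compPattern.1 hmem
  rw [ends_mk, ends_mk, Sym2.eq_iff, opp_fst, opp_fst] at hee
  rcases hee with ⟨h1, -⟩ | ⟨h1, h2⟩
  · have hji : j = i := hinj h1
    rw [hji]
  · have h3 : j = rot i := hinj h1
    have h4 : rot j = i := hinj h2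
    exfalso
    have h5 := congrArg Fin.val h3
    have h6 := congrArg Fin.val h4
    rw [rot_val] at h5 h6
    have := i.2
    have := j.2
    cases b
    · simp only [IsEdgeIndex, Bool.false_eq_true, false_or] at hi hj
      rw [if_pos hi] at h5
      rw [if_pos hj] at h6
      omega
    · have := hb rfl
      split_ifs at h5 h6 <;> omega

/-- The patterns that are counted by the components of `counts`; multiple edges are replaced by
unordered pairs of parallel edges. -/
noncomputable def patterns (d : DegreeSequence n) : CountIndex → Finset (Finset (Sym2 d.HalfEdge))
  | .line k _ => compPatterns d false k
  | .cycle k _ => compPatterns d true k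
  | .selfLoops => loopPatterns d
  | .multiEdges => doublePatterns d

/-- The number of edges in the patterns. -/
def patternSize : CountIndex → ℕ
  | .line k _ => seqEdges false k
  | .cycle k _ => seqEdges true k
  | .selfLoops => 1
  | .multiEdges => 2

lemma patternSize_pos (i : CountIndex) : 0 < patternSize i := by
  cases i <;> simp [patternSize, seqEdges] <;> omega

lemma isPartialMatching_of_mem_patterns {i : CountIndex} {α : Finset (Sym2 d.HalfEdge)}
    (h : α ∈ patterns d i) : IsPartialMatching α ∧ α.card = patternSize i := by
  cases i with
  | line k hk =>
    obtain ⟨f, hf, rfl⟩ := mem_compPatterns.1 h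
    exact ⟨isPartialMatching_compPattern hf, card_compPattern hf⟩
  | cycle k hk =>
    obtain ⟨f, hf, rfl⟩ := mem_compPatterns.1 h
    exact ⟨isPartialMatching_compPattern hf, card_compPattern hf⟩
  | selfLoops => exact ⟨isPartialMatching_of_mem_loopPatterns h, card_of_mem_loopPatterns h⟩
  | multiEdges => exact ⟨(mem_doublePatterns.1 h).2.1, (mem_doublePatterns.1 h).1⟩

lemma disjoint_compPatterns_loopPatterns {b : Bool} {k : ℕ} (hk : 2 ≤ k)
    {α β : Finset (Sym2 d.HalfEdge)} (hα : α ∈ compPatterns d b k) (hβ : β ∈ loopPatterns d)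
    {e : Sym2 d.HalfEdge} (heα : e ∈ α) (heβ : e ∈ β) : False := by
  obtain ⟨e', he', rfl⟩ := mem_loopPatterns.1 hβ
  obtain rfl := Finset.mem_singleton.1 heβ
  exact not_isDiag_ends_of_mem_compPattern hk hα heα he'.2

lemma disjoint_compPatterns_doublePatterns {b : Bool} {k : ℕ} (hk : 2 ≤ k) (hb : b = true → 3 ≤ k)
    {σ : d.Pairing} {α β : Finset (Sym2 d.HalfEdge)} (hα : α ∈ compPatterns d b k)
    (hβ : β ∈ doublePatterns d) (hσα : α ⊆ edges σ) (hσβ : β ⊆ edges σ) {e : Sym2 d.HalfEdge}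
    (heα : e ∈ α) (heβ : e ∈ β) : False := by
  obtain ⟨hcard, -, z, -, hz⟩ := mem_doublePatterns.1 hβ
  obtain ⟨e', he', hne⟩ := Finset.exists_mem_ne (s := β) (by omega) e
  exact hne (compPattern_eq_of_ends_eq hk hb hα hσα heα (hσβ he')
    ((hz e' he').trans (hz e heβ).symm))

lemma disjoint_loopPatterns_doublePatterns {α β : Finset (Sym2 d.HalfEdge)}
    (hα : α ∈ loopPatterns d) (hβ : β ∈ doublePatterns d) {e : Sym2 d.HalfEdge}
    (heα : e ∈ α) (heβ : e ∈ β) : False := by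
  obtain ⟨e', he', rfl⟩ := mem_loopPatterns.1 hα
  obtain rfl := Finset.mem_singleton.1 heα
  obtain ⟨-, -, z, hz0, hz⟩ := mem_doublePatterns.1 hβ
  exact hz0 (hz e heβ ▸ he'.2)

/-- Distinct patterns that occur together are disjoint, except for pairs of parallel edges. -/
lemma patterns_overlap {σ : d.Pairing} {i j : CountIndex} {α β : Finset (Sym2 d.HalfEdge)}
    (hα : α ∈ patterns d i) (hβ : β ∈ patterns d j) (hσα : α ⊆ edges σ) (hσβ : β ⊆ edges σ)
    (hαβ : ¬ Disjoint α β) :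
    (j = i ∧ β = α) ∨ (i = .multiEdges ∧ j = .multiEdges) := by
  obtain ⟨e, heα, heβ⟩ := Finset.not_disjoint_iff.1 hαβ
  have hcc : ∀ {b b' : Bool} {k k' : ℕ}, 2 ≤ k → 2 ≤ k' → α ∈ compPatterns d b k →
      β ∈ compPatterns d b' k' → b = b' ∧ k = k' ∧ α = β := fun h h' hα hβ =>
    compPatterns_overlap h h' hα hβ hσα hσβ heα heβ
  cases i with
  | line k hk =>
    cases j with
    | line k' hk' =>
      obtain ⟨-, rfl, rfl⟩ := hcc hk hk' hα hβ
      exact Or.inl ⟨rfl, rfl⟩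
    | cycle k' hk' => exact absurd (hcc hk (by omega) hα hβ).1 (by simp)
    | selfLoops => exact (disjoint_compPatterns_loopPatterns hk hα hβ heα heβ).elim
    | multiEdges =>
      exact (disjoint_compPatterns_doublePatterns hk (by simp) hα hβ hσα hσβ heα heβ).elim
  | cycle k hk =>
    cases j with
    | line k' hk' => exact absurd (hcc (by omega) hk' hα hβ).1 (by simp)
    | cycle k' hk' =>
      obtain ⟨-, rfl, rfl⟩ := hcc (by omega) (by omega) hα hβ
      exact Or.inl ⟨rfl, rfl⟩
    | selfLoops => exact (disjoint_compPatterns_loopPatterns (by omega) hα hβ heα heβ).elim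
    | multiEdges =>
      exact (disjoint_compPatterns_doublePatterns (by omega) (fun _ => hk) hα hβ hσα hσβ
        heα heβ).elim
  | selfLoops =>
    cases j with
    | line k' hk' => exact (disjoint_compPatterns_loopPatterns hk' hβ hα heβ heα).elim
    | cycle k' hk' => exact (disjoint_compPatterns_loopPatterns (by omega) hβ hα heβ heα).elim
    | selfLoops =>
      obtain ⟨e', -, rfl⟩ := mem_loopPatterns.1 hα
      obtain ⟨e'', -, rfl⟩ := mem_loopPatterns.1 hβ
      exact Or.inl ⟨rfl, by rw [← Finset.mem_singleton.1 heα, ← Finset.mem_singleton.1 heβ]⟩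
    | multiEdges => exact (disjoint_loopPatterns_doublePatterns hα hβ heα heβ).elim
  | multiEdges =>
    cases j with
    | line k' hk' =>
      exact (disjoint_compPatterns_doublePatterns hk' (by simp) hβ hα hσβ hσα heβ heα).elim
    | cycle k' hk' =>
      exact (disjoint_compPatterns_doublePatterns (by omega) (fun _ => hk') hβ hα hσβ hσα
        heβ heα).elim
    | selfLoops => exact (disjoint_loopPatterns_doublePatterns hβ hα heβ heα).elim
    | multiEdges => exact Or.inr ⟨rfl, rfl⟩

lemma exists_subset_edges_of_edgeProb_ne_zero {α : Finset (Sym2 d.HalfEdge)}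
    (h : edgeProb α ≠ 0) : ∃ σ : d.Pairing, α ⊆ edges σ := by
  by_contra hno
  push Not at hno
  refine h ?_
  simp [edgeProb, hno, expect]

open Classical in
-- A nonzero joint probability is witnessed by a pairing that contains both patterns, and
-- `patterns_overlap` then leaves only pairs of parallel edges.
lemma sum_overlapping_patterns_le (d : DegreeSequence n) (i j : CountIndex) :
    ∑ α ∈ patterns d i, ∑ β ∈ patterns d j,
      (if ¬ (j = i ∧ β = α) ∧ ¬ Disjoint α β then edgeProb (α ∪ β) else 0) ≤
    if i = .multiEdges ∧ j = .multiEdges then expect fun σ : d.Pairing => (tripleCount σ : ℝ)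
    else 0 := by
  split_ifs with h
  · obtain ⟨rfl, rfl⟩ := h
    refine le_of_eq_of_le ?_ (sum_overlapping_doubles_le d)
    refine Finset.sum_congr rfl fun α _ => Finset.sum_congr rfl fun β _ => ?_
    simp only [true_and, ne_eq, eq_comm (a := β)]
  · refine Finset.sum_nonpos fun α hα => Finset.sum_nonpos fun β hβ => ?_
    split_ifs with h1
    · by_contra h2
      obtain ⟨σ, hσ⟩ := exists_subset_edges_of_edgeProb_ne_zero (fun h0 => h2 h0.le)
      rcases patterns_overlap hα hβ (Finset.union_subset_left hσ) (Finset.union_subset_right hσ)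
        h1.2 with h3 | h3
      · exact h1.1 h3
      · exact h h3
    · exact le_rfl

end DegreeSequence
end ConfigModel

namespace ConfigModel
namespace DegreeSequence

/-! ### The critical window -/

section Fixed

variable {n : ℕ} {d : DegreeSequence n}

/-- The number of ordered pairs of distinct half-edges at a common vertex. -/
noncomputable def degPairs (d : DegreeSequence n) : ℝ := ∑ v, ((d.deg v).descFactorial 2 : ℝ)

lemma degPairs_nonneg (d : DegreeSequence n) : 0 ≤ degPairs d :=
  Finset.sum_nonneg fun _ _ => Nat.cast_nonneg _

lemma nu_eq (hn : n ≠ 0) (d : DegreeSequence n) :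
    d.nu = degPairs d / Fintype.card d.HalfEdge := by
  have hn' : (n : ℝ) ≠ 0 := Nat.cast_ne_zero.2 hn
  rw [nu, meanDegPairs, meanDeg, div_div_div_cancel_right₀ hn', degPairs, card_halfEdge]
  push_cast [Nat.cast_descFactorial_two]
  rfl

lemma card_halfEdge_div (d : DegreeSequence n) :
    (Fintype.card d.HalfEdge : ℝ) / n = d.meanDeg := by
  rw [meanDeg, card_halfEdge]
  push_cast
  rfl

lemma one_le_deg (h0 : d.numDeg 0 = 0) (v : Fin n) : 1 ≤ d.deg v := by
  rw [numDeg, Finset.card_eq_zero, Finset.filter_eq_empty_iff] at h0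
  exact Nat.one_le_iff_ne_zero.2 (h0 (Finset.mem_univ v))

lemma le_card_halfEdge (h0 : d.numDeg 0 = 0) : n ≤ Fintype.card d.HalfEdge := by
  rw [card_halfEdge]
  calc n = ∑ _v : Fin n, 1 := by simp
    _ ≤ _ := Finset.sum_le_sum fun v _ => one_le_deg h0 v

lemma sum_descFactorial_sq_le (d : DegreeSequence n) :
    ∑ v, ((d.deg v).descFactorial 2 : ℝ) ^ 2 ≤ (d.maxDeg : ℝ) ^ 2 * degPairs d := by
  rw [degPairs, Finset.mul_sum]
  refine Finset.sum_le_sum fun v _ => ?_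
  rw [sq ((d.deg v).descFactorial 2 : ℝ)]
  refine mul_le_mul_of_nonneg_right ?_ (Nat.cast_nonneg _)
  have h1 : (d.deg v).descFactorial 2 ≤ d.maxDeg ^ 2 :=
    (Nat.descFactorial_le_pow _ _).trans (Nat.pow_le_pow_left (deg_le_maxDeg v) 2)
  exact_mod_cast h1

/-- A set of vertices that has at least about half of all vertices, and leaves at least half of the
pairs of half-edges to its complement. -/
lemma exists_balanced (d : DegreeSequence n) (h0 : d.numDeg 0 = 0) :
    ∃ A : Finset (Fin n), (n : ℝ) / 2 - 1 - d.numDeg 1 ≤ (A.filter fun v => 2 ≤ d.deg v).card ∧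
      degPairs d / 2 ≤ ∑ v ∈ Aᶜ, ((d.deg v).descFactorial 2 : ℝ) := by
  -- Take any half `B` of the vertices. Either `B` or its complement can serve as `A`, according to
  -- which side carries fewer pairs of half-edges; rounding costs `1`, and the vertices of degree
  -- one are discarded.
  obtain ⟨B, -, hB⟩ := Finset.exists_subset_card_eq (s := (Finset.univ : Finset (Fin n)))
    (n := n / 2) (by rw [Finset.card_univ, Fintype.card_fin]; exact Nat.div_le_self _ _)
  have hcard : ∀ A : Finset (Fin n), n / 2 ≤ A.card →
      (n : ℝ) / 2 - 1 - d.numDeg 1 ≤ (A.filter fun v => 2 ≤ d.deg v).card := by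
    intro A hA
    have h1 := Finset.card_filter_add_card_filter_not (s := A) fun v => 2 ≤ d.deg v
    have h2 : (A.filter fun v => ¬ 2 ≤ d.deg v).card ≤ d.numDeg 1 := by
      refine Finset.card_le_card fun v hv => ?_
      have h3 := (Finset.mem_filter.1 hv).2
      have h4 := one_le_deg h0 v
      exact Finset.mem_filter.2 ⟨Finset.mem_univ _, by omega⟩
    have h5 : n ≤ 2 * ((A.filter fun v => 2 ≤ d.deg v).card + d.numDeg 1) + 2 := by omega
    have h6 : (n : ℝ) ≤ 2 * ((A.filter fun v => 2 ≤ d.deg v).card + d.numDeg 1) + 2 := by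
      exact_mod_cast h5
    linarith
  have hsum := Finset.sum_add_sum_compl B fun v => ((d.deg v).descFactorial 2 : ℝ)
  have hcompl : n / 2 ≤ Bᶜ.card := by
    rw [Finset.card_compl, hB, Fintype.card_fin]
    omega
  rw [← degPairs] at hsum
  rcases le_total (degPairs d / 2) (∑ v ∈ Bᶜ, ((d.deg v).descFactorial 2 : ℝ)) with h | h
  · exact ⟨B, hcard B hB.ge, h⟩
  · exact ⟨Bᶜ, hcard _ hcompl, by rw [compl_compl]; linarith⟩

lemma prob_le_add {p q r : d.Pairing → Prop} (h : ∀ σ, p σ → q σ ∨ r σ) :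
    prob p ≤ prob q + prob r := by
  classical
  rw [prob_eq, prob_eq, prob_eq, ← expect_add]
  refine expect_mono fun σ => ?_
  have := h σ
  split_ifs <;> simp_all

end Fixed

end DegreeSequence

open DegreeSequence

namespace CriticalWindow

variable {d : (n : ℕ+) → DegreeSequence n} {ρ₁ p₂ dbar : ℝ≥0}

lemma tendsto_natCast_pnat : Tendsto (fun n : ℕ+ => (n : ℝ)) atTop atTop :=
  tendsto_natCast_atTop_atTop.comp tendsto_PNat_val_atTop_atTop

lemma tendsto_card_halfEdge (hd : CriticalWindow d ρ₁ p₂ dbar) :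
    Tendsto (fun n => (Fintype.card (d n).HalfEdge : ℝ)) atTop atTop :=
  tendsto_atTop_mono (fun n => Nat.cast_le.2 (le_card_halfEdge (hd.numDeg_zero n)))
    tendsto_natCast_pnat

lemma tendsto_card_div (hd : CriticalWindow d ρ₁ p₂ dbar) :
    Tendsto (fun n : ℕ+ => (Fintype.card (d n).HalfEdge : ℝ) / n) atTop (𝓝 dbar) :=
  hd.tendsto_meanDeg.congr fun _ => (card_halfEdge_div _).symm

lemma one_le_dbar (hd : CriticalWindow d ρ₁ p₂ dbar) : (1 : ℝ) ≤ dbar := by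
  refine ge_of_tendsto' hd.tendsto_card_div fun n => ?_
  rw [one_le_div (Nat.cast_pos.2 n.pos)]
  exact Nat.cast_le.2 (le_card_halfEdge (hd.numDeg_zero n))

lemma dbar_ne_zero (hd : CriticalWindow d ρ₁ p₂ dbar) : (dbar : ℝ) ≠ 0 :=
  (one_pos.trans_le hd.one_le_dbar).ne'

/-- Limits relative to the number of vertices and to the number of half-edges. -/
lemma tendsto_div_card (hd : CriticalWindow d ρ₁ p₂ dbar) {a : ℕ+ → ℝ} {c : ℝ}
    (ha : Tendsto (fun n : ℕ+ => a n / n) atTop (𝓝 c)) :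
    Tendsto (fun n => a n / Fintype.card (d n).HalfEdge) atTop (𝓝 (c / dbar)) := by
  refine (ha.div hd.tendsto_card_div hd.dbar_ne_zero).congr fun n => ?_
  exact div_div_div_cancel_right₀ (Nat.cast_ne_zero.2 n.ne_zero) _ _

lemma tendsto_sq_div_of_tendsto_div_sqrt {a : ℕ+ → ℝ} {c : ℝ}
    (ha : Tendsto (fun n : ℕ+ => a n / √(n : ℝ)) atTop (𝓝 c)) :
    Tendsto (fun n : ℕ+ => a n ^ 2 / n) atTop (𝓝 (c ^ 2)) := by
  refine (ha.pow 2).congr fun n => ?_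
  rw [div_pow, Real.sq_sqrt (Nat.cast_nonneg _)]

lemma tendsto_numDeg_one_sq_div (hd : CriticalWindow d ρ₁ p₂ dbar) :
    Tendsto (fun n => ((d n).numDeg 1 : ℝ) ^ 2 / Fintype.card (d n).HalfEdge) atTop
      (𝓝 ((ρ₁ : ℝ) ^ 2 / dbar)) :=
  hd.tendsto_div_card (tendsto_sq_div_of_tendsto_div_sqrt hd.tendsto_numDeg_one)

lemma tendsto_numDeg_one_div_nat (hd : CriticalWindow d ρ₁ p₂ dbar) :
    Tendsto (fun n : ℕ+ => ((d n).numDeg 1 : ℝ) / n) atTop (𝓝 0) := by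
  have h1 : Tendsto (fun n : ℕ+ => (√(n : ℝ))⁻¹) atTop (𝓝 0) :=
    tendsto_inv_atTop_zero.comp (Real.tendsto_sqrt_atTop.comp tendsto_natCast_pnat)
  have h2 := hd.tendsto_numDeg_one.mul h1
  rw [mul_zero] at h2
  refine h2.congr fun n => ?_
  rw [← div_eq_mul_inv, div_div, Real.mul_self_sqrt (Nat.cast_nonneg _)]

lemma tendsto_numDeg_one_div (hd : CriticalWindow d ρ₁ p₂ dbar) :
    Tendsto (fun n => ((d n).numDeg 1 : ℝ) / Fintype.card (d n).HalfEdge) atTop (𝓝 0) := by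
  have := hd.tendsto_div_card hd.tendsto_numDeg_one_div_nat
  rwa [zero_div] at this

lemma tendsto_numDeg_two_div (hd : CriticalWindow d ρ₁ p₂ dbar) :
    Tendsto (fun n => 2 * ((d n).numDeg 2 : ℝ) / Fintype.card (d n).HalfEdge) atTop
      (𝓝 (2 * p₂ / dbar)) := by
  refine hd.tendsto_div_card ((hd.tendsto_numDeg_two.const_mul 2).congr fun n => ?_)
  exact (mul_div_assoc _ _ _).symm

/-! ### Finite limiting `ν`. -/

section Finite

variable {ν : ℝ}

lemma tendsto_degPairs_div (hν : Tendsto (fun n : ℕ+ => (d n).nu) atTop (𝓝 ν)) :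
    Tendsto (fun n => degPairs (d n) / Fintype.card (d n).HalfEdge) atTop (𝓝 ν) :=
  hν.congr fun n => nu_eq n.ne_zero _

lemma tendsto_maxDeg_sq_div (hd : CriticalWindow d ρ₁ p₂ dbar)
    (hmax : Tendsto (fun n : ℕ+ => ((d n).maxDeg : ℝ) / √(n : ℝ)) atTop (𝓝 0)) :
    Tendsto (fun n => ((d n).maxDeg : ℝ) ^ 2 / Fintype.card (d n).HalfEdge) atTop (𝓝 0) := by
  have := hd.tendsto_div_card (tendsto_sq_div_of_tendsto_div_sqrt hmax)
  simpa using this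

lemma tendsto_maxDeg_div (hd : CriticalWindow d ρ₁ p₂ dbar)
    (hmax : Tendsto (fun n : ℕ+ => ((d n).maxDeg : ℝ) / √(n : ℝ)) atTop (𝓝 0)) :
    Tendsto (fun n => ((d n).maxDeg : ℝ) / Fintype.card (d n).HalfEdge) atTop (𝓝 0) := by
  refine squeeze_zero (fun n => by positivity) (fun n => ?_) (hd.tendsto_maxDeg_sq_div hmax)
  refine div_le_div_of_nonneg_right ?_ (Nat.cast_nonneg _)
  exact_mod_cast Nat.le_self_pow two_ne_zero _

lemma tendsto_sum_edgeProb_loopPatterns (hd : CriticalWindow d ρ₁ p₂ dbar)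
    (hν : Tendsto (fun n : ℕ+ => (d n).nu) atTop (𝓝 ν)) :
    Tendsto (fun n => ∑ α ∈ loopPatterns (d n), edgeProb α) atTop (𝓝 (ν / 2)) := by
  have h1 : Tendsto (fun n => degPairs (d n) / (Fintype.card (d n).HalfEdge : ℝ) ^ 1) atTop
      (𝓝 ν) := by simpa using tendsto_degPairs_div hν
  refine ((tendsto_div_oddProd hd.tendsto_card_halfEdge 1 h1).div_const 2).congr fun n => ?_
  rw [sum_edgeProb_loopPatterns, div_div, mul_comm (oddProd _ _), degPairs]

lemma tendsto_sum_edgeProb_doublePatterns (hd : CriticalWindow d ρ₁ p₂ dbar)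
    (hν : Tendsto (fun n : ℕ+ => (d n).nu) atTop (𝓝 ν))
    (hmax : Tendsto (fun n : ℕ+ => ((d n).maxDeg : ℝ) / √(n : ℝ)) atTop (𝓝 0)) :
    Tendsto (fun n => ∑ α ∈ doublePatterns (d n), edgeProb α) atTop (𝓝 (ν ^ 2 / 4)) := by
  have hQ := tendsto_degPairs_div hν
  have h1 : Tendsto (fun n => (∑ v, (((d n).deg v).descFactorial 2 : ℝ) ^ 2) /
      (Fintype.card (d n).HalfEdge : ℝ) ^ 2) atTop (𝓝 0) := by
    have h2 := (hd.tendsto_maxDeg_sq_div hmax).mul hQ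
    rw [zero_mul] at h2
    refine squeeze_zero (fun n => by positivity) (fun n => ?_) h2
    rw [div_mul_div_comm, ← sq]
    exact div_le_div_of_nonneg_right (sum_descFactorial_sq_le _) (by positivity)
  have h3 := (hQ.pow 2).sub h1
  simp only [div_pow, ← sub_div, sub_zero] at h3
  refine ((tendsto_div_oddProd hd.tendsto_card_halfEdge 2 h3).div_const 4).congr fun n => ?_
  rw [sum_edgeProb_doublePatterns, div_div, mul_comm (oddProd _ _), degPairs]

lemma tendsto_expect_tripleCount (hd : CriticalWindow d ρ₁ p₂ dbar)
    (hν : Tendsto (fun n : ℕ+ => (d n).nu) atTop (𝓝 ν))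
    (hmax : Tendsto (fun n : ℕ+ => ((d n).maxDeg : ℝ) / √(n : ℝ)) atTop (𝓝 0)) :
    Tendsto (fun n => expect fun σ : (d n).Pairing => (tripleCount σ : ℝ)) atTop (𝓝 0) := by
  have h1 := (hd.tendsto_maxDeg_sq_div hmax).mul ((tendsto_degPairs_div hν).pow 2)
  simp only [div_pow, div_mul_div_comm, ← pow_succ', zero_mul] at h1
  refine squeeze_zero' (Eventually.of_forall fun n => expect_nonneg fun σ => Nat.cast_nonneg _) ?_
    (tendsto_div_oddProd hd.tendsto_card_halfEdge 3 h1)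
  filter_upwards [eventually_oddProd_pos hd.tendsto_card_halfEdge 3] with n hn
  exact expect_tripleCount_le hn

lemma exists_tendsto_loopPatterns_cover (hd : CriticalWindow d ρ₁ p₂ dbar)
    (hmax : Tendsto (fun n : ℕ+ => ((d n).maxDeg : ℝ) / √(n : ℝ)) atTop (𝓝 0)) :
    ∃ δ : ℕ+ → ℝ, Tendsto δ atTop (𝓝 0) ∧ ∀ᶠ n in atTop, ∀ h,
      ∑ β ∈ loopPatterns (d n) with h ∈ cover β, edgeProb β ≤ δ n := by
  refine ⟨fun n => (d n).maxDeg / oddProd (d n) 1,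
    tendsto_div_oddProd hd.tendsto_card_halfEdge 1 (by simpa using hd.tendsto_maxDeg_div hmax), ?_⟩
  filter_upwards [eventually_oddProd_pos hd.tendsto_card_halfEdge 1] with n hn h
  exact sum_loopPatterns_cover_le hn h

lemma exists_tendsto_doublePatterns_cover (hd : CriticalWindow d ρ₁ p₂ dbar)
    (hν : Tendsto (fun n : ℕ+ => (d n).nu) atTop (𝓝 ν))
    (hmax : Tendsto (fun n : ℕ+ => ((d n).maxDeg : ℝ) / √(n : ℝ)) atTop (𝓝 0)) :
    ∃ δ : ℕ+ → ℝ, Tendsto δ atTop (𝓝 0) ∧ ∀ᶠ n in atTop, ∀ h,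
      ∑ β ∈ doublePatterns (d n) with h ∈ cover β, edgeProb β ≤ δ n := by
  have h1 := (hd.tendsto_maxDeg_div hmax).mul (tendsto_degPairs_div hν)
  simp only [div_mul_div_comm, ← sq, zero_mul] at h1
  refine ⟨fun n => (d n).maxDeg * degPairs (d n) / oddProd (d n) 2,
    tendsto_div_oddProd hd.tendsto_card_halfEdge 2 h1, ?_⟩
  filter_upwards [eventually_oddProd_pos hd.tendsto_card_halfEdge 2] with n hn h
  exact sum_doublePatterns_cover_le hn h

end Finite

/-! ### Infinite limiting `ν`. -/

section Infinite

lemma tendsto_degPairs_div_atTop (hν : Tendsto (fun n : ℕ+ => (d n).nu) atTop atTop) :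
    Tendsto (fun n => degPairs (d n) / Fintype.card (d n).HalfEdge) atTop atTop :=
  hν.congr fun n => nu_eq n.ne_zero _

lemma tendsto_pow_div_oddProd (hd : CriticalWindow d ρ₁ p₂ dbar) (r : ℕ) :
    Tendsto (fun n => (Fintype.card (d n).HalfEdge : ℝ) ^ r / oddProd (d n) r) atTop (𝓝 1) := by
  refine tendsto_div_oddProd hd.tendsto_card_halfEdge r ?_
  refine tendsto_const_nhds.congr' ?_
  filter_upwards [hd.tendsto_card_halfEdge.eventually_gt_atTop 0] with n hn
  exact (div_self (pow_ne_zero _ hn.ne')).symm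

theorem tendsto_prob_selfLoops_lt (hd : CriticalWindow d ρ₁ p₂ dbar)
    (hν : Tendsto (fun n : ℕ+ => (d n).nu) atTop atTop) (K : ℕ) :
    Tendsto (fun n => prob fun σ : (d n).Pairing => selfLoops σ < K) atTop (𝓝 0) := by
  simp only [selfLoops_eq_patternCount]
  refine tendsto_prob_patternCount_lt hd.tendsto_card_halfEdge _ 1
    (fun n α hα => isPartialMatching_of_mem_loopPatterns hα)
    (fun n α hα => card_of_mem_loopPatterns hα) (fun n α hα β hβ hne hm => ?_) ?_ K
  · obtain ⟨e, -, rfl⟩ := mem_loopPatterns.1 hα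
    obtain ⟨e', -, rfl⟩ := mem_loopPatterns.1 hβ
    rw [Finset.disjoint_left]
    intro h h1 h2
    obtain ⟨f, hf, hh⟩ := mem_cover.1 h1
    obtain ⟨f', hf', hh'⟩ := mem_cover.1 h2
    rw [Finset.mem_singleton] at hf hf'
    subst hf hf'
    exact hne (by rw [hm.2 f (by simp) f' (by simp) h hh hh'])
  · have h1 := (tendsto_degPairs_div_atTop hν).atTop_mul_pos one_pos (hd.tendsto_pow_div_oddProd 1)
    refine (h1.atTop_div_const two_pos).congr' ?_
    filter_upwards [hd.tendsto_card_halfEdge.eventually_gt_atTop 0] with n hn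
    rw [sum_edgeProb_loopPatterns, pow_one, div_mul_div_cancel₀ hn.ne', div_div,
      mul_comm (oddProd _ _), degPairs]

/-- The mean number of hub patterns is at least of order `n · Σ d(d-1) / ℓ²`. Since `n / ℓ` tends to
`1 / dbar > 0`, this is of order `ν_n` and diverges. -/
theorem tendsto_prob_multiEdges_lt (hd : CriticalWindow d ρ₁ p₂ dbar)
    (hν : Tendsto (fun n : ℕ+ => (d n).nu) atTop atTop) (K : ℕ) :
    Tendsto (fun n => prob fun σ : (d n).Pairing => multiEdges σ < K) atTop (𝓝 0) := by
  have hl := hd.tendsto_card_halfEdge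
  choose A hA hA' using fun n => exists_balanced (d n) (hd.numDeg_zero n)
  have hmain : Tendsto (fun n => prob fun σ => patternCount (hubPatterns (d n) (A n)) σ < K) atTop
      (𝓝 0) := by
    have hpm : ∀ n, ∀ α ∈ hubPatterns (d n) (A n), IsPartialMatching α := by
      intro n α hα
      obtain ⟨p, -, rfl⟩ := Finset.mem_image.1 hα
      exact isPartialMatching_hubPattern p
    have hcard : ∀ n, ∀ α ∈ hubPatterns (d n) (A n), α.card = 2 := by
      intro n α hα
      obtain ⟨p, -, rfl⟩ := Finset.mem_image.1 hα
      exact card_hubPattern p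
    refine tendsto_prob_patternCount_lt hl _ 2 hpm hcard (fun n α hα β hβ hne hm => ?_) ?_ K
    · obtain ⟨p, -, rfl⟩ := Finset.mem_image.1 hα
      obtain ⟨q, -, rfl⟩ := Finset.mem_image.1 hβ
      by_contra h
      exact hne (by rw [eq_of_not_disjoint_cover hm h])
    · have h1 : Tendsto (fun n : ℕ+ => ((n : ℝ) / 2 - 1 - (d n).numDeg 1) /
          Fintype.card (d n).HalfEdge) atTop (𝓝 (1 / 2 / dbar)) := by
        refine hd.tendsto_div_card ?_
        have h2 := ((tendsto_const_nhds (x := (1 / 2 : ℝ))).sub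
          (tendsto_inv_atTop_zero.comp tendsto_natCast_pnat)).sub hd.tendsto_numDeg_one_div_nat
        rw [sub_zero, sub_zero] at h2
        refine h2.congr fun n => ?_
        have : (n : ℝ) ≠ 0 := Nat.cast_ne_zero.2 n.ne_zero
        simp only [Function.comp_apply]
        field_simp
      have hpos : (0 : ℝ) < 1 / 2 / dbar := by
        have := one_pos.trans_le hd.one_le_dbar
        positivity
      have h3 := (((tendsto_degPairs_div_atTop hν).atTop_mul_pos hpos h1).atTop_mul_pos one_pos
        (hd.tendsto_pow_div_oddProd 2)).atTop_div_const two_pos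
      refine tendsto_atTop_mono' _ ?_ h3
      filter_upwards [hl.eventually_gt_atTop 0, eventually_oddProd_pos hl 2] with n hn h0
      rw [sum_edgeProb_eq_card_div (hpm n) (hcard n), card_hubPatterns, div_mul_div_comm, ← sq,
        div_mul_div_cancel₀ (pow_ne_zero _ hn.ne'), div_right_comm]
      refine div_le_div_of_nonneg_right ?_ h0.le
      push_cast
      have h4 : degPairs (d n) * ((n : ℝ) / 2 - 1 - (d n).numDeg 1) / 2 =
          ((n : ℝ) / 2 - 1 - (d n).numDeg 1) * (degPairs (d n) / 2) := by ring
      rw [h4]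
      exact mul_le_mul (hA n) (hA' n) (div_nonneg (degPairs_nonneg _) zero_le_two)
        (Nat.cast_nonneg _)
  refine squeeze_zero (fun n => prob_nonneg _) (fun n => prob_mono fun σ hσ => ?_) hmain
  exact (patternCount_hubPatterns_le _ σ).trans_lt hσ

end Infinite

end CriticalWindow
end ConfigModel

/-! ### Assembly of the joint limit. -/

namespace ConfigModel

open DegreeSequence

/-- The family `counts`, with values in `ℕ`. -/
noncomputable def natCounts {n : ℕ} {d : DegreeSequence n} (σ : d.Pairing) : CountIndex → ℕ
  | .line k _ => lines σ k
  | .cycle k _ => cycles σ k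
  | .selfLoops => selfLoops σ
  | .multiEdges => multiEdges σ

lemma counts_eq_natCounts {n : ℕ} {d : DegreeSequence n} (σ : d.Pairing) :
    counts σ = fun i => (natCounts σ i : ℕ∞) := by
  ext1 i
  cases i <;> rfl

lemma natCounts_eq_or {n : ℕ} {d : DegreeSequence n} (σ : d.Pairing) (i : CountIndex) :
    natCounts σ i = patternCount (patterns d i) σ ∨ (i = .multiEdges ∧ 1 ≤ tripleCount σ) := by
  cases i with
  | line k hk => exact Or.inl (lines_eq_patternCount σ hk)
  | cycle k hk => exact Or.inl (cycles_eq_patternCount σ (by omega))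
  | selfLoops => exact Or.inl (selfLoops_eq_patternCount σ)
  | multiEdges => exact (multiEdges_eq_or σ).imp id fun h => ⟨rfl, h⟩

lemma measureReal_eq_prob {n : ℕ} {d : DegreeSequence n} (p : d.Pairing → Prop) :
    d.cmMeasure.real {σ | p σ} = prob p := by
  classical
  rw [prob_eq, expect, Finset.sum_boole, cmMeasure, Measure.real, uniformOn_univ,
    Measure.count_apply_finite _ (Set.toFinite _), ENNReal.toReal_div]
  simp only [ENNReal.toReal_natCast]
  congr 3
  ext σ
  simp

variable {d : (n : ℕ+) → DegreeSequence n}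

/-- Joint Poisson convergence of finitely many of the counts. -/
theorem tendsto_prob_natCounts
    (hl : Tendsto (fun n => (Fintype.card (d n).HalfEdge : ℝ)) atTop atTop)
    (F : Finset CountIndex) (lam : CountIndex → ℝ)
    (hmean : ∀ i ∈ F, Tendsto (fun n => ∑ α ∈ patterns (d n) i, edgeProb α) atTop (𝓝 (lam i)))
    (hloc : ∀ i ∈ F, ∃ δ : ℕ+ → ℝ, Tendsto δ atTop (𝓝 0) ∧ ∀ᶠ n in atTop, ∀ h,
      ∑ β ∈ patterns (d n) i with h ∈ cover β, edgeProb β ≤ δ n)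
    (htriple : .multiEdges ∈ F →
      Tendsto (fun n => expect fun σ : (d n).Pairing => (tripleCount σ : ℝ)) atTop (𝓝 0))
    (x : F → ℕ) :
    Tendsto (fun n => prob fun σ : (d n).Pairing => (fun i : F => natCounts σ i) = x) atTop
      (𝓝 (∏ i : F, Real.exp (-lam i) * lam i ^ x i / (x i).factorial)) := by
  classical
  have hN := tendsto_prob_patternCount hl (ι := F) (fun n i => patterns (d n) i)
    (fun i => patternSize i) (fun i => lam i)
    (fun n i α hα => (isPartialMatching_of_mem_patterns hα).1) (fun i => patternSize_pos _)
    (fun n i α hα => (isPartialMatching_of_mem_patterns hα).2) (fun i => hmean i i.2)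
    (fun i => hloc i i.2) (fun i j => ?_) x
  -- The actual counts and the pattern counts agree unless there is a triple edge and `M` is among
  -- the coordinates; Markov's inequality makes this event negligible.
  · have hbad : Tendsto (fun n => prob fun σ : (d n).Pairing =>
        CountIndex.multiEdges ∈ F ∧ 1 ≤ tripleCount σ) atTop (𝓝 0) := by
      by_cases hF : CountIndex.multiEdges ∈ F
      · refine squeeze_zero (fun n => prob_nonneg _) (fun n => ?_) (htriple hF)
        refine (prob_mono (q := fun σ => (1 : ℝ) ≤ (tripleCount σ : ℝ)) fun σ hσ => ?_).trans
          ((prob_le_expect_div (fun σ => Nat.cast_nonneg _) one_pos).trans_eq (div_one _))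
        exact_mod_cast hσ.2
      · refine tendsto_const_nhds.congr fun n => ?_
        simp [prob_eq, hF, expect]
    have hdiff : ∀ n, ∀ σ : (d n).Pairing,
        (fun i : F => natCounts σ i) = (fun i : F => patternCount (patterns (d n) i) σ) ∨
          (CountIndex.multiEdges ∈ F ∧ 1 ≤ tripleCount σ) := by
      intro n σ
      by_cases hb : CountIndex.multiEdges ∈ F ∧ 1 ≤ tripleCount σ
      · exact Or.inr hb
      · refine Or.inl (funext fun i => (natCounts_eq_or σ i).resolve_right fun h => hb ⟨?_, h.2⟩)
        exact h.1 ▸ i.2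
    refine tendsto_of_tendsto_of_tendsto_of_le_of_le (by simpa using hN.sub hbad)
      (by simpa using hN.add hbad) (fun n => ?_) (fun n => ?_)
    · refine sub_le_iff_le_add.2 (prob_le_add fun σ hσ => ?_)
      exact (hdiff n σ).imp (fun h => h.trans hσ) id
    · exact prob_le_add fun σ hσ => (hdiff n σ).imp (fun h => h.symm.trans hσ) id
  · have hlim : Tendsto (fun n => if (i : CountIndex) = .multiEdges ∧ (j : CountIndex) = .multiEdges
        then expect fun σ : (d n).Pairing => (tripleCount σ : ℝ) else 0) atTop (𝓝 0) := by
      split_ifs with h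
      · exact htriple (h.1 ▸ i.2)
      · exact tendsto_const_nhds
    refine squeeze_zero (fun n => Finset.sum_nonneg fun α _ => Finset.sum_nonneg fun β _ => ?_)
      (fun n => ?_) hlim
    · split_ifs
      · exact edgeProb_nonneg _
      · exact le_rfl
    · refine le_of_eq_of_le ?_ (sum_overlapping_patterns_le (d n) i j)
      refine Finset.sum_congr rfl fun α _ => Finset.sum_congr rfl fun β _ => ?_
      exact if_congr (by rw [Subtype.ext_iff]) rfl rfl

namespace CriticalWindow

variable {ρ₁ p₂ dbar : ℝ≥0} {ν : ℝ≥0∞}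

lemma tendsto_nu_toReal (hν : Tendsto (fun n : ℕ+ => ENNReal.ofReal (d n).nu) atTop (𝓝 ν))
    (hfin : ν ≠ ∞) : Tendsto (fun n : ℕ+ => (d n).nu) atTop (𝓝 ν.toReal) := by
  refine ((ENNReal.tendsto_toReal hfin).comp hν).congr fun n => ?_
  -- `ENNReal.ofReal` truncates nothing here, as `ν_n` is a ratio of nonnegative quantities.
  refine ENNReal.toReal_ofReal ?_
  rw [nu_eq n.ne_zero]
  exact div_nonneg (degPairs_nonneg _) (Nat.cast_nonneg _)

lemma tendsto_sum_edgeProb_patterns (hd : CriticalWindow d ρ₁ p₂ dbar)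
    (hν : Tendsto (fun n : ℕ+ => ENNReal.ofReal (d n).nu) atTop (𝓝 ν))
    (hmax : ν ≠ ∞ →
      Tendsto (fun n : ℕ+ => ((d n).maxDeg : ℝ) / √(n : ℝ)) atTop (𝓝 0))
    {i : CountIndex} (hi : limitMean ρ₁ p₂ dbar ν i ≠ ∞) :
    Tendsto (fun n => ∑ α ∈ patterns (d n) i, edgeProb α) atTop
      (𝓝 (limitMean ρ₁ p₂ dbar ν i).toReal) := by
  have hl := hd.tendsto_card_halfEdge
  have h1 := hd.tendsto_numDeg_one_div
  have h2 := hd.tendsto_numDeg_two_div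
  cases i with
  | line k hk =>
    refine (tendsto_sum_edgeProb_lines hk hl h1 hd.tendsto_numDeg_one_sq_div h2).trans_eq
      (congrArg 𝓝 ?_)
    simp only [limitMean, ENNReal.coe_toReal]
    push_cast
    rw [div_pow, div_mul_div_comm, ← pow_succ', show k - 2 + 1 = k - 1 by omega, div_div,
      mul_comm (2 : ℝ) ((dbar : ℝ) ^ (k - 1))]
  | cycle k hk =>
    refine (tendsto_sum_edgeProb_cycles (by omega : 2 ≤ k) hl h1 h2).trans_eq (congrArg 𝓝 ?_)
    simp only [limitMean, ENNReal.coe_toReal]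
    push_cast
    rw [div_pow, div_div, mul_comm ((dbar : ℝ) ^ k)]
  | selfLoops =>
    have hfin : ν ≠ ∞ := fun h => hi (by simp [limitMean, h, ENNReal.div_eq_top])
    refine (hd.tendsto_sum_edgeProb_loopPatterns (tendsto_nu_toReal hν hfin)).trans_eq
      (congrArg 𝓝 ?_)
    simp [limitMean, ENNReal.toReal_div]
  | multiEdges =>
    have hfin : ν ≠ ∞ := fun h => hi (by simp [limitMean, h, ENNReal.div_eq_top])
    refine (hd.tendsto_sum_edgeProb_doublePatterns (tendsto_nu_toReal hν hfin)
      (hmax hfin)).trans_eq (congrArg 𝓝 ?_)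
    simp [limitMean, ENNReal.toReal_div]

lemma exists_tendsto_patterns_cover (hd : CriticalWindow d ρ₁ p₂ dbar)
    (hν : Tendsto (fun n : ℕ+ => ENNReal.ofReal (d n).nu) atTop (𝓝 ν))
    (hmax : ν ≠ ∞ →
      Tendsto (fun n : ℕ+ => ((d n).maxDeg : ℝ) / √(n : ℝ)) atTop (𝓝 0))
    {i : CountIndex} (hi : limitMean ρ₁ p₂ dbar ν i ≠ ∞) :
    ∃ δ : ℕ+ → ℝ, Tendsto δ atTop (𝓝 0) ∧ ∀ᶠ n in atTop, ∀ h,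
      ∑ β ∈ patterns (d n) i with h ∈ cover β, edgeProb β ≤ δ n := by
  have hl := hd.tendsto_card_halfEdge
  have h1 := hd.tendsto_numDeg_one_div
  have h2 := hd.tendsto_numDeg_two_div
  cases i with
  | line k hk => exact exists_tendsto_compPatterns_cover hk hl h1 h2
  | cycle k hk => exact exists_tendsto_compPatterns_cover (by omega) hl h1 h2
  | selfLoops =>
    have hfin : ν ≠ ∞ := fun h => hi (by simp [limitMean, h, ENNReal.div_eq_top])
    exact hd.exists_tendsto_loopPatterns_cover (hmax hfin)
  | multiEdges =>
    have hfin : ν ≠ ∞ := fun h => hi (by simp [limitMean, h, ENNReal.div_eq_top])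
    exact hd.exists_tendsto_doublePatterns_cover (tendsto_nu_toReal hν hfin) (hmax hfin)

end CriticalWindow
end ConfigModel

theorem mainTheorem4 (d : (n : ℕ+) → ConfigModel.DegreeSequence n) (ρ₁ p₂ dbar : ℝ≥0)
    (hd : ConfigModel.CriticalWindow d ρ₁ p₂ dbar) (ν : ℝ≥0∞)
    (hν : Tendsto (fun n : ℕ+ => ENNReal.ofReal (d n).nu) atTop (𝓝 ν))
    (hmax : ν ≠ ∞ →
      Tendsto (fun n : ℕ+ => ((d n).maxDeg : ℝ) / √(n : ℝ)) atTop (𝓝 0)) :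
    TendstoInDistribution
      (fun (n : ℕ+) (σ : (d n).Pairing) => ConfigModel.counts σ) atTop
      (id : (ConfigModel.CountIndex → ℕ∞) → (ConfigModel.CountIndex → ℕ∞))
      (fun n => (d n).cmMeasure)
      (Measure.infinitePi fun i => ConfigModel.poisson (ConfigModel.limitMean ρ₁ p₂ dbar ν i)) := by
  simp only [ConfigModel.counts_eq_natCounts]
  refine ConfigModel.tendstoInDistribution_poisson
    -- Coordinates with finite mean are handled jointly by Stein's method; an infinite mean can
    -- occur only for `S` and `M`, and only if `ν = ∞`, where the second moment method takes over.
    (Y := fun (n : ℕ+) (σ : (d n).Pairing) => ConfigModel.natCounts σ) (fun F hF x => ?_)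
    fun i hi K => ?_
  · simp only [ConfigModel.measureReal_eq_prob, poissonMeasure_real_singleton,
      ENNReal.coe_toNNReal_eq_toReal]
    refine ConfigModel.tendsto_prob_natCounts hd.tendsto_card_halfEdge F
      (fun i => (ConfigModel.limitMean ρ₁ p₂ dbar ν i).toReal)
      (fun i hi => hd.tendsto_sum_edgeProb_patterns hν hmax (hF i hi))
      (fun i hi => hd.exists_tendsto_patterns_cover hν hmax (hF i hi)) (fun hM => ?_) x
    have hfin : ν ≠ ∞ := fun h => hF _ hM (by simp [ConfigModel.limitMean, h, ENNReal.div_eq_top])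
    exact hd.tendsto_expect_tripleCount (ConfigModel.CriticalWindow.tendsto_nu_toReal hν hfin)
      (hmax hfin)
  · simp only [ConfigModel.measureReal_eq_prob]
    have hnu : ν = ∞ → Tendsto (fun n : ℕ+ => (d n).nu) atTop atTop := fun h =>
      ENNReal.tendsto_ofReal_nhds_top.1 (h ▸ hν)
    cases i with
    | line k hk => exact absurd hi ENNReal.coe_ne_top
    | cycle k hk => exact absurd hi ENNReal.coe_ne_top
    | selfLoops =>
      refine hd.tendsto_prob_selfLoops_lt (hnu ?_) K
      simpa [ConfigModel.limitMean, ENNReal.div_eq_top] using hi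
    | multiEdges =>
      refine hd.tendsto_prob_multiEdges_lt (hnu ?_) K
      simpa [ConfigModel.limitMean, ENNReal.div_eq_top] using hi
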